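/- **Definitions.** All Hopf algebras are over $\mathbb{C}$. A basis $B$ of a finite-dimensional Hopf algebra $H$ is *positive* if all structure constants of $H$ relative to $B$ (multiplication, unit, comultiplication, counit, antipode) are non-negative real numbers. A *quasi-triangular structure* on $H$ is an invertible $R\in H\otimes H$ with $\tau\Delta(g)=R\,\Delta(g)R^{-1}$ for all $g\in H$, $(\Delta\otimes\mathrm{id})R=R_{13}R_{23}$, $(\mathrm{id}\otimes\Delta)R=R_{13}R_{12}$ and $(\varepsilon\otimes\mathrm{id})R=(\mathrm{id}\otimes\varepsilon)R=1$, where $\tau(a\otimes b)=b\otimes a$. It is *triangular* if moreover $(\tau R)R=1\otimes 1$, and *positive* if its coefficients in the basis $B\otimes B$ are non-negative real numbers. A *unique factorization* $G=G_+G_-$ of a group consists of two subgroups such that every $g\in G$ is $g=g_+g_-$ for unique $g_\pm\in G_\pm$. For $u\in G_+$, $x\in G_-$ define ${}^xu,\,u^x\in G_+$ and $x^u,\,{}^ux\in G_-$ by $xu=({}^xu)(x^u)$ and $ux=({}^ux)(u^x)$. If $G$ is finite, $H(G;G_+,G_-)$ is the Hopf algebra with basis $\{g\}$, $g\in G$,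 and $$\{g\}\{h\}=\delta_{g_+^{g_-},\,h_+}\{gh_-\},\quad 1=\sum_{u\in G_+}\{u\},\quad \Delta\{g\}=\sum_{h\in G_+}\{g_+h^{-1}({}^{h}g_-)\}\otimes\{hg_-\},\quad \varepsilon\{g\}=\delta_{g_+,e},\quad S\{g\}=\{g^{-1}\}.$$ For homomorphisms $\xi,\eta:G_+\to G_-$ put $$R_{\xi,\eta}=\sum_{u,v\in G_+}\{u(\eta(v)^u)^{-1}\}\otimes\{v\xi(u)\},\qquad R_\xi=R_{\xi,\xi}.$$ If a group $G_-$ acts on a group $A$ by automorphisms, a *1-cycle* is a map $\zeta:A\to G_-$ with $\zeta(a)\zeta(b)=\zeta(a(\zeta(a)\cdot b))$ for all $a,b\in A$. **Theorem 4.** The following data are in one-to-one correspondence, up to isomorphism: 1. a finite-dimensional Hopf algebra $H$ with a positive basis $B$ and a positive triangular structure $R$; 2. a unique factorization $G=G_+G_-$ of a finite group and a homomorphism $\xi:G_+\to G_-$ such that $A=\{u\xi(u^{-1}):u\in G_+\}$ is an abelian normal subgroup of $G$; 3. a unique factorization $G=G_+G_-$ of a finite group and a homomorphism $\xi:G_+\to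 G_-$ satisfying $uv=({}^{\xi(u)}v)(u^{\xi(v)})$ and $\xi({}^xu)\,x^u=x\,\xi(u)$ for all $u,v\in G_+$, $x\in G_-$; 4. a finite group $G_-$, a finite abelian group $A$ on which $G_-$ acts by automorphisms, and a 1-cycle $\zeta:A\to G_-$. Here an isomorphism in (1) is an isomorphism of Hopf algebras carrying $R$ to $R'$ and $B$ to $B'$ up to multiplying the basis elements by positive real numbers; in (2) and (3) it is a group isomorphism compatible with $G_+$, $G_-$ and $\xi$; in (4) it is a pair of group isomorphisms compatible with the actions and with $\zeta$. The correspondence is as follows. To $(G=G_+G_-,\xi)$ as in (2) corresponds $(H(G;G_+,G_-),\,G,\,R_\xi)$ in (1); the same pair $(G=G_+G_-,\xi)$ in (3); and, in (4), $A=\{u\xi(u^{-1})\}$ with $G_-$ acting by conjugation and $\zeta(u\xi(u^{-1}))=\xi(u)$. Inversely, to $(G_-,A,\zeta)$ corresponds $G=A\rtimes G_-$ with $G_+=\{a\zeta(a):a\in A\}$ and $\xi$ the restriction to $G_+$ of the projection $ax\mapsto x$. Moreover, for a fixed unique factorization $G=G_+G_-$ of a finite group: (i) $\xi\mapsto R_\xi$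 is a bijection from the homomorphisms as in (2) onto the positive triangular structures on $H(G;G_+,G_-)$ with basis $G$; (ii) a homomorphism $\xi$ satisfies the condition in (2) if and only if it satisfies the conditions in (3); (iii) if $\xi,\eta:G_+\to G_-$ are homomorphisms such that $G_+'=\{u\xi(u^{-1}):u\in G_+\}$ and $G_+''=\{\eta(u^{-1})u:u\in G_+\}$ are normal subgroups of $G$ and $u\xi(u^{-1})\mapsto\eta(u)u^{-1}$ is a group isomorphism $G_+'\to G_+''$, then $R_{\xi,\eta}$ is triangular if and only if $\xi=\eta$. -/

import Mathlib

open scoped TensorProduct ComplexOrder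

universe u v

noncomputable section

/-! ### Unique factorizations of groups and the induced actions -/

/-- A unique factorization `G = G₊ G₋`: every `g` is `u * x` for unique `u ∈ pos`, `x ∈ neg`. -/
structure UniqueFactorization (G : Type u) [Group G] where
  pos : Subgroup G
  neg : Subgroup G
  isComplement : pos.IsComplement' neg

namespace UniqueFactorization

variable {G : Type u} [Group G] (F : UniqueFactorization G)

/-- `g₊`, where `g = g₊ g₋`. -/
def posPart (g : G) : F.pos := (Subgroup.IsComplement.equiv F.isComplement g).1

/-- `g₋`, where `g = g₊ g₋`. -/
def negPart (g : G) : F.neg := (Subgroup.IsComplement.equiv F.isComplement g).2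

/-- `ḡ₊`, where `g = ḡ₋ ḡ₊`; see `negBar_mul_posBar`. -/
def posBar (g : G) : F.pos := (F.posPart g⁻¹)⁻¹

/-- `ḡ₋`, where `g = ḡ₋ ḡ₊`; see `negBar_mul_posBar`. -/
def negBar (g : G) : F.neg := (F.negPart g⁻¹)⁻¹

/-- `ˣu`: the `G₊`-part of `x u = (ˣu)(xᵘ)`. -/
def negOnPos (x : F.neg) (u : F.pos) : F.pos := F.posPart (x * u : G)

/-- `xᵘ`: the `G₋`-part of `x u = (ˣu)(xᵘ)`. -/
def negPow (x : F.neg) (u : F.pos) : F.neg := F.negPart (x * u : G)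

/-- `uˣ`: the `G₊`-part of `u x = (ᵘx)(uˣ)`. -/
def posPow (u : F.pos) (x : F.neg) : F.pos := F.posBar (u * x : G)

/-- `ᵘx`: the `G₋`-part of `u x = (ᵘx)(uˣ)`. -/
def posOnNeg (u : F.pos) (x : F.neg) : F.neg := F.negBar (u * x : G)

theorem posPart_mul_negPart (g : G) : (F.posPart g * F.negPart g : G) = g :=
  Subgroup.IsComplement.equiv_fst_mul_equiv_snd F.isComplement g

theorem equiv_mul (u : F.pos) (x : F.neg) :
    Subgroup.IsComplement.equiv F.isComplement (u * x : G) = (u, x) :=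
  (Subgroup.IsComplement.equiv F.isComplement).apply_symm_apply (u, x)

theorem posPart_mul (u : F.pos) (x : F.neg) : F.posPart (u * x : G) = u := by
  rw [posPart, equiv_mul]

theorem negPart_mul (u : F.pos) (x : F.neg) : F.negPart (u * x : G) = x := by
  rw [negPart, equiv_mul]

theorem posPart_eq {g : G} (u : F.pos) (x : F.neg) (h : g = u * x) : F.posPart g = u := by
  rw [h, posPart_mul]

theorem negPart_eq {g : G} (u : F.pos) (x : F.neg) (h : g = u * x) : F.negPart g = x := by
  rw [h, negPart_mul]

theorem negBar_mul_posBar (g : G) : (F.negBar g * F.posBar g : G) = g := by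
  have h := F.posPart_mul_negPart g⁻¹
  rw [negBar, posBar, Subgroup.coe_inv, Subgroup.coe_inv, ← mul_inv_rev, h, inv_inv]

theorem posBar_eq {g : G} (x : F.neg) (u : F.pos) (h : g = x * u) : F.posBar g = u := by
  rw [posBar, F.posPart_eq u⁻¹ x⁻¹ (by simp [h]), inv_inv]

theorem negBar_eq {g : G} (x : F.neg) (u : F.pos) (h : g = x * u) : F.negBar g = x := by
  rw [negBar, F.negPart_eq u⁻¹ x⁻¹ (by simp [h]), inv_inv]

/-- `u x = (ᵘx)(uˣ)`. -/
theorem posOnNeg_mul_posPow (u : F.pos) (x : F.neg) :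
    (F.posOnNeg u x * F.posPow u x : G) = u * x :=
  F.negBar_mul_posBar _

theorem posPow_one (u : F.pos) : F.posPow u 1 = u :=
  F.posBar_eq 1 u (by simp)

theorem one_posPow (x : F.neg) : F.posPow 1 x = 1 := F.posBar_eq x 1 (by simp)

theorem one_posOnNeg (x : F.neg) : F.posOnNeg 1 x = x := F.negBar_eq x 1 (by simp)

theorem posOnNeg_one (u : F.pos) : F.posOnNeg u 1 = 1 := F.negBar_eq 1 u (by simp)

theorem posPow_mul (u : F.pos) (x y : F.neg) :
    F.posPow u (x * y) = F.posPow (F.posPow u x) y := by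
  refine F.posBar_eq (F.posOnNeg u x * F.posOnNeg (F.posPow u x) y) _ ?_
  rw [Subgroup.coe_mul, Subgroup.coe_mul, mul_assoc, posOnNeg_mul_posPow, ← mul_assoc, ← mul_assoc,
    posOnNeg_mul_posPow]

theorem posOnNeg_mul (u : F.pos) (x y : F.neg) :
    F.posOnNeg u (x * y) = F.posOnNeg u x * F.posOnNeg (F.posPow u x) y := by
  refine F.negBar_eq _ (F.posPow (F.posPow u x) y) ?_
  rw [Subgroup.coe_mul, Subgroup.coe_mul, mul_assoc, posOnNeg_mul_posPow, ← mul_assoc, ← mul_assoc,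
    posOnNeg_mul_posPow]

theorem mul_posOnNeg (u v : F.pos) (x : F.neg) :
    F.posOnNeg (u * v) x = F.posOnNeg u (F.posOnNeg v x) := by
  refine F.negBar_eq _ (F.posPow u (F.posOnNeg v x) * F.posPow v x) ?_
  rw [Subgroup.coe_mul, Subgroup.coe_mul, ← mul_assoc, posOnNeg_mul_posPow, mul_assoc, mul_assoc,
    posOnNeg_mul_posPow]

theorem mul_posPow (u v : F.pos) (x : F.neg) :
    F.posPow (u * v) x = F.posPow u (F.posOnNeg v x) * F.posPow v x := by
  refine F.posBar_eq (F.posOnNeg u (F.posOnNeg v x)) _ ?_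
  rw [Subgroup.coe_mul, Subgroup.coe_mul, ← mul_assoc, posOnNeg_mul_posPow, mul_assoc, mul_assoc,
    posOnNeg_mul_posPow]

/-- The right action of `x` on `G₊` as a permutation. -/
def posPowEquiv (x : F.neg) : F.pos ≃ F.pos where
  toFun u := F.posPow u x
  invFun u := F.posPow u x⁻¹
  left_inv u := by simp only [← posPow_mul, mul_inv_cancel, posPow_one]
  right_inv u := by simp only [← posPow_mul, inv_mul_cancel, posPow_one]

theorem posPow_eq_one_iff (u : F.pos) (x : F.neg) : F.posPow u x = 1 ↔ u = 1 := by
  have h := (F.posPowEquiv x).injective.eq_iff (a := u) (b := 1)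
  simpa only [posPowEquiv, Equiv.coe_fn_mk, one_posPow] using h

theorem posPow_inv (p : F.pos) (x : F.neg) :
    F.posPow (F.posPow p x)⁻¹ (F.posOnNeg p x)⁻¹ = p⁻¹ := by
  refine F.posBar_eq x⁻¹ _ ?_
  simp only [Subgroup.coe_inv]
  rw [← mul_inv_rev, ← mul_inv_rev, posOnNeg_mul_posPow]

theorem inv_posPow (p : F.pos) (x : F.neg) :
    F.posPow p⁻¹ (F.posOnNeg p x) = (F.posPow p x)⁻¹ := by
  have h := F.mul_posPow p⁻¹ p x
  rw [inv_mul_cancel, one_posPow] at h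
  exact eq_inv_of_mul_eq_one_left h.symm

theorem posOnNeg_cancel (p q : F.pos) (x : F.neg) :
    F.posOnNeg (p * q⁻¹) (F.posOnNeg q x) = F.posOnNeg p x := by
  rw [← mul_posOnNeg, inv_mul_cancel_right]

instance fintypePos [Finite G] : Fintype F.pos := Fintype.ofFinite _

instance decidableEqPos : DecidableEq F.pos := Classical.decEq _

end UniqueFactorization

/-! ### The bicrossproduct Hopf algebra `H(G; G₊, G₋)` -/

/-- The underlying vector space of `H(G; G₊, G₋)`, spanned by the set `G`. -/
def Bicross {G : Type u} [Group G] (_F : UniqueFactorization G) : Type u := G →₀ ℂ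

namespace Bicross

variable {G : Type u} [Group G] (F : UniqueFactorization G)

instance : AddCommGroup (Bicross F) := inferInstanceAs (AddCommGroup (G →₀ ℂ))
instance : Module ℂ (Bicross F) := inferInstanceAs (Module ℂ (G →₀ ℂ))

/-- The basis `G` of `H(G; G₊, G₋)`; `basis F g` is the element written `{g}`. -/
def basis : Module.Basis G ℂ (Bicross F) := ⟨LinearEquiv.refl ℂ (G →₀ ℂ)⟩

/-- Multiplication: `{g}{h} = {g h₋}` if `g₊ ^ g₋ = h₊`, and `0` otherwise. -/
def mulMap : Bicross F →ₗ[ℂ] Bicross F →ₗ[ℂ] Bicross F :=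
  (basis F).constr ℂ fun g => (basis F).constr ℂ fun h =>
    if F.posPow (F.posPart g) (F.negPart g) = F.posPart h then basis F (g * F.negPart h) else 0

/-- Counit: `ε{g} = 1` if `g₊ = e`, and `0` otherwise. -/
def counitMap : Bicross F →ₗ[ℂ] ℂ :=
  (basis F).constr ℂ fun g => if F.posPart g = 1 then 1 else 0

/-- Antipode: `S{g} = {g⁻¹}`. -/
def antipodeMap : Bicross F →ₗ[ℂ] Bicross F :=
  (basis F).constr ℂ fun g => basis F g⁻¹

/-- The basis element `{u x}`, for `u ∈ G₊` and `x ∈ G₋`. -/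
def el (p : F.pos) (x : F.neg) : Bicross F := basis F (p * x : G)

theorem basis_eq_el (g : G) : basis F g = el F (F.posPart g) (F.negPart g) := by
  rw [el, F.posPart_mul_negPart]

theorem ext_el {M : Type v} [AddCommMonoid M] [Module ℂ M] {f f' : Bicross F →ₗ[ℂ] M}
    (h : ∀ p x, f (el F p x) = f' (el F p x)) : f = f' :=
  (basis F).ext fun g => by rw [basis_eq_el]; exact h _ _

theorem mulMap_el (p q : F.pos) (x y : F.neg) :
    mulMap F (el F p x) (el F q y) = if F.posPow p x = q then el F p (x * y) else 0 := by
  simp only [mulMap, el, Module.Basis.constr_basis, F.posPart_mul, F.negPart_mul,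
    Subgroup.coe_mul, mul_assoc]

theorem counitMap_el (p : F.pos) (x : F.neg) :
    counitMap F (el F p x) = if p = 1 then 1 else 0 := by
  simp only [counitMap, el, Module.Basis.constr_basis, F.posPart_mul]

theorem antipodeMap_el (p : F.pos) (x : F.neg) :
    antipodeMap F (el F p x) = el F (F.posPow p x)⁻¹ (F.posOnNeg p x)⁻¹ := by
  simp only [antipodeMap, el, Module.Basis.constr_basis, Subgroup.coe_inv]
  rw [← F.posOnNeg_mul_posPow, mul_inv_rev]

theorem mulMap_assoc (a b c : Bicross F) :
    mulMap F (mulMap F a b) c = mulMap F a (mulMap F b c) := by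
  have key : (mulMap F).compr₂ (mulMap F) =
      (LinearMap.lcomp ℂ _ (mulMap F)).comp ((LinearMap.llcomp ℂ _ _ _).comp (mulMap F)) := by
    refine ext_el F fun p x => ext_el F fun q y => ext_el F fun r z => ?_
    simp only [LinearMap.compr₂_apply, LinearMap.comp_apply, LinearMap.lcomp_apply,
      LinearMap.llcomp_apply, mulMap_el]
    by_cases h₁ : F.posPow p x = q
    · by_cases h₂ : F.posPow q y = r
      · simp [h₁, h₂, mulMap_el, F.posPow_mul, mul_assoc]
      · simp [h₁, h₂, mulMap_el, F.posPow_mul]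
    · by_cases h₂ : F.posPow q y = r
      · simp [h₁, h₂, mulMap_el]
      · simp [h₁, h₂]
  exact LinearMap.congr_fun (LinearMap.congr_fun (LinearMap.congr_fun key a) b) c

variable [Finite G]

/-- Unit: `1 = ∑_{u ∈ G₊} {u}`. -/
def unit : Bicross F := ∑ w : F.pos, basis F (w : G)

/-- Comultiplication: `Δ{g} = ∑_{h ∈ G₊} {g₊ h⁻¹ (ʰg₋)} ⊗ {h g₋}`. -/
def comulMap : Bicross F →ₗ[ℂ] Bicross F ⊗[ℂ] Bicross F :=
  (basis F).constr ℂ fun g => ∑ h : F.pos,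
    basis F (F.posPart g * (h : G)⁻¹ * F.posOnNeg h (F.negPart g)) ⊗ₜ[ℂ]
      basis F (h * F.negPart g : G)

theorem unit_eq : unit F = ∑ w : F.pos, el F w 1 := by simp [unit, el]

theorem comulMap_el (p : F.pos) (x : F.neg) :
    comulMap F (el F p x) =
      ∑ h : F.pos, el F (p * h⁻¹) (F.posOnNeg h x) ⊗ₜ[ℂ] el F h x := by
  simp only [comulMap, el, Module.Basis.constr_basis, F.posPart_mul, F.negPart_mul,
    Subgroup.coe_mul, Subgroup.coe_inv]

theorem unit_mulMap (a : Bicross F) : mulMap F (unit F) a = a := by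
  have key : mulMap F (unit F) = LinearMap.id := by
    refine ext_el F fun p x => ?_
    simp [unit_eq, mulMap_el, F.posPow_one]
  exact LinearMap.congr_fun key a

theorem mulMap_unit (a : Bicross F) : mulMap F a (unit F) = a := by
  have key : (mulMap F).flip (unit F) = LinearMap.id := by
    refine ext_el F fun p x => ?_
    simp [unit_eq, mulMap_el]
  exact LinearMap.congr_fun key a

instance : Ring (Bicross F) where
  __ := (inferInstance : AddCommGroup (Bicross F))
  mul a b := mulMap F a b
  one := unit F
  left_distrib a b c := map_add (mulMap F a) b c
  right_distrib a b c := LinearMap.map_add₂ (mulMap F) a b c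
  zero_mul a := LinearMap.map_zero₂ (mulMap F) a
  mul_zero a := map_zero (mulMap F a)
  mul_assoc := mulMap_assoc F
  one_mul := unit_mulMap F
  mul_one := mulMap_unit F

instance : Algebra ℂ (Bicross F) :=
  Algebra.ofModule (fun r a b => LinearMap.map_smul₂ (mulMap F) r a b)
    (fun r a b => map_smul (mulMap F a) r b)

theorem el_mul_el (p q : F.pos) (x y : F.neg) :
    el F p x * el F q y = if F.posPow p x = q then el F p (x * y) else 0 :=
  mulMap_el F p q x y

theorem one_eq : (1 : Bicross F) = ∑ w : F.pos, el F w 1 := unit_eq F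

instance : Coalgebra ℂ (Bicross F) where
  comul := comulMap F
  counit := counitMap F
  coassoc := by
    refine ext_el F fun p x => ?_
    simp only [LinearMap.comp_apply, comulMap_el, map_sum, LinearMap.rTensor_tmul,
      LinearMap.lTensor_tmul, TensorProduct.sum_tmul, TensorProduct.tmul_sum,
      LinearEquiv.coe_coe, TensorProduct.assoc_tmul]
    rw [Finset.sum_comm (s := Finset.univ) (t := Finset.univ)
      (f := fun h k => el F (p * h⁻¹) (F.posOnNeg h x) ⊗ₜ[ℂ]
        (el F (h * k⁻¹) (F.posOnNeg k x) ⊗ₜ[ℂ] el F k x))]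
    refine Finset.sum_congr rfl fun k _ => ?_
    refine Fintype.sum_equiv (Equiv.mulRight k) _ _ fun h => ?_
    simp [mul_assoc, F.mul_posOnNeg]
  rTensor_counit_comp_comul := by
    refine ext_el F fun p x => ?_
    simp [comulMap_el, counitMap_el, mul_inv_eq_one, TensorProduct.ite_tmul]
  lTensor_counit_comp_comul := by
    refine ext_el F fun p x => ?_
    simp [comulMap_el, counitMap_el, F.one_posOnNeg, TensorProduct.tmul_ite]

theorem comul_el (p : F.pos) (x : F.neg) :
    Coalgebra.comul (R := ℂ) (el F p x) =
      ∑ h : F.pos, el F (p * h⁻¹) (F.posOnNeg h x) ⊗ₜ[ℂ] el F h x :=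
  comulMap_el F p x

theorem counit_el (p : F.pos) (x : F.neg) :
    Coalgebra.counit (R := ℂ) (el F p x) = if p = 1 then 1 else 0 :=
  counitMap_el F p x

instance : Bialgebra ℂ (Bicross F) where
  counit_one := by
    simp [one_eq, counit_el]
  mul_compr₂_counit := by
    refine ext_el F fun p x => ext_el F fun q y => ?_
    simp only [LinearMap.compr₂_apply, LinearMap.compl₁₂_apply, LinearMap.mul_apply', el_mul_el,
      counit_el]
    by_cases hp : p = 1
    · subst hp
      by_cases hq : q = 1
      · simp [hq, F.one_posPow, counit_el]
      · simp [hq, Ne.symm hq, F.one_posPow]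
    · split_ifs <;> simp_all [counit_el]
  comul_one := by
    simp only [one_eq, map_sum, comul_el, Algebra.TensorProduct.one_def, TensorProduct.sum_tmul,
      TensorProduct.tmul_sum, F.posOnNeg_one]
    rw [Finset.sum_comm]
    refine Finset.sum_congr rfl fun k _ => ?_
    exact Fintype.sum_equiv (Equiv.mulRight k⁻¹) _ _ fun h => by simp
  mul_compr₂_comul := by
    refine ext_el F fun p x => ext_el F fun q y => ?_
    simp only [LinearMap.compr₂_apply, LinearMap.compl₁₂_apply, LinearMap.mul_apply', el_mul_el,
      comul_el, Finset.sum_mul_sum, Algebra.TensorProduct.tmul_mul_tmul]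
    have h₁ : ∀ k l : F.pos,
        (if F.posPow (p * k⁻¹) (F.posOnNeg k x) = q * l⁻¹ then
          el F (p * k⁻¹) (F.posOnNeg k x * F.posOnNeg l y) else 0) ⊗ₜ[ℂ]
        (if F.posPow k x = l then el F k (x * y) else 0) =
        if F.posPow k x = l then
          (if F.posPow p x = q then
            el F (p * k⁻¹) (F.posOnNeg k (x * y)) ⊗ₜ[ℂ] el F k (x * y) else 0) else 0 := by
      intro k l
      by_cases hl : F.posPow k x = l
      · subst hl
        have h₂ := F.mul_posPow (p * k⁻¹) k x
        rw [inv_mul_cancel_right] at h₂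
        have h₃ : F.posPow (p * k⁻¹) (F.posOnNeg k x) = q * (F.posPow k x)⁻¹ ↔
            F.posPow p x = q := by
          rw [eq_mul_inv_iff_mul_eq, ← h₂]
        by_cases hq : F.posPow p x = q
        · rw [if_pos (h₃.2 hq)]
          simp [hq, F.posOnNeg_mul]
        · rw [if_neg (mt h₃.1 hq)]
          simp [hq]
      · simp [hl]
    simp only [h₁, Finset.sum_ite_eq, Finset.mem_univ, if_true]
    by_cases hq : F.posPow p x = q
    · simp [hq, comul_el]
    · simp [hq]

instance : HopfAlgebra ℂ (Bicross F) where
  antipode := antipodeMap F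
  mul_antipode_rTensor_comul := by
    refine ext_el F fun p x => ?_
    simp only [LinearMap.comp_apply, comul_el, counit_el, map_sum, LinearMap.rTensor_tmul,
      LinearMap.mul'_apply, antipodeMap_el, Algebra.linearMap_apply, el_mul_el, F.posPow_inv]
    by_cases hp : p = 1
    · subst hp
      simp only [one_mul, inv_inv, if_true, F.inv_posPow, map_one, one_eq]
      refine Fintype.sum_equiv (F.posPowEquiv x) _ _ fun h => ?_
      have h₁ : F.posOnNeg h⁻¹ (F.posOnNeg h x) = x := by
        rw [← F.mul_posOnNeg, inv_mul_cancel, F.one_posOnNeg]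
      simp [h₁, UniqueFactorization.posPowEquiv]
    · simp [hp]
  mul_antipode_lTensor_comul := by
    refine ext_el F fun p x => ?_
    simp only [LinearMap.comp_apply, comul_el, counit_el, map_sum, LinearMap.lTensor_tmul,
      LinearMap.mul'_apply, antipodeMap_el, Algebra.linearMap_apply, el_mul_el]
    have h₁ : ∀ h : F.pos,
        F.posPow (p * h⁻¹) (F.posOnNeg h x) = (F.posPow h x)⁻¹ ↔ p = 1 := fun h => by
      have h₂ := F.mul_posPow (p * h⁻¹) h x
      rw [inv_mul_cancel_right] at h₂
      rw [eq_inv_iff_mul_eq_one, ← h₂, F.posPow_eq_one_iff]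
    simp only [h₁, mul_inv_cancel]
    by_cases hp : p = 1
    · subst hp
      simp only [one_mul, if_true, map_one, one_eq]
      exact Fintype.sum_equiv (Equiv.inv _) _ _ fun h => by simp
    · simp [hp]

end Bicross

/-! ### Positive bases and (quasi-)triangular structures -/

section Triangular

variable {H : Type u} [Ring H] [HopfAlgebra ℂ H]

/-- All structure constants of `H` (multiplication, unit, comultiplication, counit, antipode)
relative to `b` are non-negative real numbers (the order on `ℂ` is the one with
`0 ≤ z ↔ 0 ≤ z.re ∧ z.im = 0`). -/
structure IsPositiveBasis {ι : Type v} (b : Module.Basis ι ℂ H) : Prop where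
  mul_nonneg : ∀ i j k, 0 ≤ b.repr (b i * b j) k
  one_nonneg : ∀ i, 0 ≤ b.repr 1 i
  comul_nonneg : ∀ i j k, 0 ≤ (b.tensorProduct b).repr (Coalgebra.comul (R := ℂ) (b i)) (j, k)
  counit_nonneg : ∀ i, 0 ≤ Coalgebra.counit (R := ℂ) (b i)
  antipode_nonneg : ∀ i j, 0 ≤ b.repr (HopfAlgebra.antipode ℂ (b i)) j

/-- `R ∈ H ⊗ H` has non-negative real coefficients in the basis `b ⊗ b`. -/
def IsPositiveTensor {ι : Type v} (b : Module.Basis ι ℂ H) (R : H ⊗[ℂ] H) : Prop :=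
  ∀ i j, 0 ≤ (b.tensorProduct b).repr R (i, j)

/-- `R₁₂ = R ⊗ 1`. -/
def leg₁₂ (R : H ⊗[ℂ] H) : H ⊗[ℂ] (H ⊗[ℂ] H) := TensorProduct.assoc ℂ H H H (R ⊗ₜ[ℂ] 1)

/-- `R₁₃`: the image of `R` under `a ⊗ b ↦ a ⊗ 1 ⊗ b`. -/
def leg₁₃ (R : H ⊗[ℂ] H) : H ⊗[ℂ] (H ⊗[ℂ] H) :=
  LinearMap.lTensor H (TensorProduct.mk ℂ H H 1) R

/-- `R₂₃ = 1 ⊗ R`. -/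
def leg₂₃ (R : H ⊗[ℂ] H) : H ⊗[ℂ] (H ⊗[ℂ] H) := 1 ⊗ₜ[ℂ] R

structure IsQuasiTriangular (R : H ⊗[ℂ] H) : Prop where
  /-- `R` is invertible, and `τ Δ(g) = R Δ(g) R⁻¹`. -/
  exists_inv : ∃ S : H ⊗[ℂ] H, R * S = 1 ∧ S * R = 1 ∧ ∀ g : H,
    TensorProduct.comm ℂ H H (Coalgebra.comul (R := ℂ) g) = R * Coalgebra.comul (R := ℂ) g * S
  /-- `(Δ ⊗ id) R = R₁₃ R₂₃`. -/
  comul_left : TensorProduct.assoc ℂ H H H (LinearMap.rTensor H (Coalgebra.comul (R := ℂ)) R) =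
    leg₁₃ R * leg₂₃ R
  /-- `(id ⊗ Δ) R = R₁₃ R₁₂`. -/
  comul_right : LinearMap.lTensor H (Coalgebra.comul (R := ℂ)) R = leg₁₃ R * leg₁₂ R
  /-- `(ε ⊗ id) R = 1`. -/
  counit_left : TensorProduct.lid ℂ H (LinearMap.rTensor H (Coalgebra.counit (R := ℂ)) R) = 1
  /-- `(id ⊗ ε) R = 1`. -/
  counit_right : TensorProduct.rid ℂ H (LinearMap.lTensor H (Coalgebra.counit (R := ℂ)) R) = 1

/-- A quasi-triangular structure with `(τ R) R = 1 ⊗ 1`. -/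
structure IsTriangular (R : H ⊗[ℂ] H) : Prop extends IsQuasiTriangular R where
  comm_mul_self : TensorProduct.comm ℂ H H R * R = 1

end Triangular

/-! ### First kind of data: Hopf algebras with positive basis and positive triangular structure -/

/-- A finite-dimensional complex Hopf algebra with a positive basis and a positive triangular
structure. -/
structure PosTriHopf where
  H : Type u
  [ring : Ring H]
  [hopf : HopfAlgebra ℂ H]
  ι : Type u
  [finite : Finite ι]
  b : Module.Basis ι ℂ H
  R : H ⊗[ℂ] H
  isPositiveBasis : IsPositiveBasis b
  isTriangular : IsTriangular R
  isPositiveTensor : IsPositiveTensor b R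

attribute [instance] PosTriHopf.ring PosTriHopf.hopf PosTriHopf.finite

/-- Isomorphism: an isomorphism of bialgebras (hence of Hopf algebras) that carries one basis to
the other up to multiplying the basis elements by positive real numbers, and carries one
triangular structure to the other. -/
def PosTriHopf.Iso (X Y : PosTriHopf.{u}) : Prop :=
  ∃ e : X.H ≃ₐc[ℂ] Y.H,
    (∃ (σ : X.ι ≃ Y.ι) (c : X.ι → ℝ), ∀ i, 0 < c i ∧ e (X.b i) = (c i : ℂ) • Y.b (σ i)) ∧
    TensorProduct.congr e.toCoalgEquiv.toLinearEquiv e.toCoalgEquiv.toLinearEquiv X.R = Y.R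

instance PosTriHopf.setoid : Setoid PosTriHopf.{u} where
  r := PosTriHopf.Iso
  iseqv :=
    { refl := fun X => ⟨BialgEquiv.refl ℂ X.H, ⟨Equiv.refl _, fun _ => 1, fun i => by simp⟩, by
        change TensorProduct.congr (LinearEquiv.refl ℂ X.H) (LinearEquiv.refl ℂ X.H) X.R = X.R
        simp⟩
      symm := by
        rintro X Y ⟨e, ⟨σ, c, h⟩, hR⟩
        refine ⟨e.symm, ⟨σ.symm, fun i => (c (σ.symm i))⁻¹, fun i => ⟨inv_pos.2 (h _).1, ?_⟩⟩, ?_⟩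
        · have h₁ := (h (σ.symm i)).2
          have h₂ : (c (σ.symm i) : ℂ) ≠ 0 := by exact_mod_cast (h (σ.symm i)).1.ne'
          rw [Equiv.apply_symm_apply] at h₁
          have h₃ : Y.b i = e ((c (σ.symm i) : ℂ)⁻¹ • X.b (σ.symm i)) := by
            rw [map_smul, h₁, smul_smul, inv_mul_cancel₀ h₂, one_smul]
          rw [h₃]
          simp
        · rw [← hR]
          exact (TensorProduct.congr e.toCoalgEquiv.toLinearEquiv
            e.toCoalgEquiv.toLinearEquiv).symm_apply_apply X.R
      trans := by
        rintro X Y Z ⟨e, ⟨σ, c, h⟩, hR⟩ ⟨e', ⟨σ', c', h'⟩, hR'⟩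
        refine ⟨e.trans e', ⟨σ.trans σ', fun i => c i * c' (σ i),
          fun i => ⟨mul_pos (h i).1 (h' _).1, ?_⟩⟩, ?_⟩
        · change e' (e (X.b i)) = _
          rw [(h i).2, map_smul, (h' _).2, smul_smul]
          simp
        · rw [← hR', ← hR]
          change TensorProduct.congr
            (e.toCoalgEquiv.toLinearEquiv.trans e'.toCoalgEquiv.toLinearEquiv)
            (e.toCoalgEquiv.toLinearEquiv.trans e'.toCoalgEquiv.toLinearEquiv) X.R = _
          rw [TensorProduct.congr_trans]
          rfl }

/-! ### Second and third kind of data: unique factorizations with a homomorphism -/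

namespace UniqueFactorization

variable {G : Type u} [Group G] (F : UniqueFactorization G)

/-- The set `{u ξ(u⁻¹) : u ∈ G₊}`. -/
def leftSet (ξ : F.pos →* F.neg) : Set G := Set.range fun p : F.pos => (p * ξ p⁻¹ : G)

/-- The set `{η(u⁻¹) u : u ∈ G₊}`. -/
def rightSet (η : F.pos →* F.neg) : Set G := Set.range fun p : F.pos => (η p⁻¹ * p : G)

/-- `{u ξ(u⁻¹) : u ∈ G₊}` is an abelian normal subgroup of `G`. -/
def IsAbelianNormal (ξ : F.pos →* F.neg) : Prop :=
  ∃ A : Subgroup G, (A : Set G) = F.leftSet ξ ∧ A.Normal ∧ ∀ a ∈ A, ∀ b ∈ A, a * b = b * a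

/-- `u v = (^{ξ(u)} v)(u ^ {ξ(v)})` and `ξ(ˣu) xᵘ = x ξ(u)` for `u, v ∈ G₊`, `x ∈ G₋`. -/
def IsBraided (ξ : F.pos →* F.neg) : Prop :=
  (∀ p q : F.pos, p * q = F.negOnPos (ξ p) q * F.posPow p (ξ q)) ∧
  ∀ (p : F.pos) (x : F.neg), ξ (F.negOnPos x p) * F.negPow x p = x * ξ p

/-- `G₊' = {u ξ(u⁻¹)}` and `G₊'' = {η(u⁻¹) u}` are normal subgroups of `G`, and
`u ξ(u⁻¹) ↦ η(u) u⁻¹` is an isomorphism of groups `G₊' → G₊''`. -/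
def IsQuasiTriangularPair (ξ η : F.pos →* F.neg) : Prop :=
  ∃ A B : Subgroup G, (A : Set G) = F.leftSet ξ ∧ (B : Set G) = F.rightSet η ∧
    A.Normal ∧ B.Normal ∧
    ∃ f : A ≃* B, ∀ (p : F.pos) (a : A), (a : G) = p * ξ p⁻¹ → (f a : G) = η p * (p : G)⁻¹

/-- `R = ∑_{u, v ∈ G₊} {u (η(v)ᵘ)⁻¹} ⊗ {v ξ(u)}`. -/
def rMatrix [Finite G] (ξ η : F.pos →* F.neg) : Bicross F ⊗[ℂ] Bicross F :=
  ∑ p : F.pos, ∑ q : F.pos,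
    Bicross.basis F (p * (F.negPow (η q) p : G)⁻¹) ⊗ₜ[ℂ] Bicross.basis F (q * ξ p : G)

end UniqueFactorization

/-- A unique factorization `G = G₊ G₋` of a finite group with a homomorphism `ξ : G₊ → G₋`. -/
structure FactHom where
  G : Type u
  [group : Group G]
  [finite : Finite G]
  F : UniqueFactorization G
  ξ : F.pos →* F.neg

attribute [instance] FactHom.group FactHom.finite

/-- Isomorphism: a group isomorphism carrying `G₊`, `G₋`, `ξ` to `G₊`, `G₋`, `ξ`. -/
def FactHom.Iso (X Y : FactHom.{u}) : Prop :=
  ∃ f : X.G ≃* Y.G, (∀ g, f g ∈ Y.F.pos ↔ g ∈ X.F.pos) ∧ (∀ g, f g ∈ Y.F.neg ↔ g ∈ X.F.neg) ∧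
    ∀ (p : X.F.pos) (q : Y.F.pos), f p = q → f (X.ξ p) = Y.ξ q

instance FactHom.setoid : Setoid FactHom.{u} where
  r := FactHom.Iso
  iseqv :=
    { refl := fun X => ⟨MulEquiv.refl _, fun _ => Iff.rfl, fun _ => Iff.rfl, fun p q h => by
        obtain rfl : p = q := Subtype.ext h
        rfl⟩
      symm := by
        rintro X Y ⟨f, h₁, h₂, h₃⟩
        refine ⟨f.symm, fun g => ?_, fun g => ?_, fun p q h => ?_⟩
        · rw [← h₁, f.apply_symm_apply]
        · rw [← h₂, f.apply_symm_apply]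
        · rw [MulEquiv.symm_apply_eq] at h ⊢
          exact (h₃ q p h.symm).symm
      trans := by
        rintro X Y Z ⟨f, h₁, h₂, h₃⟩ ⟨f', h₁', h₂', h₃'⟩
        refine ⟨f.trans f', fun g => (h₁' _).trans (h₁ _), fun g => (h₂' _).trans (h₂ _),
          fun p q h => ?_⟩
        exact (congrArg f' (h₃ p ⟨f p, (h₁ _).2 p.2⟩ rfl)).trans (h₃' _ q h) }

/-- Second kind of data: `{u ξ(u⁻¹) : u ∈ G₊}` is an abelian normal subgroup. -/
abbrev AbelianFact := {X : FactHom.{u} // X.F.IsAbelianNormal X.ξ}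

/-- Third kind of data: `u v = (^{ξ(u)} v)(u ^ {ξ(v)})` and `ξ(ˣu) xᵘ = x ξ(u)`. -/
abbrev BraidedFact := {X : FactHom.{u} // X.F.IsBraided X.ξ}

instance AbelianFact.setoid : Setoid AbelianFact.{u} := FactHom.setoid.comap Subtype.val

instance BraidedFact.setoid : Setoid BraidedFact.{u} := FactHom.setoid.comap Subtype.val

/-! ### Fourth kind of data: actions on abelian groups with a 1-cycle -/

/-- A finite group `N` (in the role of `G₋`) acting on a finite abelian group `A` by
automorphisms, and a 1-cycle `ζ : A → N`. -/
structure CycleData where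
  N : Type u
  A : Type u
  [groupN : Group N]
  [finiteN : Finite N]
  [groupA : CommGroup A]
  [finiteA : Finite A]
  [action : MulDistribMulAction N A]
  ζ : A → N
  cycle : ∀ a b, ζ a * ζ b = ζ (a * ζ a • b)

attribute [instance] CycleData.groupN CycleData.finiteN CycleData.groupA CycleData.finiteA
  CycleData.action

/-- Isomorphism: compatible isomorphisms of both groups. -/
def CycleData.Iso (X Y : CycleData.{u}) : Prop :=
  ∃ (φ : X.N ≃* Y.N) (ψ : X.A ≃* Y.A),
    (∀ x a, ψ (x • a) = φ x • ψ a) ∧ ∀ a, φ (X.ζ a) = Y.ζ (ψ a)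

instance CycleData.setoid : Setoid CycleData.{u} where
  r := CycleData.Iso
  iseqv :=
    { refl := fun X => ⟨MulEquiv.refl _, MulEquiv.refl _, fun _ _ => rfl, fun _ => rfl⟩
      symm := by
        rintro X Y ⟨φ, ψ, h₁, h₂⟩
        refine ⟨φ.symm, ψ.symm, fun x a => ?_, fun a => ?_⟩
        · rw [MulEquiv.symm_apply_eq, h₁]
          simp
        · rw [MulEquiv.symm_apply_eq, h₂]
          simp
      trans := by
        rintro X Y Z ⟨φ, ψ, h₁, h₂⟩ ⟨φ', ψ', h₁', h₂'⟩
        refine ⟨φ.trans φ', ψ.trans ψ', fun x a => ?_, fun a => ?_⟩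
        · simp [h₁, h₁']
        · simp [h₂, h₂'] }

theorem CycleData.ζ_one (Y : CycleData.{u}) : Y.ζ 1 = 1 := by
  have h := Y.cycle 1 1
  rwa [smul_one, mul_one, mul_eq_left] at h

/-- The semi-direct product `A ⋊ N`, with `(a x)(b y) = a (x • b) x y`. -/
abbrev CycleData.Semidirect (Y : CycleData.{u}) : Type u :=
  Y.A ⋊[MulDistribMulAction.toMulAut Y.N Y.A] Y.N

instance (Y : CycleData.{u}) : Finite Y.Semidirect :=
  Finite.of_equiv _ SemidirectProduct.equivProd.symm

/-- The subgroup `{a ζ(a) : a ∈ A}` of `A ⋊ N`. -/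
def CycleData.graph (Y : CycleData.{u}) : Subgroup Y.Semidirect where
  carrier := Set.range fun a : Y.A => ⟨a, Y.ζ a⟩
  one_mem' := ⟨1, SemidirectProduct.ext rfl Y.ζ_one⟩
  mul_mem' := by
    rintro _ _ ⟨a, rfl⟩ ⟨b, rfl⟩
    exact ⟨a * Y.ζ a • b, SemidirectProduct.ext rfl (Y.cycle a b).symm⟩
  inv_mem' := by
    rintro _ ⟨a, rfl⟩
    refine ⟨(Y.ζ a)⁻¹ • a⁻¹, SemidirectProduct.ext rfl ?_⟩
    have h := Y.cycle a ((Y.ζ a)⁻¹ • a⁻¹)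
    rw [smul_inv_smul, mul_inv_cancel, Y.ζ_one] at h
    exact eq_inv_of_mul_eq_one_right h

/-- The unique factorization of `G = A ⋊ N` with `G₊ = {a ζ(a)}` and `G₋ = N`. -/
def CycleData.factorization (Y : CycleData.{u}) : UniqueFactorization Y.Semidirect where
  pos := Y.graph
  neg := (SemidirectProduct.inr : Y.N →* Y.Semidirect).range
  isComplement := by
    constructor
    · rintro ⟨⟨_, a, rfl⟩, ⟨_, x, rfl⟩⟩ ⟨⟨_, b, rfl⟩, ⟨_, y, rfl⟩⟩ h
      obtain rfl : a = b := by simpa using congrArg SemidirectProduct.left h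
      obtain rfl : x = y := by simpa using congrArg SemidirectProduct.right h
      rfl
    · rintro ⟨a, x⟩
      refine ⟨⟨⟨_, a, rfl⟩, ⟨_, (Y.ζ a)⁻¹ * x, rfl⟩⟩, ?_⟩
      ext <;> simp

/-- From the fourth kind of data: `G = A ⋊ N`, `G₊ = {a ζ(a)}`, `G₋ = N`, and `ξ : G₊ → G₋` the
restriction of the projection `a x ↦ x`. -/
def CycleData.toFactHom (Y : CycleData.{u}) : FactHom.{u} where
  G := Y.Semidirect
  F := Y.factorization
  ξ := (SemidirectProduct.inr : Y.N →* Y.Semidirect).rangeRestrict.comp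
    (SemidirectProduct.rightHom.comp Y.graph.subtype)

namespace AbelianFact

variable (X : AbelianFact.{u})

/-- The subgroup `A = {u ξ(u⁻¹) : u ∈ G₊}` of `G`. -/
def subgroup : Subgroup X.1.G :=
  X.2.choose.copy (X.1.F.leftSet X.1.ξ) X.2.choose_spec.1.symm

theorem subgroup_eq : X.subgroup = X.2.choose := Subgroup.copy_eq _ _ _

instance subgroup_normal : X.subgroup.Normal := X.subgroup_eq ▸ X.2.choose_spec.2.1

instance : CommGroup X.subgroup where
  __ := (inferInstance : Group X.subgroup)
  mul_comm a b := Subtype.ext <| X.2.choose_spec.2.2 a (X.subgroup_eq ▸ a.2) b (X.subgroup_eq ▸ b.2)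

/-- `G₋` acts on `A` by conjugation: `x • a = x a x⁻¹`. -/
instance : MulDistribMulAction X.1.F.neg X.subgroup :=
  MulDistribMulAction.compHom X.subgroup
    ((MulAut.conjNormal : X.1.G →* MulAut X.subgroup).comp X.1.F.neg.subtype)

theorem coe_smul (x : X.1.F.neg) (a : X.subgroup) :
    ((x • a : X.subgroup) : X.1.G) = x * a * (x : X.1.G)⁻¹ :=
  MulAut.conjNormal_apply (x : X.1.G) a

/-- From the second kind of data: `G₋` acts on `A = {u ξ(u⁻¹)}` by conjugation, and
`ζ(u ξ(u⁻¹)) = ξ(u)`. Note that `u` is the `G₊`-part of `u ξ(u⁻¹)`. -/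
def toCycleData : CycleData.{u} where
  N := X.1.F.neg
  A := X.subgroup
  ζ a := X.1.ξ (X.1.F.posPart a)
  cycle := by
    rintro ⟨_, p, rfl⟩ ⟨_, q, rfl⟩
    rw [← map_mul]
    congr 1
    have h : ∀ r : X.1.F.pos, X.1.F.posPart (r * X.1.ξ r⁻¹ : X.1.G) = r :=
      fun r => X.1.F.posPart_mul _ _
    refine (X.1.F.posPart_eq _ (X.1.ξ (p * q)⁻¹) ?_).symm
    rw [Subgroup.coe_mul, coe_smul]
    simp only [h]
    simp [mul_assoc]

end AbelianFact

end

/-!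
For a Hopf algebra with a positive basis, the canonical map `a ⊗ b ↦ a₁ ⊗ a₂ b` and its inverse
both have non-negative matrices, and a non-negative matrix with non-negative inverse is a
permutation matrix up to positive factors. Hence the products and coproducts of basis vectors are
governed by a matched pair of groups, formed by the basis vectors occurring in the unit and those
with non-zero counit. The remaining positive factors form a 2-cocycle; its logarithm is real, so
averaging over the finite groups trivialises it, and rescaling the basis gives `H(G; G₊, G₋)`.

Likewise, multiplication by a positive triangular structure `R` permutes the basis of `H ⊗ H` up to
positive factors, so `R = ∑ r(u, v) {u a(u, v)} ⊗ {v b(u, v)}`. The hexagon identities make `b` a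
homomorphism `ξ` of `u` and determine `a` by a homomorphism `η` of `v`; they make `r`
multiplicative, hence `1`, since a finite group has no non-trivial positive characters.
Triangularity gives `ξ = η`, and the intertwining property of `R` becomes the conditions of the
third kind of data. These conditions say that the complement `{u ξ(u)⁻¹}` of `G₋` is an abelian
normal subgroup.
-/

noncomputable section

/-! ### Factorizations with an abelian normal complement -/

namespace UniqueFactorization

variable {G : Type u} [Group G] (F : UniqueFactorization G)

theorem eq_and_eq_of_mul_eq_mul {p q : F.pos} {x y : F.neg} (h : (p * x : G) = q * y) :
    p = q ∧ x = y :=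
  Prod.mk.inj (F.isComplement.1 h)

theorem negOnPos_mul_negPow (x : F.neg) (p : F.pos) :
    (F.negOnPos x p * F.negPow x p : G) = x * p :=
  F.posPart_mul_negPart _

theorem negOnPos_posPow (p : F.pos) (x : F.neg) :
    F.negOnPos (F.posOnNeg p x) (F.posPow p x) = p :=
  F.posPart_eq p x (F.posOnNeg_mul_posPow p x)

theorem negPow_posPow (p : F.pos) (x : F.neg) :
    F.negPow (F.posOnNeg p x) (F.posPow p x) = x :=
  F.negPart_eq p x (F.posOnNeg_mul_posPow p x)

theorem posPow_negOnPos (x : F.neg) (p : F.pos) :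
    F.posPow (F.negOnPos x p) (F.negPow x p) = p :=
  F.posBar_eq x p (F.negOnPos_mul_negPow x p)

theorem posOnNeg_negOnPos (x : F.neg) (p : F.pos) :
    F.posOnNeg (F.negOnPos x p) (F.negPow x p) = x :=
  F.negBar_eq x p (F.negOnPos_mul_negPow x p)

theorem negPow_inv (x : F.neg) (p : F.pos) : (F.negPow x p)⁻¹ = F.posOnNeg p⁻¹ x⁻¹ := by
  refine (F.negBar_eq _ (F.negOnPos x p)⁻¹ ?_).symm
  simpa using (congrArg (·⁻¹) (F.negOnPos_mul_negPow x p)).symm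

theorem posPow_negPow_inv (x : F.neg) (p : F.pos) :
    F.posPow p (F.negPow x p)⁻¹ = F.negOnPos x p := by
  conv_lhs => enter [2]; rw [← F.posPow_negOnPos x p]
  rw [← posPow_mul, mul_inv_cancel, posPow_one]

theorem mul_negOnPos (x y : F.neg) (p : F.pos) :
    F.negOnPos (x * y) p = F.negOnPos x (F.negOnPos y p) := by
  refine F.posPart_eq _ (F.negPow x (F.negOnPos y p) * F.negPow y p) ?_
  rw [Subgroup.coe_mul, Subgroup.coe_mul, ← mul_assoc, negOnPos_mul_negPow, mul_assoc, mul_assoc,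
    negOnPos_mul_negPow]

theorem mul_negPow (x y : F.neg) (p : F.pos) :
    F.negPow (x * y) p = F.negPow x (F.negOnPos y p) * F.negPow y p := by
  refine F.negPart_eq (F.negOnPos x (F.negOnPos y p)) _ ?_
  rw [Subgroup.coe_mul, Subgroup.coe_mul, ← mul_assoc, negOnPos_mul_negPow, mul_assoc, mul_assoc,
    negOnPos_mul_negPow]

theorem one_negOnPos (p : F.pos) : F.negOnPos 1 p = p := F.posPart_eq p 1 (by simp)

theorem negPow_one (x : F.neg) : F.negPow x 1 = x := F.negPart_eq 1 x (by simp)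

theorem one_negPow (p : F.pos) : F.negPow 1 p = 1 := F.negPart_eq p 1 (by simp)

theorem negOnPos_inv_negOnPos (x : F.neg) (p : F.pos) : F.negOnPos x (F.negOnPos x⁻¹ p) = p := by
  rw [← mul_negOnPos, mul_inv_cancel, one_negOnPos]

theorem posPart_conj (x y : F.neg) (p : F.pos) :
    F.posPart (x * (p * (y : G)) * (x : G)⁻¹) = F.negOnPos x p := by
  refine F.posPart_eq _ (F.negPow x p * y * x⁻¹) ?_
  rw [Subgroup.coe_mul, Subgroup.coe_mul, ← mul_assoc, ← mul_assoc, ← mul_assoc,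
    negOnPos_mul_negPow, Subgroup.coe_inv]

/-- The element `u ξ(u)⁻¹` of `G`; these elements form `F.leftSet ξ`. -/
def twist (ξ : F.pos →* F.neg) (p : F.pos) : G := p * (ξ p : G)⁻¹

/-- The second condition of `IsBraided`. It says that `u x ↦ ξ(u) x` is a retraction of `G`
onto `G₋`; see `IsEquivariant.retraction`. -/
def IsEquivariant (ξ : F.pos →* F.neg) : Prop :=
  ∀ (p : F.pos) (x : F.neg), ξ (F.negOnPos x p) * F.negPow x p = x * ξ p

variable {F} {ξ : F.pos →* F.neg}

theorem twist_mul_coe (p : F.pos) : F.twist ξ p * ξ p = p := inv_mul_cancel_right _ _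

theorem posPart_twist (p : F.pos) : F.posPart (F.twist ξ p) = p :=
  F.posPart_eq p (ξ p)⁻¹ rfl

theorem leftSet_eq_range_twist : F.leftSet ξ = Set.range (F.twist ξ) := by
  simp only [leftSet, map_inv, Subgroup.coe_inv]
  rfl

theorem twist_mem_leftSet (p : F.pos) : F.twist ξ p ∈ F.leftSet ξ := by
  rw [leftSet_eq_range_twist]
  exact Set.mem_range_self p

theorem mem_leftSet {g : G} : g ∈ F.leftSet ξ ↔ F.twist ξ (F.posPart g) = g := by
  refine ⟨?_, fun h => h ▸ twist_mem_leftSet _⟩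
  rw [leftSet_eq_range_twist]
  rintro ⟨p, rfl⟩
  rw [posPart_twist]

theorem twist_mem {A : Subgroup G} (hA : (A : Set G) = F.leftSet ξ) (p : F.pos) :
    F.twist ξ p ∈ A :=
  SetLike.mem_coe.1 (hA ▸ twist_mem_leftSet p)

theorem isComplement'_of_coe_eq_leftSet {A : Subgroup G} (hA : (A : Set G) = F.leftSet ξ) :
    A.IsComplement' F.neg := by
  refine Subgroup.isComplement'_of_disjoint_and_mul_eq_univ ?_ ?_
  · rw [Subgroup.disjoint_def]
    intro g hg hn
    rw [← SetLike.mem_coe, hA, mem_leftSet] at hg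
    have h : F.posPart g = 1 := F.posPart_eq 1 ⟨g, hn⟩ (by simp)
    rw [← hg, h, twist, map_one, Subgroup.coe_one, Subgroup.coe_one, inv_one, mul_one]
  · refine Set.eq_univ_of_forall fun g => ?_
    rw [hA]
    refine ⟨_, twist_mem_leftSet (F.posPart g), _, (ξ (F.posPart g) * F.negPart g).2, ?_⟩
    change F.twist ξ (F.posPart g) * (ξ (F.posPart g) * F.negPart g : F.neg) = g
    rw [Subgroup.coe_mul, ← mul_assoc, twist_mul_coe, posPart_mul_negPart]

theorem conj_twist_eq_iff (p : F.pos) (x : F.neg) :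
    x * F.twist ξ p * (x : G)⁻¹ = F.twist ξ (F.negOnPos x p) ↔
      ξ (F.negOnPos x p) * F.negPow x p = x * ξ p := by
  have h : x * F.twist ξ p * (x : G)⁻¹ =
      F.negOnPos x p * (F.negPow x p * (x * ξ p : G)⁻¹) := by
    rw [← mul_assoc, negOnPos_mul_negPow, twist]
    group
  rw [h, twist, mul_right_inj, mul_inv_eq_iff_eq_mul, eq_inv_mul_iff_mul_eq, ← Subgroup.coe_mul,
    ← Subgroup.coe_mul, Subtype.coe_inj]

namespace IsEquivariant

/-- The homomorphism `u x ↦ ξ(u) x` from `G` to `G₋`; its kernel is `F.leftSet ξ`. -/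
def retraction (h : F.IsEquivariant ξ) : G →* F.neg :=
  MonoidHom.mk' (fun g => ξ (F.posPart g) * F.negPart g) fun g k => by
    have hgk : g * k = ((F.posPart g * F.negOnPos (F.negPart g) (F.posPart k) : F.pos) : G) *
        ((F.negPow (F.negPart g) (F.posPart k) * F.negPart k : F.neg) : G) := by
      rw [Subgroup.coe_mul, Subgroup.coe_mul, mul_assoc, ← mul_assoc (F.negOnPos _ _ : G),
        negOnPos_mul_negPow, mul_assoc, posPart_mul_negPart, ← mul_assoc, posPart_mul_negPart]
    have hξ := h (F.posPart k) (F.negPart g)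
    rw [F.posPart_eq _ _ hgk, F.negPart_eq _ _ hgk, map_mul, mul_assoc,
      ← mul_assoc (ξ (F.negOnPos _ _)), hξ]
    simp only [mul_assoc]

theorem coe_ker_retraction (h : F.IsEquivariant ξ) :
    (h.retraction.ker : Set G) = F.leftSet ξ := by
  ext g
  rw [mem_leftSet, twist]
  change ξ (F.posPart g) * F.negPart g = 1 ↔ _
  rw [mul_eq_one_iff_inv_eq, ← Subtype.coe_inj, Subgroup.coe_inv]
  conv_rhs => rw [← F.posPart_mul_negPart g, posPart_mul, mul_right_inj]

end IsEquivariant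

theorem isEquivariant_iff_exists_normal :
    F.IsEquivariant ξ ↔ ∃ A : Subgroup G, (A : Set G) = F.leftSet ξ ∧ A.Normal := by
  refine ⟨fun h => ⟨h.retraction.ker, h.coe_ker_retraction, inferInstance⟩, ?_⟩
  rintro ⟨A, hA, hn⟩ p x
  have hmem : x * F.twist ξ p * (x : G)⁻¹ ∈ A :=
    hn.conj_mem _ (twist_mem hA p) _
  rw [← SetLike.mem_coe, hA, mem_leftSet] at hmem
  rw [← conj_twist_eq_iff, ← hmem]
  exact congrArg _ (F.posPart_conj x (ξ p)⁻¹ p)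

theorem mul_eq_negOnPos_mul_posPow_iff {A : Subgroup G} (hA : (A : Set G) = F.leftSet ξ)
    (hn : A.Normal) (p q : F.pos) :
    p * q = F.negOnPos (ξ p) q * F.posPow p (ξ q) ↔
      Commute (F.twist ξ p) (F.twist ξ (F.negOnPos (ξ p) q)) := by
  set w := F.negOnPos (ξ p) q
  have hw : ξ p * F.twist ξ q * (ξ p : G)⁻¹ = F.twist ξ w :=
    (conj_twist_eq_iff q (ξ p)).2 (isEquivariant_iff_exists_normal.2 ⟨A, hA, hn⟩ q (ξ p))
  have hcomm : Commute (F.twist ξ p) (F.twist ξ w) ↔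
      p * F.twist ξ q * (p : G)⁻¹ = F.twist ξ w := by
    rw [commute_iff_eq, ← mul_inv_eq_iff_eq_mul, ← hw]
    nth_rw 1 [twist]
    nth_rw 2 [twist]
    simp only [mul_assoc, mul_inv_rev, inv_inv, inv_mul_cancel_left]
  have hmem : p * F.twist ξ q * (p : G)⁻¹ ∈ F.leftSet ξ :=
    hA ▸ hn.conj_mem _ (twist_mem hA q) _
  have hfactor : p * F.twist ξ q * (p : G)⁻¹ * F.posOnNeg p (ξ q) =
      p * q * (F.posPow p (ξ q) : G)⁻¹ := by
    rw [twist, eq_mul_inv_iff_mul_eq, mul_assoc _ (F.posOnNeg p (ξ q) : G), posOnNeg_mul_posPow]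
    group
  rw [hcomm]
  constructor
  · intro h
    have hpos : F.posPart (p * F.twist ξ q * (p : G)⁻¹) = w := by
      refine F.posPart_eq w (F.posOnNeg p (ξ q))⁻¹ ?_
      rw [Subgroup.coe_inv, eq_mul_inv_iff_mul_eq, hfactor, ← Subgroup.coe_mul, h,
        Subgroup.coe_mul, mul_inv_cancel_right]
    rw [← mem_leftSet.1 hmem, hpos]
  · intro h
    rw [h, twist, mul_assoc] at hfactor
    have hpos : w = p * q * (F.posPow p (ξ q))⁻¹ :=
      (F.eq_and_eq_of_mul_eq_mul (x := (ξ w)⁻¹ * F.posOnNeg p (ξ q)) (y := 1)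
        (by simpa using hfactor)).1
    rw [hpos, inv_mul_cancel_right]

theorem isAbelianNormal_iff_isBraided : F.IsAbelianNormal ξ ↔ F.IsBraided ξ := by
  constructor
  · rintro ⟨A, hA, hn, hc⟩
    exact ⟨fun p q => (mul_eq_negOnPos_mul_posPow_iff hA hn p q).2
        (hc _ (twist_mem hA _) _ (twist_mem hA _)),
      isEquivariant_iff_exists_normal.2 ⟨A, hA, hn⟩⟩
  · rintro ⟨hmul, heq⟩
    obtain ⟨A, hA, hn⟩ := isEquivariant_iff_exists_normal.1 heq
    refine ⟨A, hA, hn, fun a ha b hb => ?_⟩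
    rw [← SetLike.mem_coe, hA, mem_leftSet] at ha hb
    rw [← ha, ← hb, ← F.negOnPos_inv_negOnPos (ξ (F.posPart a)) (F.posPart b)]
    exact (mul_eq_negOnPos_mul_posPow_iff hA hn _ _).1 (hmul _ _)

end UniqueFactorization

/-- The isomorphism between corresponding subgroups induced by an isomorphism of groups. -/
def restrictSubgroup {G G' : Type*} [Group G] [Group G'] (f : G ≃* G') {K : Subgroup G}
    {K' : Subgroup G'} (h : ∀ g, f g ∈ K' ↔ g ∈ K) : K ≃* K' where
  __ := f.toEquiv.subtypeEquiv fun g => (h g).symm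
  map_mul' a b := Subtype.ext (map_mul f (a : G) b)

namespace UniqueFactorization

variable {G G' : Type u} [Group G] [Group G'] {F : UniqueFactorization G}
  {F' : UniqueFactorization G'} {f : G ≃* G'}

/-- `f` is an isomorphism from the unique factorization `G = G₊ G₋` to `G' = G'₊ G'₋`. -/
structure IsFactorIso (F : UniqueFactorization G) (F' : UniqueFactorization G') (f : G ≃* G') :
    Prop where
  mem_pos (g : G) : f g ∈ F'.pos ↔ g ∈ F.pos
  mem_neg (g : G) : f g ∈ F'.neg ↔ g ∈ F.neg

namespace IsFactorIso

/-- The isomorphism `G₊ ≃ G'₊` induced by an isomorphism of factorizations. -/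
def posEquiv (hf : F.IsFactorIso F' f) : F.pos ≃* F'.pos := restrictSubgroup f hf.mem_pos

/-- The isomorphism `G₋ ≃ G'₋` induced by an isomorphism of factorizations. -/
def negEquiv (hf : F.IsFactorIso F' f) : F.neg ≃* F'.neg := restrictSubgroup f hf.mem_neg

variable (hf : F.IsFactorIso F' f)

theorem coe_posEquiv (p : F.pos) : (hf.posEquiv p : G') = f p := rfl

theorem coe_negEquiv (x : F.neg) : (hf.negEquiv x : G') = f x := rfl

theorem posPart_map (g : G) : F'.posPart (f g) = hf.posEquiv (F.posPart g) :=
  F'.posPart_eq _ (hf.negEquiv (F.negPart g)) <| by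
    rw [coe_posEquiv, coe_negEquiv, ← map_mul, posPart_mul_negPart]

theorem map_twist {ξ : F.pos →* F.neg} {ξ' : F'.pos →* F'.neg}
    (hξ : ∀ p, hf.negEquiv (ξ p) = ξ' (hf.posEquiv p)) (p : F.pos) :
    f (F.twist ξ p) = F'.twist ξ' (hf.posEquiv p) := by
  rw [twist, twist, ← hξ, coe_posEquiv, coe_negEquiv, map_mul, map_inv]

theorem map_mem_leftSet {ξ : F.pos →* F.neg} {ξ' : F'.pos →* F'.neg}
    (hξ : ∀ p, hf.negEquiv (ξ p) = ξ' (hf.posEquiv p)) (g : G) :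
    f g ∈ F'.leftSet ξ' ↔ g ∈ F.leftSet ξ := by
  rw [mem_leftSet, mem_leftSet, hf.posPart_map, ← hf.map_twist hξ, f.injective.eq_iff]

end IsFactorIso

end UniqueFactorization

theorem FactHom.Iso.exists_isFactorIso {X Y : FactHom.{u}} (h : X.Iso Y) :
    ∃ (f : X.G ≃* Y.G) (hf : X.F.IsFactorIso Y.F f),
      ∀ p, hf.negEquiv (X.ξ p) = Y.ξ (hf.posEquiv p) := by
  obtain ⟨f, hpos, hneg, hξ⟩ := h
  exact ⟨f, ⟨hpos, hneg⟩, fun p => Subtype.ext (hξ p _ rfl)⟩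

namespace CycleData

variable (Y : CycleData.{u})

theorem mem_graph_iff (g : Y.Semidirect) : g ∈ Y.graph ↔ g.right = Y.ζ g.left :=
  ⟨by rintro ⟨a, rfl⟩; rfl, fun h => ⟨g.left, SemidirectProduct.ext rfl h.symm⟩⟩

theorem mem_factorization_neg_iff (g : Y.Semidirect) : g ∈ Y.factorization.neg ↔ g.left = 1 :=
  ⟨by rintro ⟨x, rfl⟩; rfl, fun h => ⟨g.right, SemidirectProduct.ext h.symm rfl⟩⟩

/-- The homomorphism `a ζ(a) ↦ ζ(a)` from `G₊` to `G₋`. -/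
def ξ : Y.factorization.pos →* Y.factorization.neg := Y.toFactHom.ξ

theorem twist_ξ (p : Y.factorization.pos) :
    Y.factorization.twist Y.ξ p = SemidirectProduct.inl (SemidirectProduct.left p.1) :=
  mul_inv_eq_of_eq_mul (SemidirectProduct.inl_left_mul_inr_right p.1).symm

theorem leftSet_ξ :
    Y.factorization.leftSet Y.ξ = (SemidirectProduct.inl : Y.A →* Y.Semidirect).range := by
  rw [UniqueFactorization.leftSet_eq_range_twist, MonoidHom.coe_range]
  refine Set.Subset.antisymm ?_ ?_
  · rintro _ ⟨p, rfl⟩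
    exact ⟨_, (Y.twist_ξ p).symm⟩
  · rintro _ ⟨a, rfl⟩
    exact ⟨⟨_, a, rfl⟩, Y.twist_ξ _⟩

theorem posPart_inl (a : Y.A) :
    Y.factorization.posPart (SemidirectProduct.inl a) = ⟨⟨a, Y.ζ a⟩, a, rfl⟩ :=
  (congrArg _ (Y.twist_ξ ⟨_, a, rfl⟩)).symm.trans (UniqueFactorization.posPart_twist _)

theorem isAbelianNormal_ξ : Y.factorization.IsAbelianNormal Y.ξ := by
  refine ⟨(SemidirectProduct.inl : Y.A →* Y.Semidirect).range, Y.leftSet_ξ.symm, ?_, ?_⟩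
  · rw [SemidirectProduct.range_inl_eq_ker_rightHom]
    exact MonoidHom.normal_ker _
  · rintro _ ⟨a, rfl⟩ _ ⟨b, rfl⟩
    rw [← map_mul, mul_comm, map_mul]

/-- The second kind of data obtained from the fourth. -/
def toAbelianFact : AbelianFact.{u} := ⟨Y.toFactHom, Y.isAbelianNormal_ξ⟩

variable {Y} in
theorem Iso.toFactHom {Z : CycleData.{u}} (h : Y.Iso Z) : Y.toFactHom.Iso Z.toFactHom := by
  obtain ⟨φ, ψ, hsmul, hζ⟩ := h
  refine ⟨SemidirectProduct.congr ψ φ fun x => MulEquiv.ext (hsmul x), fun g => ?_, fun g => ?_,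
    fun p q hpq => ?_⟩
  · refine (Z.mem_graph_iff _).trans (Iff.trans ?_ (Y.mem_graph_iff g).symm)
    change φ g.right = Z.ζ (ψ g.left) ↔ _
    rw [← hζ, φ.injective.eq_iff]
  · exact (Z.mem_factorization_neg_iff _).trans
      ((map_eq_one_iff ψ ψ.injective).trans (Y.mem_factorization_neg_iff g).symm)
  · have hright := congrArg SemidirectProduct.right hpq
    exact SemidirectProduct.ext (map_one ψ) hright

end CycleData

namespace AbelianFact

theorem Iso.toCycleData {X Y : AbelianFact.{u}} (h : X.1.Iso Y.1) :
    X.toCycleData.Iso Y.toCycleData := by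
  obtain ⟨f, hf, hξ⟩ := h.exists_isFactorIso
  refine ⟨hf.negEquiv, restrictSubgroup f (hf.map_mem_leftSet hξ), fun x a => Subtype.ext ?_,
    fun a => ?_⟩
  · refine (congrArg f (X.coe_smul x a)).trans (Eq.trans ?_ (Y.coe_smul _ _).symm)
    rw [map_mul, map_mul, map_inv]
    rfl
  · exact (hξ _).trans (congrArg Y.1.ξ (hf.posPart_map (Subtype.val a)).symm)

variable (X : AbelianFact.{u})

theorem twist_posPart (a : X.subgroup) : X.1.F.twist X.1.ξ (X.1.F.posPart a) = a :=
  UniqueFactorization.mem_leftSet.1 a.2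

theorem isComplement' : X.subgroup.IsComplement' X.1.F.neg :=
  UniqueFactorization.isComplement'_of_coe_eq_leftSet (ξ := X.1.ξ) rfl

/-- The isomorphism `(a, x) ↦ a x` from `A ⋊ G₋` to `G`. -/
def semidirectEquiv : X.toCycleData.Semidirect ≃* X.1.G :=
  (SemidirectProduct.congr (MulEquiv.refl _) (MulEquiv.refl _) fun _ => rfl).trans
    (SemidirectProduct.mulEquivSubgroup X.isComplement')

theorem mul_ξ_posPart (a : X.subgroup) :
    (a * X.1.ξ (X.1.F.posPart a) : X.1.G) = X.1.F.posPart a := by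
  conv_lhs => rw [← X.twist_posPart a]
  rw [UniqueFactorization.posPart_twist, UniqueFactorization.twist_mul_coe]

theorem mul_mem_pos_iff (a : X.subgroup) (x : X.1.F.neg) :
    (a * x : X.1.G) ∈ X.1.F.pos ↔ x = X.1.ξ (X.1.F.posPart a) := by
  constructor
  · intro h
    have heq : (X.1.F.posPart a * ((X.1.ξ (X.1.F.posPart a))⁻¹ * x : X.1.F.neg) : X.1.G) =
        (⟨_, h⟩ : X.1.F.pos) * (1 : X.1.F.neg) := by
      rw [Subgroup.coe_mul, Subgroup.coe_inv, ← mul_assoc, Subgroup.coe_one, mul_one]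
      exact congrArg (· * (x : X.1.G)) (X.twist_posPart a)
    exact (inv_mul_eq_one.1 (X.1.F.eq_and_eq_of_mul_eq_mul heq).2).symm
  · rintro rfl
    rw [mul_ξ_posPart]
    exact Subtype.prop _

theorem mul_mem_neg_iff (a : X.subgroup) (x : X.1.F.neg) :
    (a * x : X.1.G) ∈ X.1.F.neg ↔ a = 1 := by
  rw [Subgroup.mul_mem_cancel_right _ x.2]
  refine ⟨fun h => Subtype.ext (Subgroup.disjoint_def.1 X.isComplement'.disjoint a.2 h), ?_⟩
  rintro rfl
  exact X.1.F.neg.one_mem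

theorem toCycleData_toFactHom_iso (X : AbelianFact.{u}) : X.toCycleData.toFactHom.Iso X.1 := by
  refine ⟨X.semidirectEquiv, ?_, ?_, ?_⟩
  · rintro ⟨a, x⟩
    exact (X.mul_mem_pos_iff a x).trans (X.toCycleData.mem_graph_iff ⟨a, x⟩).symm
  · rintro ⟨a, x⟩
    exact (X.mul_mem_neg_iff a x).trans (X.toCycleData.mem_factorization_neg_iff ⟨a, x⟩).symm
  · rintro ⟨_, a, rfl⟩ q h
    rw [← show X.1.F.posPart (Subtype.val (p := (· ∈ X.subgroup)) a) = q from
      Subtype.ext ((X.mul_ξ_posPart a).symm.trans h)]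
    exact one_mul _

end AbelianFact

theorem CycleData.toAbelianFact_toCycleData_iso (Y : CycleData.{u}) :
    Y.toAbelianFact.toCycleData.Iso Y := by
  let φ : Y.N ≃* Y.factorization.neg := MonoidHom.ofInjective SemidirectProduct.inr_injective
  let ψ : Y.A ≃* Y.toAbelianFact.subgroup :=
    (MonoidHom.ofInjective SemidirectProduct.inl_injective).trans
      (MulEquiv.subgroupCongr (SetLike.coe_injective Y.leftSet_ξ.symm))
  refine CycleData.setoid.iseqv.symm ⟨φ, ψ, fun x a => Subtype.ext ?_, fun a => Subtype.ext ?_⟩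
  · refine Eq.trans ?_ (Y.toAbelianFact.coe_smul (φ x) (ψ a)).symm
    exact (SemidirectProduct.inl_aut (φ := MulDistribMulAction.toMulAut Y.N Y.A) x a).trans
      (congrArg _ (map_inv _ x))
  · exact congrArg (fun p => (Y.toFactHom.ξ p).1) (Y.posPart_inl a).symm

/-- The correspondence between the second and the third kind of data. -/
def abelianBraidedEquiv : Quotient AbelianFact.setoid.{u} ≃ Quotient BraidedFact.setoid.{u} :=
  Quotient.congr
    (Equiv.subtypeEquivRight fun _ => UniqueFactorization.isAbelianNormal_iff_isBraided)
    fun _ _ => Iff.rfl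

/-- The correspondence between the second and the fourth kind of data. -/
def abelianCycleEquiv : Quotient AbelianFact.setoid.{u} ≃ Quotient CycleData.setoid.{u} where
  toFun := Quotient.map AbelianFact.toCycleData fun _ _ => AbelianFact.Iso.toCycleData
  invFun := Quotient.map CycleData.toAbelianFact fun _ _ h => h.toFactHom
  left_inv := Quotient.ind fun X => Quotient.sound X.toCycleData_toFactHom_iso
  right_inv := Quotient.ind fun Y => Quotient.sound Y.toAbelianFact_toCycleData_iso

/-! ### Non-negative vectors and matrices -/

/-- All coefficients of `v` in the basis `b` are non-negative. -/
def IsNonneg {ι R V : Type*} [Semiring R] [LE R] [AddCommMonoid V] [Module R V]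
    (b : Module.Basis ι R V) (v : V) : Prop :=
  ∀ i, 0 ≤ b.repr v i

namespace IsNonneg

variable {ι κ R V W : Type*} [CommSemiring R] [PartialOrder R] [AddCommMonoid V]
  [Module R V] [AddCommMonoid W] [Module R W]
  {b : Module.Basis ι R V} {c : Module.Basis κ R W}

theorem zero : IsNonneg b 0 := fun i => by simp

variable [IsOrderedRing R]

theorem sum {α : Type*} {s : Finset α} {f : α → V} (h : ∀ a ∈ s, IsNonneg b (f a)) :
    IsNonneg b (∑ a ∈ s, f a) := fun i => by
  simpa using Finset.sum_nonneg fun a ha => h a ha i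

theorem smul {v : V} (hv : IsNonneg b v) {z : R} (hz : 0 ≤ z) : IsNonneg b (z • v) := fun i => by
  simpa using mul_nonneg hz (hv i)

theorem self (i : ι) : IsNonneg b (b i) := fun j => by
  classical
  rw [b.repr_self, Finsupp.single_apply]
  split_ifs
  exacts [zero_le_one, le_rfl]

theorem map [Finite ι] {f : V →ₗ[R] W} (hf : ∀ i, IsNonneg c (f (b i))) {v : V}
    (hv : IsNonneg b v) : IsNonneg c (f v) := by
  have := Fintype.ofFinite ι
  rw [← b.sum_repr v, map_sum]
  refine sum fun i _ => ?_
  rw [map_smul]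
  exact (hf i).smul (hv i)

theorem tmul {v : V} {w : W} (hv : IsNonneg b v) (hw : IsNonneg c w) :
    IsNonneg (b.tensorProduct c) (v ⊗ₜ[R] w) := by
  rintro ⟨i, j⟩
  rw [Module.Basis.tensorProduct_repr_tmul_apply, smul_eq_mul]
  exact mul_nonneg (hw j) (hv i)

theorem comm [Finite ι] [Finite κ] {v : V ⊗[R] W} (hv : IsNonneg (b.tensorProduct c) v) :
    IsNonneg (c.tensorProduct b) (TensorProduct.comm R V W v) := by
  refine map (f := (TensorProduct.comm R V W).toLinearMap) (fun i => ?_) hv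
  rw [Module.Basis.tensorProduct_apply']
  exact (self _).tmul (self _)

variable {A : Type*} [Semiring A] [Algebra R A] {b : Module.Basis ι R A}

theorem mul [Finite ι] (hb : ∀ i j, IsNonneg b (b i * b j)) {v w : A} (hv : IsNonneg b v)
    (hw : IsNonneg b w) : IsNonneg b (v * w) :=
  map (f := LinearMap.mulRight R w) (fun i => map (f := LinearMap.mulLeft R (b i)) (hb i) hw) hv

theorem basis_tmul_mul (hb : ∀ i j, IsNonneg b (b i * b j)) (i j : ι × ι) :
    IsNonneg (b.tensorProduct b) (b.tensorProduct b i * b.tensorProduct b j) := by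
  rw [Module.Basis.tensorProduct_apply', Module.Basis.tensorProduct_apply',
    Algebra.TensorProduct.tmul_mul_tmul]
  exact (hb _ _).tmul (hb _ _)

end IsNonneg

section Monomial

theorem exists_ne_zero_of_matrix_mul_eq_one {ι R : Type*} [Fintype ι] [DecidableEq ι]
    [NonAssocSemiring R] [Nontrivial R] {A B : Matrix ι ι R} (h : A * B = 1) (i : ι) :
    ∃ j, A i j ≠ 0 ∧ B j i ≠ 0 := by
  have hsum : ∑ l, A i l * B l i ≠ 0 := by
    rw [← Matrix.mul_apply, h, Matrix.one_apply_eq]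
    exact one_ne_zero
  obtain ⟨j, -, hj⟩ := Finset.exists_ne_zero_of_sum_ne_zero hsum
  exact ⟨j, left_ne_zero_of_mul hj, right_ne_zero_of_mul hj⟩

variable {ι R : Type*} [CommRing R] [PartialOrder R] [IsOrderedRing R] [NoZeroDivisors R]

theorem eq_of_nonneg_of_matrix_mul_eq_one [Fintype ι] [DecidableEq ι] {A B : Matrix ι ι R}
    (hA : ∀ i j, 0 ≤ A i j) (hB : ∀ i j, 0 ≤ B i j) (h : A * B = 1) {i j k : ι} (hik : A i k ≠ 0)
    (hkj : B k j ≠ 0) : i = j := by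
  by_contra hij
  have hsum : ∑ l, A i l * B l j = 0 := by
    rw [← Matrix.mul_apply, h, Matrix.one_apply_ne hij]
  rw [Finset.sum_eq_zero_iff_of_nonneg fun l _ => mul_nonneg (hA i l) (hB l j)] at hsum
  exact mul_ne_zero hik hkj (hsum k (Finset.mem_univ k))

theorem exists_perm_of_nonneg_matrix_inverse [Fintype ι] [DecidableEq ι] [Nontrivial R]
    {A B : Matrix ι ι R} (hA : ∀ i j, 0 ≤ A i j) (hB : ∀ i j, 0 ≤ B i j) (hAB : A * B = 1) :
    ∃ σ : Equiv.Perm ι, ∀ i j, A i j ≠ 0 ↔ i = σ j := by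
  have hBA : B * A = 1 := mul_eq_one_comm.1 hAB
  choose σ hBσ hAσ using exists_ne_zero_of_matrix_mul_eq_one hBA
  have hσ : Function.Injective σ := fun j j' h =>
    eq_of_nonneg_of_matrix_mul_eq_one hB hA hBA (hBσ j) (h ▸ hAσ j')
  refine ⟨Equiv.ofBijective σ hσ.bijective_of_finite, fun i j => ⟨fun hij => ?_, ?_⟩⟩
  · exact eq_of_nonneg_of_matrix_mul_eq_one hA hB hAB hij (hBσ j)
  · rintro rfl
    exact hAσ j

theorem exists_perm_of_nonneg_linearMap_inverse [Finite ι] [Nontrivial R] {V : Type*}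
    [AddCommGroup V] [Module R V] (b : Module.Basis ι R V) {f g : V →ₗ[R] V}
    (hf : ∀ i, IsNonneg b (f (b i))) (hg : ∀ i, IsNonneg b (g (b i)))
    (hfg : f ∘ₗ g = LinearMap.id) :
    ∃ σ : Equiv.Perm ι, ∀ i j, b.repr (f (b i)) j ≠ 0 ↔ j = σ i := by
  classical
  have := Fintype.ofFinite ι
  have hmul : LinearMap.toMatrix b b f * LinearMap.toMatrix b b g = 1 := by
    rw [← LinearMap.toMatrix_comp, hfg, LinearMap.toMatrix_id]
  obtain ⟨σ, hσ⟩ := exists_perm_of_nonneg_matrix_inverse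
    (fun i j => (LinearMap.toMatrix_apply b b f i j).symm ▸ hf j i)
    (fun i j => (LinearMap.toMatrix_apply b b g i j).symm ▸ hg j i) hmul
  exact ⟨σ, fun i j => by rw [← hσ j i, LinearMap.toMatrix_apply]⟩

theorem exists_perm_smul_of_nonneg_linearMap_inverse [Finite ι] [Nontrivial R] {V : Type*}
    [AddCommGroup V] [Module R V] (b : Module.Basis ι R V) {f g : V →ₗ[R] V}
    (hf : ∀ i, IsNonneg b (f (b i))) (hg : ∀ i, IsNonneg b (g (b i)))
    (hfg : f ∘ₗ g = LinearMap.id) :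
    ∃ (σ : Equiv.Perm ι) (z : ι → R), (∀ i, 0 < z i) ∧ ∀ i, f (b i) = z i • b (σ i) := by
  obtain ⟨σ, hσ⟩ := exists_perm_of_nonneg_linearMap_inverse b hf hg hfg
  refine ⟨σ, fun i => b.repr (f (b i)) (σ i),
    fun i => (hf i (σ i)).lt_of_ne' ((hσ i _).2 rfl), fun i => b.ext_elem fun j => ?_⟩
  rw [map_smul, b.repr_self, Finsupp.smul_apply]
  obtain rfl | hj := eq_or_ne j (σ i)
  · rw [Finsupp.single_eq_same, smul_eq_mul, mul_one]
  · rw [Finsupp.single_eq_of_ne hj, smul_zero]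
    exact not_ne_iff.1 (mt (hσ i j).1 hj)

end Monomial

theorem eq_and_eq_of_sum_smul_basis_eq {ι κ R V : Type*} [Fintype ι] [Semiring R]
    [AddCommMonoid V] [Module R V] (b : Module.Basis (ι × κ) R V) {c c' : ι → R} {f f' : ι → κ}
    (h : ∑ i, c i • b (i, f i) = ∑ i, c' i • b (i, f' i)) {i : ι} (hi : c i ≠ 0) :
    c i = c' i ∧ f i = f' i := by
  classical
  have hrepr : ∀ (c : ι → R) (f : ι → κ) k,
      b.repr (∑ j, c j • b (j, f j)) (i, k) = if f i = k then c i else 0 := fun c f k => by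
    simp only [map_sum, map_smul, Module.Basis.repr_self, Finsupp.coe_finsetSum, Finset.sum_apply,
      Finsupp.smul_apply, Finsupp.single_apply, smul_eq_mul, Prod.mk.injEq, mul_ite, mul_one,
      mul_zero, ite_and]
    rw [Finset.sum_ite_eq' Finset.univ i, if_pos (Finset.mem_univ i)]
  have hc := congrArg (fun v => b.repr v (i, f i)) h
  simp only [hrepr, if_true] at hc
  by_cases hf : f' i = f i
  · exact ⟨hc.trans (if_pos hf), hf.symm⟩
  · exact absurd (hc.trans (if_neg hf)) hi

/-! ### Tensors with one term for each pair of left units -/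

namespace Bicross

variable {G : Type u} [Group G] (F : UniqueFactorization G)

/-- The basis of `H(G; G₊, G₋)`, with `{u x}` indexed by the pair of `u ∈ G₊` and `x ∈ G₋`. -/
def elBasis : Module.Basis (F.pos × F.neg) ℂ (Bicross F) :=
  (basis F).reindex (Subgroup.IsComplement.equiv F.isComplement)

theorem elBasis_apply (p : F.pos) (x : F.neg) : elBasis F (p, x) = el F p x := by
  rw [elBasis, Module.Basis.reindex_apply]
  rfl

variable [Finite G]

/-- The tensor `∑ r(u, v) {u a(u, v)} ⊗ {v b(u, v)}` over `u, v ∈ G₊`. Its terms for distinct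
pairs `(u, v)` are multiples of distinct basis vectors. -/
def tens (r : F.pos → F.pos → ℂ) (a b : F.pos → F.pos → F.neg) : Bicross F ⊗[ℂ] Bicross F :=
  ∑ p, ∑ q, r p q • (el F p (a p q) ⊗ₜ[ℂ] el F q (b p q))

/-- The analogue of `tens` in the threefold tensor power. -/
def tens₃ (r : F.pos → F.pos → F.pos → ℂ) (a b c : F.pos → F.pos → F.pos → F.neg) :
    Bicross F ⊗[ℂ] (Bicross F ⊗[ℂ] Bicross F) :=
  ∑ p, ∑ q, ∑ s, r p q s • (el F p (a p q s) ⊗ₜ[ℂ] (el F q (b p q s) ⊗ₜ[ℂ] el F s (c p q s)))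

variable {F} in
theorem eq_of_tens_eq {r r' : F.pos → F.pos → ℂ} {a b a' b' : F.pos → F.pos → F.neg}
    (h : tens F r a b = tens F r' a' b') {p q : F.pos} (hr : r p q ≠ 0) :
    r p q = r' p q ∧ a p q = a' p q ∧ b p q = b' p q := by
  let B := ((elBasis F).tensorProduct (elBasis F)).reindex (Equiv.prodProdProdComm _ _ _ _)
  have hB : ∀ r a b, tens F r a b =
      ∑ i : F.pos × F.pos, r i.1 i.2 • B (i, (a i.1 i.2, b i.1 i.2)) := by
    intro r a b
    simp [B, tens, elBasis_apply, Fintype.sum_prod_type]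
  rw [hB, hB] at h
  obtain ⟨hr', hab⟩ := eq_and_eq_of_sum_smul_basis_eq B (i := (p, q))
    (c := fun i => r i.1 i.2) (c' := fun i => r' i.1 i.2)
    (f := fun i => (a i.1 i.2, b i.1 i.2)) (f' := fun i => (a' i.1 i.2, b' i.1 i.2)) h hr
  exact ⟨hr', Prod.mk.inj hab⟩

variable {F} in
theorem eq_of_tens₃_eq {r r' : F.pos → F.pos → F.pos → ℂ}
    {a b c a' b' c' : F.pos → F.pos → F.pos → F.neg} (h : tens₃ F r a b c = tens₃ F r' a' b' c')
    {p q s : F.pos} (hr : r p q s ≠ 0) :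
    r p q s = r' p q s ∧ a p q s = a' p q s ∧ b p q s = b' p q s ∧ c p q s = c' p q s := by
  let e : (F.pos × F.neg) × (F.pos × F.neg) × (F.pos × F.neg) ≃
      (F.pos × F.pos × F.pos) × (F.neg × F.neg × F.neg) :=
    ((Equiv.refl _).prodCongr (Equiv.prodProdProdComm _ _ _ _)).trans
      (Equiv.prodProdProdComm _ _ _ _)
  let B := ((elBasis F).tensorProduct ((elBasis F).tensorProduct (elBasis F))).reindex e
  have hB : ∀ r a b c, tens₃ F r a b c = ∑ i : F.pos × F.pos × F.pos, r i.1 i.2.1 i.2.2 •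
      B (i, (a i.1 i.2.1 i.2.2, b i.1 i.2.1 i.2.2, c i.1 i.2.1 i.2.2)) := by
    intro r a b c
    simp [B, e, tens₃, elBasis_apply, Fintype.sum_prod_type]
  rw [hB, hB] at h
  obtain ⟨hr', habc⟩ := eq_and_eq_of_sum_smul_basis_eq B (i := (p, q, s))
    (c := fun i => r i.1 i.2.1 i.2.2) (c' := fun i => r' i.1 i.2.1 i.2.2)
    (f := fun i => (a i.1 i.2.1 i.2.2, b i.1 i.2.1 i.2.2, c i.1 i.2.1 i.2.2))
    (f' := fun i => (a' i.1 i.2.1 i.2.2, b' i.1 i.2.1 i.2.2, c' i.1 i.2.1 i.2.2)) h hr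
  obtain ⟨ha, hbc⟩ := Prod.mk.inj habc
  exact ⟨hr', ha, Prod.mk.inj hbc⟩

variable (r : F.pos → F.pos → ℂ) (a b : F.pos → F.pos → F.neg)

theorem one_eq_tens : (1 : Bicross F ⊗[ℂ] Bicross F) = tens F 1 1 1 := by
  simp only [tens, Algebra.TensorProduct.one_def, one_eq, TensorProduct.sum_tmul,
    TensorProduct.tmul_sum, one_smul, Pi.one_apply]
  exact Finset.sum_comm

theorem counit_left_tens :
    TensorProduct.lid ℂ _ (LinearMap.rTensor (Bicross F) (Coalgebra.counit (R := ℂ))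
      (tens F r a b)) = ∑ q, r 1 q • el F q (b 1 q) := by
  simp only [tens, map_sum, map_smul, LinearMap.rTensor_tmul, TensorProduct.lid_tmul, counit_el]
  simp

theorem counit_right_tens :
    TensorProduct.rid ℂ _ (LinearMap.lTensor (Bicross F) (Coalgebra.counit (R := ℂ))
      (tens F r a b)) = ∑ p, r p 1 • el F p (a p 1) := by
  simp only [tens, map_sum, map_smul, LinearMap.lTensor_tmul, TensorProduct.rid_tmul, counit_el]
  simp

theorem comul_left_tens :
    TensorProduct.assoc ℂ _ _ _ (LinearMap.rTensor (Bicross F) (Coalgebra.comul (R := ℂ))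
      (tens F r a b)) =
      tens₃ F (fun p p' q => r (p * p') q) (fun p p' q => F.posOnNeg p' (a (p * p') q))
        (fun p p' q => a (p * p') q) (fun p p' q => b (p * p') q) := by
  simp only [tens, tens₃, map_sum, map_smul, LinearMap.rTensor_tmul, comul_el,
    TensorProduct.sum_tmul, TensorProduct.assoc_tmul, Finset.smul_sum]
  rw [Finset.sum_congr rfl fun p _ => Finset.sum_comm, Finset.sum_comm]
  conv_rhs => rw [Finset.sum_comm]
  refine Finset.sum_congr rfl fun h _ => ?_
  exact Fintype.sum_equiv (Equiv.mulRight h⁻¹) _ _ fun p => by simp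

theorem comul_right_tens :
    LinearMap.lTensor (Bicross F) (Coalgebra.comul (R := ℂ)) (tens F r a b) =
      tens₃ F (fun p q q' => r p (q * q')) (fun p q q' => a p (q * q'))
        (fun p q q' => F.posOnNeg q' (b p (q * q'))) (fun p q q' => b p (q * q')) := by
  simp only [tens, tens₃, map_sum, map_smul, LinearMap.lTensor_tmul, comul_el,
    TensorProduct.tmul_sum, Finset.smul_sum]
  refine Finset.sum_congr rfl fun p _ => ?_
  rw [Finset.sum_comm]
  conv_rhs => rw [Finset.sum_comm]
  refine Finset.sum_congr rfl fun q' _ => ?_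
  exact Fintype.sum_equiv (Equiv.mulRight q'⁻¹) _ _ fun q => by simp

theorem leg₁₃_mul_leg₂₃_tens :
    leg₁₃ (tens F r a b) * leg₂₃ (tens F r a b) =
      tens₃ F (fun p p' q => r p q * r p' (F.posPow q (b p q))) (fun p _ q => a p q)
        (fun p p' q => a p' (F.posPow q (b p q)))
        (fun p p' q => b p q * b p' (F.posPow q (b p q))) := by
  simp only [leg₁₃, leg₂₃, tens, tens₃, map_sum, map_smul, LinearMap.lTensor_tmul,
    TensorProduct.mk_apply, TensorProduct.tmul_sum, TensorProduct.tmul_smul]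
  rw [Finset.sum_mul]
  refine Finset.sum_congr rfl fun p _ => ?_
  rw [Finset.sum_mul]
  conv_rhs => rw [Finset.sum_comm]
  refine Finset.sum_congr rfl fun q _ => ?_
  simp only [Finset.mul_sum, smul_mul_smul_comm, Algebra.TensorProduct.tmul_mul_tmul, one_mul,
    mul_one, el_mul_el, TensorProduct.tmul_ite, smul_ite, smul_zero, Finset.sum_ite_eq,
    Finset.mem_univ, if_true]

theorem leg₁₃_mul_leg₁₂_tens :
    leg₁₃ (tens F r a b) * leg₁₂ (tens F r a b) =
      tens₃ F (fun p q q' => r p q' * r (F.posPow p (a p q')) q)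
        (fun p q q' => a p q' * a (F.posPow p (a p q')) q)
        (fun p q q' => b (F.posPow p (a p q')) q) (fun p _ q' => b p q') := by
  simp only [leg₁₃, leg₁₂, tens, tens₃, map_sum, map_smul, LinearMap.lTensor_tmul,
    TensorProduct.mk_apply, TensorProduct.sum_tmul, ← TensorProduct.smul_tmul',
    TensorProduct.assoc_tmul]
  rw [Finset.sum_mul]
  refine Finset.sum_congr rfl fun p _ => ?_
  rw [Finset.sum_mul]
  conv_rhs => rw [Finset.sum_comm]
  refine Finset.sum_congr rfl fun q _ => ?_
  rw [Finset.sum_comm, Finset.mul_sum]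
  refine Finset.sum_congr rfl fun q' _ => ?_
  simp only [Finset.mul_sum, smul_mul_smul_comm, Algebra.TensorProduct.tmul_mul_tmul, one_mul,
    mul_one, el_mul_el, TensorProduct.ite_tmul, smul_ite, smul_zero, Finset.sum_ite_eq,
    Finset.mem_univ, if_true]

theorem comm_tens_mul_tens :
    TensorProduct.comm ℂ _ _ (tens F r a b) * tens F r a b =
      tens F (fun q p => r p q * r (F.posPow q (b p q)) (F.posPow p (a p q)))
        (fun q p => b p q * a (F.posPow q (b p q)) (F.posPow p (a p q)))
        (fun q p => a p q * b (F.posPow q (b p q)) (F.posPow p (a p q))) := by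
  simp only [tens, map_sum, map_smul, TensorProduct.comm_tmul]
  conv_rhs => rw [Finset.sum_comm]
  rw [Finset.sum_mul]
  refine Finset.sum_congr rfl fun p _ => ?_
  rw [Finset.sum_mul]
  refine Finset.sum_congr rfl fun q _ => ?_
  simp only [Finset.mul_sum, smul_mul_smul_comm, Algebra.TensorProduct.tmul_mul_tmul,
    el_mul_el, TensorProduct.tmul_ite, TensorProduct.ite_tmul,
    smul_ite, smul_zero, Finset.sum_ite_eq, Finset.mem_univ, if_true]

theorem tens_mul_comul (w : F.pos) (x : F.neg) :
    tens F r a b * Coalgebra.comul (R := ℂ) (el F w x) =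
      tens F (fun p q => if F.posPow p (a p q) * F.posPow q (b p q) = w then r p q else 0)
        (fun p q => a p q * F.posOnNeg (F.posPow q (b p q)) x) (fun p q => b p q * x) := by
  simp only [tens, comul_el]
  rw [Finset.sum_mul]
  refine Finset.sum_congr rfl fun p _ => ?_
  rw [Finset.sum_mul]
  refine Finset.sum_congr rfl fun q _ => ?_
  simp only [Finset.mul_sum, smul_mul_assoc, Algebra.TensorProduct.tmul_mul_tmul, el_mul_el,
    TensorProduct.tmul_ite, TensorProduct.ite_tmul,
    smul_ite, smul_zero, Finset.sum_ite_eq, Finset.mem_univ, if_true,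
    ite_smul, zero_smul, eq_mul_inv_iff_mul_eq]

theorem comm_comul_mul_tens (w : F.pos) (x : F.neg) :
    TensorProduct.comm ℂ _ _ (Coalgebra.comul (R := ℂ) (el F w x)) * tens F r a b =
      tens F (fun p q => if q * p = w then r (F.posPow p x) (F.posPow q (F.posOnNeg p x)) else 0)
        (fun p q => x * a (F.posPow p x) (F.posPow q (F.posOnNeg p x)))
        (fun p q => F.posOnNeg p x * b (F.posPow p x) (F.posPow q (F.posOnNeg p x))) := by
  simp only [tens, comul_el, map_sum, TensorProduct.comm_tmul]
  rw [Finset.sum_mul]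
  refine Finset.sum_congr rfl fun p _ => ?_
  have h : ∀ q : F.pos, q * p = w ↔ q = w * p⁻¹ := fun q => by rw [eq_mul_inv_iff_mul_eq]
  simp only [h, ite_smul, zero_smul, Finset.sum_ite_eq', Finset.mem_univ, if_true]
  simp only [Finset.mul_sum, mul_smul_comm, Algebra.TensorProduct.tmul_mul_tmul, el_mul_el,
    TensorProduct.tmul_ite, TensorProduct.ite_tmul,
    smul_ite, smul_zero, Finset.sum_ite_eq, Finset.mem_univ, if_true]

end Bicross

namespace Bicross

variable {G : Type u} [Group G] [Finite G] {F : UniqueFactorization G}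

theorem isNonneg_mul (g h : G) : IsNonneg (basis F) (basis F g * basis F h) := by
  rw [basis_eq_el, basis_eq_el F h, el_mul_el]
  split_ifs
  exacts [IsNonneg.self _, IsNonneg.zero]

theorem isPositiveBasis : IsPositiveBasis (basis F) where
  mul_nonneg := isNonneg_mul
  one_nonneg := by
    rw [one_eq]
    exact IsNonneg.sum fun _ _ => IsNonneg.self _
  comul_nonneg g j k := by
    rw [basis_eq_el, comul_el]
    exact IsNonneg.sum (b := (basis F).tensorProduct (basis F))
      (fun _ _ => (IsNonneg.self _).tmul (IsNonneg.self _)) (j, k)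
  counit_nonneg g := by
    rw [basis_eq_el, counit_el]
    split_ifs
    exacts [zero_le_one, le_rfl]
  antipode_nonneg g := by
    have h : HopfAlgebra.antipode ℂ (basis F g) = basis F g⁻¹ := (basis F).constr_basis ℂ _ g
    rw [h]
    exact IsNonneg.self _

theorem rMatrix_eq_tens (ξ η : F.pos →* F.neg) :
    F.rMatrix ξ η = tens F 1 (fun p q => (F.negPow (η q) p)⁻¹) (fun p _ => ξ p) := by
  simp only [UniqueFactorization.rMatrix, tens, Pi.one_apply, one_smul, el, Subgroup.coe_inv]

theorem isPositiveTensor_rMatrix (ξ η : F.pos →* F.neg) :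
    IsPositiveTensor (basis F) (F.rMatrix ξ η) := fun i j =>
  IsNonneg.sum (b := (basis F).tensorProduct (basis F)) (fun _ _ => IsNonneg.sum fun _ _ =>
    (IsNonneg.self _).tmul (IsNonneg.self _)) (i, j)

theorem el_one_tmul_el_one_mul (p q p' q' : F.pos) (x y : F.neg) :
    (el F p 1 ⊗ₜ[ℂ] el F q 1) * (el F p' x ⊗ₜ[ℂ] el F q' y) =
      if p = p' ∧ q = q' then el F p x ⊗ₜ[ℂ] el F q y else 0 := by
  simp only [Algebra.TensorProduct.tmul_mul_tmul, el_mul_el, F.posPow_one, one_mul, ite_and,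
    TensorProduct.ite_tmul, TensorProduct.tmul_ite]
  split_ifs <;> rfl

theorem exists_el_one_tmul_el_one_mul_eq {R S : Bicross F ⊗[ℂ] Bicross F}
    (hR : IsPositiveTensor (basis F) R) (hS : IsPositiveTensor (basis F) S) (hSR : S * R = 1)
    (p q : F.pos) : ∃ (r : ℝ) (x y : F.neg), 0 < r ∧
      (el F p 1 ⊗ₜ[ℂ] el F q 1) * R = (r : ℂ) • (el F p x ⊗ₜ[ℂ] el F q y) := by
  set B := (basis F).tensorProduct (basis F)
  have hB_mul : ∀ i j, IsNonneg B (B i * B j) :=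
    IsNonneg.basis_tmul_mul (b := basis F) isNonneg_mul
  have hpos : ∀ T, IsPositiveTensor (basis F) T → ∀ i, IsNonneg B (B i * T) := by
    intro T hT i
    have hT' : IsNonneg B T := fun ij => hT ij.1 ij.2
    exact IsNonneg.mul hB_mul (IsNonneg.self i) hT'
  have hB : ∀ g h, B (g, h) = basis F g ⊗ₜ[ℂ] basis F h := fun g h =>
    Module.Basis.tensorProduct_apply ..
  obtain ⟨σ, z, hz, hσ⟩ := exists_perm_smul_of_nonneg_linearMap_inverse B
    (f := LinearMap.mulRight ℂ R) (g := LinearMap.mulRight ℂ S) (hpos R hR) (hpos S hS)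
    (LinearMap.ext fun x => by simp [mul_assoc, hSR])
  obtain ⟨r, hr, hrz⟩ := RCLike.pos_iff_exists_ofReal.1 (hz (p, q))
  have hmul := hσ (p, q)
  set g := σ (p, q)
  have hpq : B (p, q) = el F p 1 ⊗ₜ[ℂ] el F q 1 := by simp [hB, el]
  rw [LinearMap.mulRight_apply, hpq, hB, basis_eq_el, basis_eq_el, ← hrz] at hmul
  have hidem : (el F p 1 ⊗ₜ[ℂ] el F q 1) * ((el F p 1 ⊗ₜ[ℂ] el F q 1) * R) =
      (el F p 1 ⊗ₜ[ℂ] el F q 1) * R := by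
    rw [← mul_assoc, el_one_tmul_el_one_mul, if_pos ⟨rfl, rfl⟩]
  have hne : (el F p 1 ⊗ₜ[ℂ] el F q 1) * R ≠ 0 := by
    rw [hmul, ← basis_eq_el, ← basis_eq_el, ← hB]
    exact smul_ne_zero (RCLike.ofReal_ne_zero.2 hr.ne') (B.ne_zero _)
  rw [← hidem, hmul, mul_smul_comm, el_one_tmul_el_one_mul] at hne
  obtain ⟨hp, hq⟩ : p = F.posPart g.1 ∧ q = F.posPart g.2 := by
    by_contra h
    exact hne (by rw [if_neg h, smul_zero])
  exact ⟨r, F.negPart g.1, F.negPart g.2, hr, hmul.trans (by rw [← hp, ← hq]; rfl)⟩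

theorem exists_eq_tens {R S : Bicross F ⊗[ℂ] Bicross F} (hR : IsPositiveTensor (basis F) R)
    (hS : IsPositiveTensor (basis F) S) (hSR : S * R = 1) :
    ∃ (r : F.pos → F.pos → ℝ) (a b : F.pos → F.pos → F.neg), (∀ p q, 0 < r p q) ∧
      R = tens F (fun p q => r p q) a b := by
  choose r a b hr h using exists_el_one_tmul_el_one_mul_eq hR hS hSR
  refine ⟨r, a, b, hr, ?_⟩
  calc R = tens F 1 1 1 * R := by rw [← one_eq_tens, one_mul]
    _ = tens F (fun p q => r p q) a b := by
      simp only [tens, Finset.sum_mul, Pi.one_apply, one_smul, h]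

end Bicross

/-! ### Positive triangular structures -/

namespace UniqueFactorization.IsBraided

variable {G : Type u} [Group G] {F : UniqueFactorization G} {ξ : F.pos →* F.neg}

theorem posOnNeg_mul_map (h : F.IsBraided ξ) (p : F.pos) (x : F.neg) :
    F.posOnNeg p x * ξ (F.posPow p x) = ξ p * x := by
  simpa only [F.negOnPos_posPow, F.negPow_posPow] using
    (h.2 (F.posPow p x) (F.posOnNeg p x)).symm

theorem negPow_map (h : F.IsBraided ξ) (p q : F.pos) :
    F.negPow (ξ q) p = ξ (F.posPow q (ξ p)) := by
  have hmul := h.2 p (ξ q)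
  rw [← map_mul, h.1 q p, map_mul] at hmul
  exact mul_left_cancel hmul

theorem posOnNeg_map (h : F.IsBraided ξ) (p q : F.pos) :
    F.posOnNeg q (ξ p) = ξ (F.negOnPos (ξ q) p) := by
  have hmul := h.posOnNeg_mul_map q (ξ p)
  rw [← map_mul, h.1 q p, map_mul] at hmul
  exact mul_right_cancel hmul

end UniqueFactorization.IsBraided

namespace UniqueFactorization

variable {G : Type u} [Group G] {F : UniqueFactorization G} {ξ : F.pos →* F.neg}

theorem IsQuasiTriangularPair.isAbelianNormal (h : F.IsQuasiTriangularPair ξ ξ) :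
    F.IsAbelianNormal ξ := by
  obtain ⟨A, B, hA, -, hn, -, f, hf⟩ := h
  refine ⟨A, hA, hn, fun a ha b hb => ?_⟩
  have hinv : ∀ c : A, (f c : G) = (c : G)⁻¹ := by
    intro c
    obtain ⟨p, hp⟩ : (c : G) ∈ F.leftSet ξ := hA ▸ c.2
    rw [hf p c hp.symm, ← hp]
    simp
  have hmul := congrArg Subtype.val (map_mul f ⟨a, ha⟩ ⟨b, hb⟩)
  rw [Subgroup.coe_mul, hinv, hinv, hinv] at hmul
  simpa using congrArg (·⁻¹) hmul

end UniqueFactorization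

namespace Bicross

open UniqueFactorization

variable {G : Type u} [Group G] [Finite G] {F : UniqueFactorization G} {ξ η : F.pos →* F.neg}

theorem comm_rMatrix_mul_rMatrix (h : F.IsBraided ξ) :
    TensorProduct.comm ℂ _ _ (F.rMatrix ξ ξ) * F.rMatrix ξ ξ = 1 := by
  have hpow : ∀ p q, F.posPow (F.negOnPos (ξ q) p) (ξ (F.posPow q (ξ p))) = p := fun p q => by
    rw [← h.negPow_map, F.posPow_negOnPos]
  rw [rMatrix_eq_tens, comm_tens_mul_tens, one_eq_tens]
  congr 1 <;> funext q p
  · exact mul_one 1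
  · simp only [F.posPow_negPow_inv]
    simp only [h.negPow_map, hpow, mul_inv_cancel, Pi.one_apply]
  · simp only [h.negPow_map, inv_mul_cancel, Pi.one_apply]

theorem comm_comul_mul_rMatrix (h : F.IsBraided ξ) (c : Bicross F) :
    TensorProduct.comm ℂ _ _ (Coalgebra.comul (R := ℂ) c) * F.rMatrix ξ ξ =
      F.rMatrix ξ ξ * Coalgebra.comul (R := ℂ) c := by
  suffices LinearMap.mulRight ℂ (F.rMatrix ξ ξ) ∘ₗ
      (TensorProduct.comm ℂ (Bicross F) (Bicross F)).toLinearMap ∘ₗ Coalgebra.comul (R := ℂ) =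
      LinearMap.mulLeft ℂ (F.rMatrix ξ ξ) ∘ₗ Coalgebra.comul (R := ℂ) from
    LinearMap.congr_fun this c
  refine ext_el F fun w x => ?_
  simp only [LinearMap.comp_apply, LinearMap.mulRight_apply, LinearMap.mulLeft_apply,
    LinearEquiv.coe_coe]
  rw [rMatrix_eq_tens, tens_mul_comul, comm_comul_mul_tens]
  congr 1 <;> funext p q
  · simp only [F.posPow_negPow_inv, ← h.1 q p, Pi.one_apply]
  · rw [h.negPow_map, h.negPow_map, ← F.posPow_mul, h.posOnNeg_mul_map, F.posPow_mul,
      mul_inv_eq_iff_eq_mul, mul_assoc, h.posOnNeg_mul_map, inv_mul_cancel_left]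
  · exact h.posOnNeg_mul_map p x

theorem comul_left_rMatrix (h : F.IsBraided ξ) :
    TensorProduct.assoc ℂ _ _ _ (LinearMap.rTensor (Bicross F) (Coalgebra.comul (R := ℂ))
      (F.rMatrix ξ ξ)) = leg₁₃ (F.rMatrix ξ ξ) * leg₂₃ (F.rMatrix ξ ξ) := by
  rw [rMatrix_eq_tens, comul_left_tens, leg₁₃_mul_leg₂₃_tens]
  congr 1 <;> funext p p' q
  · exact (mul_one 1).symm
  · rw [F.negPow_inv, F.negPow_inv, ← F.mul_posOnNeg, mul_inv_rev, mul_inv_cancel_left]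
  · rw [h.negPow_map, h.negPow_map, map_mul, F.posPow_mul]
  · exact map_mul ξ p p'

theorem comul_right_rMatrix (h : F.IsBraided ξ) :
    LinearMap.lTensor (Bicross F) (Coalgebra.comul (R := ℂ)) (F.rMatrix ξ ξ) =
      leg₁₃ (F.rMatrix ξ ξ) * leg₁₂ (F.rMatrix ξ ξ) := by
  rw [rMatrix_eq_tens, comul_right_tens, leg₁₃_mul_leg₁₂_tens]
  congr 1 <;> funext p q q'
  · exact (mul_one 1).symm
  · rw [F.posPow_negPow_inv, map_mul, F.mul_negPow, mul_inv_rev]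
  · rw [F.posPow_negPow_inv, h.posOnNeg_map]

theorem isTriangular_rMatrix (h : F.IsBraided ξ) : IsTriangular (F.rMatrix ξ ξ) := by
  have hleft := comm_rMatrix_mul_rMatrix h
  have hright : F.rMatrix ξ ξ * TensorProduct.comm ℂ _ _ (F.rMatrix ξ ξ) = 1 := by
    have hcomm : ∀ z : Bicross F ⊗[ℂ] Bicross F,
        Algebra.TensorProduct.comm ℂ (Bicross F) (Bicross F) (TensorProduct.comm ℂ _ _ z) = z :=
      (TensorProduct.comm ℂ (Bicross F) (Bicross F)).symm_apply_apply
    have hmap := congrArg (Algebra.TensorProduct.comm ℂ (Bicross F) (Bicross F)) hleft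
    rwa [map_mul, map_one, hcomm] at hmap
  refine ⟨⟨⟨_, hright, hleft, fun g => ?_⟩, comul_left_rMatrix h, comul_right_rMatrix h, ?_, ?_⟩,
    hleft⟩
  · rw [← comm_comul_mul_rMatrix h, mul_assoc, hright, mul_one]
  · rw [rMatrix_eq_tens, counit_left_tens, one_eq]
    simp
  · rw [rMatrix_eq_tens, counit_right_tens, one_eq]
    simp [F.one_negPow]

theorem eq_of_comm_rMatrix_mul_rMatrix
    (h : TensorProduct.comm ℂ _ _ (F.rMatrix ξ η) * F.rMatrix ξ η = 1) : ξ = η := by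
  rw [rMatrix_eq_tens, comm_tens_mul_tens, one_eq_tens] at h
  ext q : 1
  obtain ⟨-, -, hq⟩ := eq_of_tens_eq h (p := q) (q := 1) (by simp)
  simp only [map_one, F.posPow_one, F.negPow_one, Pi.one_apply, inv_mul_eq_one] at hq
  exact hq.symm

theorem rMatrix_injective : Function.Injective fun ξ : F.pos →* F.neg => F.rMatrix ξ ξ := by
  intro ξ η h
  simp only [rMatrix_eq_tens] at h
  ext p : 1
  exact (eq_of_tens_eq h (p := p) (q := 1) one_ne_zero).2.2

theorem isTriangular_rMatrix_iff (h : F.IsQuasiTriangularPair ξ η) :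
    IsTriangular (F.rMatrix ξ η) ↔ ξ = η := by
  refine ⟨fun h' => eq_of_comm_rMatrix_mul_rMatrix h'.comm_mul_self, ?_⟩
  rintro rfl
  exact isTriangular_rMatrix (isAbelianNormal_iff_isBraided.1 h.isAbelianNormal)

end Bicross

theorem eq_one_of_pos_of_map_mul {G K : Type*} [Group G] [Finite G] [Ring K] [LinearOrder K]
    [IsStrictOrderedRing K] {f : G → K} (hf : ∀ g, 0 < f g) (hmul : ∀ g h, f (g * h) = f g * f h)
    (g : G) : f g = 1 := by
  have hone : f 1 = 1 := by
    have h := hmul 1 1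
    rw [mul_one] at h
    exact (mul_eq_left₀ (hf 1).ne').1 h.symm
  let φ : G →* K := { toFun := f, map_one' := hone, map_mul' := hmul }
  have hpow : φ g ^ Nat.card G = 1 := by rw [← map_pow, pow_card_eq_one', map_one]
  exact (pow_eq_one_iff_of_nonneg (hf g).le Nat.card_pos.ne').1 hpow

namespace Bicross

open UniqueFactorization

variable {G : Type u} [Group G] [Finite G] {F : UniqueFactorization G}

theorem prod_eq_one_of_mul_negOnPos {K : Type*} [CommRing K] [LinearOrder K]
    [IsStrictOrderedRing K] {r : F.pos → F.pos → K} (hr : ∀ p q, 0 < r p q) (η : F.pos → F.neg)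
    (h : ∀ p q q', r p (q * q') = r p q' * r (F.negOnPos (η q') p) q) (q : F.pos) :
    ∏ p, r p q = 1 := by
  refine eq_one_of_pos_of_map_mul (f := fun q => ∏ p, r p q)
    (fun q => Finset.prod_pos fun p _ => hr p q) (fun q q' => ?_) q
  have hinj : Function.Injective (F.negOnPos (η q')) :=
    (Function.RightInverse.injective (g := F.negOnPos (η q')⁻¹) fun p => by
      simpa using F.negOnPos_inv_negOnPos (η q')⁻¹ p)
  simp only [h, Finset.prod_mul_distrib]
  rw [mul_comm, hinj.bijective_of_finite.prod_comp fun p => r p q]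

theorem eq_one_of_twisted_mul {K : Type*} [CommRing K] [LinearOrder K]
    [IsStrictOrderedRing K] {r : F.pos → F.pos → K} (hr : ∀ p q, 0 < r p q) (ξ η : F.pos → F.neg)
    (hξ : ∀ p p' q, r (p * p') q = r p q * r p' (F.posPow q (ξ p)))
    (hη : ∀ p q q', r p (q * q') = r p q' * r (F.negOnPos (η q') p) q) (p q : F.pos) :
    r p q = 1 := by
  have hprod := prod_eq_one_of_mul_negOnPos hr η hη
  have hpow : r p q ^ Fintype.card F.pos = 1 := calc
    r p q ^ Fintype.card F.pos = ∏ p', r p q * r p' (F.posPow q (ξ p)) := by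
      rw [Finset.prod_mul_distrib, hprod, mul_one, Finset.prod_const, Finset.card_univ]
    _ = ∏ p', r (p * p') q := by simp only [hξ]
    _ = ∏ p', r p' q := Equiv.prod_comp (Equiv.mulLeft p) fun p' => r p' q
    _ = 1 := hprod q
  exact (pow_eq_one_iff_of_nonneg (hr p q).le Fintype.card_ne_zero).1 hpow

section Tens

variable {r : F.pos → F.pos → ℝ} {a b : F.pos → F.pos → F.neg}

theorem mul_left_of_isQuasiTriangular_tens (hr : ∀ p q, 0 < r p q)
    (h : IsQuasiTriangular (tens F (fun p q => r p q) a b)) (p p' q : F.pos) :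
    r (p * p') q = r p q * r p' (F.posPow q (b p q)) ∧
      F.posOnNeg p' (a (p * p') q) = a p q ∧ a (p * p') q = a p' (F.posPow q (b p q)) ∧
      b (p * p') q = b p q * b p' (F.posPow q (b p q)) := by
  have hcomul := h.comul_left
  rw [comul_left_tens, leg₁₃_mul_leg₂₃_tens] at hcomul
  obtain ⟨hrr, hab⟩ := eq_of_tens₃_eq hcomul (p := p) (q := p') (s := q)
    (Complex.ofReal_ne_zero.2 (hr _ _).ne')
  exact ⟨by exact_mod_cast hrr, hab⟩

theorem mul_right_of_isQuasiTriangular_tens (hr : ∀ p q, 0 < r p q)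
    (h : IsQuasiTriangular (tens F (fun p q => r p q) a b)) (p q q' : F.pos) :
    r p (q * q') = r p q' * r (F.posPow p (a p q')) q ∧
      a p (q * q') = a p q' * a (F.posPow p (a p q')) q ∧
      F.posOnNeg q' (b p (q * q')) = b (F.posPow p (a p q')) q ∧ b p (q * q') = b p q' := by
  have hcomul := h.comul_right
  rw [comul_right_tens, leg₁₃_mul_leg₁₂_tens] at hcomul
  obtain ⟨hrr, hab⟩ := eq_of_tens₃_eq hcomul (p := p) (q := q) (s := q')
    (Complex.ofReal_ne_zero.2 (hr _ _).ne')
  exact ⟨by exact_mod_cast hrr, hab⟩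

theorem exists_hom_of_isQuasiTriangular_tens (hr : ∀ p q, 0 < r p q)
    (h : IsQuasiTriangular (tens F (fun p q => r p q) a b)) :
    ∃ ξ η : F.pos →* F.neg, (∀ p q, a p q = (F.negPow (η q) p)⁻¹) ∧ ∀ p q, b p q = ξ p := by
  have hleft := mul_left_of_isQuasiTriangular_tens hr h
  have hright := mul_right_of_isQuasiTriangular_tens hr h
  have hb : ∀ p q, b p q = b p 1 := fun p q => by simpa using (hright p q 1).2.2.2
  have ha : ∀ p q, a p q = F.posOnNeg p⁻¹ (a 1 q) := fun p q => by
    have hpq := (hleft 1 p q).2.1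
    rw [one_mul] at hpq
    rw [← hpq, ← F.mul_posOnNeg, inv_mul_cancel, F.one_posOnNeg]
  refine ⟨MonoidHom.mk' (fun p => b p 1) fun p p' => ?_,
    MonoidHom.mk' (fun q => (a 1 q)⁻¹) fun q q' => ?_, fun p q => ?_, hb⟩
  · rw [(hleft p p' 1).2.2.2, hb p']
  · rw [(hright 1 q q').2.1, F.one_posPow, mul_inv_rev]
  · rw [F.negPow_inv, MonoidHom.mk'_apply, inv_inv, ha]

theorem exists_rMatrix_eq_of_isQuasiTriangular_tens (hr : ∀ p q, 0 < r p q)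
    (h : IsQuasiTriangular (tens F (fun p q => r p q) a b)) :
    ∃ ξ η : F.pos →* F.neg, F.rMatrix ξ η = tens F (fun p q => r p q) a b := by
  obtain ⟨ξ, η, ha, hb⟩ := exists_hom_of_isQuasiTriangular_tens hr h
  have hr_one : ∀ p q, r p q = 1 := by
    refine eq_one_of_twisted_mul hr ξ η (fun p p' q => ?_) fun p q q' => ?_
    · rw [(mul_left_of_isQuasiTriangular_tens hr h p p' q).1, hb]
    · rw [(mul_right_of_isQuasiTriangular_tens hr h p q q').1, ha, F.posPow_negPow_inv]
  refine ⟨ξ, η, ?_⟩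
  rw [rMatrix_eq_tens]
  congr 1 <;> funext p q
  exacts [by simp [hr_one], (ha p q).symm, (hb p q).symm]

end Tens

theorem isBraided_of_isQuasiTriangular_rMatrix {ξ : F.pos →* F.neg}
    (h : IsQuasiTriangular (F.rMatrix ξ ξ)) : F.IsBraided ξ := by
  obtain ⟨S, -, hSR, hcomm⟩ := h.exists_inv
  have hbraid : ∀ (p q : F.pos) (x : F.neg), q * p = F.negOnPos (ξ q) p * F.posPow q (ξ p) ∧
      F.posOnNeg p x * ξ (F.posPow p x) = ξ p * x := by
    intro p q x
    have hpq := congrArg (· * F.rMatrix ξ ξ) (hcomm (el F (q * p) x))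
    simp only [mul_assoc, hSR, mul_one] at hpq
    rw [rMatrix_eq_tens, tens_mul_comul, comm_comul_mul_tens] at hpq
    obtain ⟨hr, -, hb⟩ := eq_of_tens_eq hpq (p := p) (q := q) (by simp)
    refine ⟨?_, hb⟩
    rw [if_pos rfl, F.posPow_negPow_inv] at hr
    by_contra hne
    exact one_ne_zero (hr.trans (if_neg (Ne.symm hne)))
  refine ⟨fun p q => (hbraid q p 1).1, fun p x => ?_⟩
  have hmul := (hbraid (F.negOnPos x p) 1 (F.negPow x p)).2
  rw [F.posOnNeg_negOnPos, F.posPow_negOnPos] at hmul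
  exact hmul.symm

theorem exists_isBraided_of_isTriangular {R : Bicross F ⊗[ℂ] Bicross F} (h : IsTriangular R)
    (hR : IsPositiveTensor (basis F) R) :
    ∃ ξ : F.pos →* F.neg, F.IsBraided ξ ∧ F.rMatrix ξ ξ = R := by
  have hS : IsPositiveTensor (basis F) (TensorProduct.comm ℂ _ _ R) := fun i j =>
    IsNonneg.comm (fun ij => hR ij.1 ij.2) (i, j)
  obtain ⟨r, a, b, hr, rfl⟩ := exists_eq_tens hR hS h.comm_mul_self
  obtain ⟨ξ, η, hξη⟩ := exists_rMatrix_eq_of_isQuasiTriangular_tens hr h.toIsQuasiTriangular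
  rw [← hξη] at h ⊢
  obtain rfl := eq_of_comm_rMatrix_mul_rMatrix h.comm_mul_self
  exact ⟨ξ, isBraided_of_isQuasiTriangular_rMatrix h.toIsQuasiTriangular, rfl⟩

theorem bijOn_rMatrix (F : UniqueFactorization G) :
    Set.BijOn (fun ξ => F.rMatrix ξ ξ) {ξ | F.IsAbelianNormal ξ}
      {R | IsTriangular R ∧ IsPositiveTensor (basis F) R} := by
  simp only [isAbelianNormal_iff_isBraided]
  refine ⟨fun ξ h => ⟨isTriangular_rMatrix h, isPositiveTensor_rMatrix ξ ξ⟩,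
    rMatrix_injective.injOn, ?_⟩
  rintro R ⟨h, hR⟩
  exact exists_isBraided_of_isTriangular h hR

end Bicross

/-! ### The combinatorics of the supports of the structure constants -/

/-- The relations satisfied by the supports of the structure constants of a Hopf algebra with a
positive basis: `mul i j k` says that `k` occurs in the product of `i` and `j`, and `comul i j k`
that `i ⊗ j` occurs in the coproduct of `k`. The last two fields say that
`a ⊗ b ↦ a₁ ⊗ a₂ b` and `a ⊗ b ↦ a b₁ ⊗ b₂` permute the basis `i ⊗ j` up to positive factors. -/
structure HopfSupport (ι : Type*) where
  mul : ι → ι → ι → Prop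
  comul : ι → ι → ι → Prop
  unit : ι → Prop
  counit : ι → Prop
  assoc : ∀ i j k l, (∃ m, mul i j m ∧ mul m k l) ↔ ∃ m, mul j k m ∧ mul i m l
  coassoc : ∀ i j k l, (∃ m, comul i j m ∧ comul m k l) ↔ ∃ m, comul j k m ∧ comul i m l
  unit_mul : ∀ j k, (∃ i, unit i ∧ mul i j k) ↔ j = k
  mul_unit : ∀ j k, (∃ i, unit i ∧ mul j i k) ↔ j = k
  counit_comul : ∀ j k, (∃ i, counit i ∧ comul i j k) ↔ j = k
  comul_counit : ∀ j k, (∃ i, counit i ∧ comul j i k) ↔ j = k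
  mul_comul : ∀ i j k l, (∃ m, mul i j m ∧ comul k l m) ↔
    ∃ a b c d, comul a b i ∧ comul c d j ∧ mul a c k ∧ mul b d l
  counit_mul : ∀ i j, (∃ m, mul i j m ∧ counit m) ↔ counit i ∧ counit j
  unit_comul : ∀ i j, (∃ m, comul i j m ∧ unit m) ↔ unit i ∧ unit j
  counit_unit : ∃ i, unit i ∧ counit i
  left_perm : ∃ σ : Equiv.Perm (ι × ι), ∀ i j k l,
    (∃ m, comul k m i ∧ mul m j l) ↔ (k, l) = σ (i, j)
  right_perm : ∃ σ : Equiv.Perm (ι × ι), ∀ i j k l,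
    (∃ m, comul m l j ∧ mul i m k) ↔ (k, l) = σ (i, j)

namespace HopfSupport

variable {ι : Type*} (P : HopfSupport ι)

/-- The supports for the dual Hopf algebra. -/
def dual : HopfSupport ι where
  mul := P.comul
  comul := P.mul
  unit := P.counit
  counit := P.unit
  assoc := P.coassoc
  coassoc := P.assoc
  unit_mul := P.counit_comul
  mul_unit := P.comul_counit
  counit_comul := P.unit_mul
  comul_counit := P.mul_unit
  mul_comul i j k l := by
    rw [exists_congr fun _ => and_comm, P.mul_comul k l i j]
    exact ⟨fun ⟨a, b, c, d, hi, hj, hk, hl⟩ => ⟨a, c, b, d, hk, hl, hi, hj⟩,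
      fun ⟨a, b, c, d, hi, hj, hk, hl⟩ => ⟨a, c, b, d, hk, hl, hi, hj⟩⟩
  counit_mul := P.unit_comul
  unit_comul := P.counit_mul
  counit_unit := P.counit_unit.imp fun _ => And.symm
  left_perm := by
    obtain ⟨σ, h⟩ := P.right_perm
    refine ⟨σ.symm, fun i j k l => ?_⟩
    rw [Equiv.eq_symm_apply, eq_comm, ← h]
    exact exists_congr fun _ => and_comm
  right_perm := by
    obtain ⟨σ, h⟩ := P.left_perm
    refine ⟨σ.symm, fun i j k l => ?_⟩
    rw [Equiv.eq_symm_apply, eq_comm, ← h]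
    exact exists_congr fun _ => and_comm

/-- The supports for the Hopf algebra with opposite product and opposite coproduct. -/
def op : HopfSupport ι where
  mul i j := P.mul j i
  comul i j := P.comul j i
  unit := P.unit
  counit := P.counit
  assoc i j k l := (P.assoc k j i l).symm
  coassoc i j k l := (P.coassoc k j i l).symm
  unit_mul := P.mul_unit
  mul_unit := P.unit_mul
  counit_comul := P.comul_counit
  comul_counit := P.counit_comul
  mul_comul i j k l := by
    rw [P.mul_comul j i l k]
    exact ⟨fun ⟨a, b, c, d, hi, hj, hk, hl⟩ => ⟨d, c, b, a, hj, hi, hl, hk⟩,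
      fun ⟨a, b, c, d, hi, hj, hk, hl⟩ => ⟨d, c, b, a, hj, hi, hl, hk⟩⟩
  counit_mul i j := (P.counit_mul j i).trans and_comm
  unit_comul i j := (P.unit_comul j i).trans and_comm
  counit_unit := P.counit_unit
  left_perm := by
    obtain ⟨σ, h⟩ := P.right_perm
    refine ⟨(Equiv.prodComm _ _).trans (σ.trans (Equiv.prodComm _ _)), fun i j k l => ?_⟩
    rw [h j i l k]
    exact (Equiv.prodComm ι ι).injective.eq_iff.symm
  right_perm := by
    obtain ⟨σ, h⟩ := P.left_perm
    refine ⟨(Equiv.prodComm _ _).trans (σ.trans (Equiv.prodComm _ _)), fun i j k l => ?_⟩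
    rw [h j i l k]
    exact (Equiv.prodComm ι ι).injective.eq_iff.symm

variable {P}

theorem eq_of_unit_mul {u j k : ι} (hu : P.unit u) (h : P.mul u j k) : j = k :=
  (P.unit_mul j k).1 ⟨u, hu, h⟩

theorem eq_of_mul_unit {u j k : ι} (hu : P.unit u) (h : P.mul j u k) : j = k :=
  (P.mul_unit j k).1 ⟨u, hu, h⟩

variable (P)

/-- The left unit of the index `j`: the unit `u` such that `j` occurs in the product of `u` and
`j`. Products are thus composable arrows `src j ⟶ tgt j` of a groupoid. -/
def src (j : ι) : ι := ((P.unit_mul j j).2 rfl).choose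

/-- The right unit of the index `j`. -/
def tgt (j : ι) : ι := P.op.src j

/-- The left counit of the index `j`. -/
def cosrc (j : ι) : ι := P.dual.src j

/-- The right counit of the index `j`. -/
def cotgt (j : ι) : ι := P.dual.op.src j

theorem unit_src (j : ι) : P.unit (P.src j) := ((P.unit_mul j j).2 rfl).choose_spec.1

theorem src_mul_self (j : ι) : P.mul (P.src j) j j := ((P.unit_mul j j).2 rfl).choose_spec.2

theorem unit_tgt (j : ι) : P.unit (P.tgt j) := P.op.unit_src j

theorem mul_tgt_self (j : ι) : P.mul j (P.tgt j) j := P.op.src_mul_self j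

theorem counit_cosrc (j : ι) : P.counit (P.cosrc j) := P.dual.unit_src j

theorem cosrc_comul_self (j : ι) : P.comul (P.cosrc j) j j := P.dual.src_mul_self j

theorem counit_cotgt (j : ι) : P.counit (P.cotgt j) := P.dual.op.unit_src j

theorem comul_cotgt_self (j : ι) : P.comul j (P.cotgt j) j := P.dual.op.src_mul_self j

variable {P}

theorem eq_of_unit_mul_unit {u v k : ι} (hu : P.unit u) (hv : P.unit v) (h : P.mul u v k) :
    u = v :=
  (eq_of_mul_unit hv h).trans (eq_of_unit_mul hu h).symm

theorem src_eq {u j k : ι} (hu : P.unit u) (h : P.mul u j k) : P.src j = u := by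
  obtain rfl := eq_of_unit_mul hu h
  obtain ⟨m, hm, -⟩ := (P.assoc u (P.src j) j j).2 ⟨j, P.src_mul_self j, h⟩
  exact (eq_of_unit_mul_unit hu (P.unit_src j) hm).symm

theorem cosrc_eq {x j k : ι} (hx : P.counit x) (h : P.comul x j k) : P.cosrc j = x :=
  src_eq (P := P.dual) hx h

theorem cotgt_eq {x j k : ι} (hx : P.counit x) (h : P.comul j x k) : P.cotgt j = x :=
  src_eq (P := P.dual.op) hx h

theorem src_unit {u : ι} (hu : P.unit u) : P.src u = u :=
  eq_of_unit_mul_unit (P.unit_src u) hu (P.src_mul_self u)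

theorem tgt_unit {u : ι} (hu : P.unit u) : P.tgt u = u := src_unit (P := P.op) hu

theorem cosrc_counit {x : ι} (hx : P.counit x) : P.cosrc x = x := src_unit (P := P.dual) hx

theorem cotgt_counit {x : ι} (hx : P.counit x) : P.cotgt x = x := src_unit (P := P.dual.op) hx

theorem eq_of_mul {i i' j j' k k' : ι} (h : P.mul i j k) (h' : P.mul i' j' k')
    (hv : P.cosrc i = P.cosrc i') (hk : k = k') : i = i' ∧ j = j' := by
  obtain ⟨σ, hσ⟩ := P.left_perm
  have hσk := (hσ i j (P.cosrc i) k).1 ⟨i, P.cosrc_comul_self i, h⟩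
  have hσk' := (hσ i' j' (P.cosrc i') k').1 ⟨i', P.cosrc_comul_self i', h'⟩
  rw [hv, hk, hσk'] at hσk
  exact Prod.mk.inj (σ.injective hσk.symm)

theorem mul_unique {i j k k' : ι} (h : P.mul i j k) (h' : P.mul i j k') : k = k' := by
  obtain ⟨σ, hσ⟩ := P.left_perm
  have hσk := (hσ i j (P.cosrc i) k).1 ⟨i, P.cosrc_comul_self i, h⟩
  have hσk' := (hσ i j (P.cosrc i) k').1 ⟨i, P.cosrc_comul_self i, h'⟩
  exact (Prod.mk.inj (hσk.trans hσk'.symm)).2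

theorem mul_left_cancel {i j j' k : ι} (h : P.mul i j k) (h' : P.mul i j' k) : j = j' :=
  (eq_of_mul h h' rfl rfl).2

theorem mul_right_cancel {i i' j k : ι} (h : P.mul i j k) (h' : P.mul i' j k) : i = i' :=
  mul_left_cancel (P := P.op) h h'

theorem tgt_eq_src {i j k : ι} (h : P.mul i j k) : P.tgt i = P.src j := by
  obtain ⟨q, hq, -⟩ := (P.assoc i (P.tgt i) j k).1 ⟨i, P.mul_tgt_self i, h⟩
  exact (src_eq (P.unit_tgt i) hq).symm

theorem exists_mul {i j : ι} (h : P.tgt i = P.src j) : ∃ k, P.mul i j k := by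
  obtain ⟨σ, hσ⟩ := P.left_perm
  have hσi := (hσ i (P.tgt i) (P.cosrc i) i).1
    ⟨i, P.cosrc_comul_self i, P.mul_tgt_self i⟩
  obtain ⟨m, hm, hm'⟩ := (hσ i j (σ (i, j)).1 (σ (i, j)).2).2 rfl
  obtain ⟨q, hq, hq'⟩ := (P.assoc m (P.tgt i) j (σ (i, j)).2).2
    ⟨j, h ▸ P.src_mul_self j, hm'⟩
  have hσq := (hσ i (P.tgt i) _ q).1 ⟨m, hm, hq⟩
  obtain rfl := (Prod.mk.inj (hσi.trans hσq.symm)).2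
  exact ⟨_, hq'⟩

theorem src_mul {i j k : ι} (h : P.mul i j k) : P.src k = P.src i := by
  obtain ⟨q, hq, hq'⟩ := (P.assoc (P.src i) i j k).1 ⟨i, P.src_mul_self i, h⟩
  obtain rfl := mul_unique h hq
  exact src_eq (P.unit_src i) hq'

theorem tgt_mul {i j k : ι} (h : P.mul i j k) : P.tgt k = P.tgt j := src_mul (P := P.op) h

theorem cosrc_comul {i j k : ι} (h : P.comul i j k) : P.cosrc k = P.cosrc i :=
  src_mul (P := P.dual) h

theorem cotgt_comul {i j k : ι} (h : P.comul i j k) : P.cotgt k = P.cotgt j :=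
  tgt_mul (P := P.dual) h

theorem exists_mul_of_counit {x : ι} (hx : P.counit x) (d : ι) :
    ∃ i j, P.cosrc i = x ∧ P.mul i j d := by
  obtain ⟨σ, hσ⟩ := P.left_perm
  set ij := σ.symm (x, d) with hij
  obtain ⟨m, hm, hm'⟩ := (hσ ij.1 ij.2 x d).2 (by rw [hij]; simp)
  obtain rfl := eq_of_unit_mul (P := P.dual) hx hm
  exact ⟨_, _, cosrc_eq hx hm, hm'⟩

theorem eq_of_mul_src {i j d : ι} (h : P.mul i j (P.src d)) (hi : P.cosrc i = P.cosrc d) :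
    i = d := by
  have hd := P.src_mul_self d
  obtain ⟨q, -, hq⟩ := (P.assoc i j d d).1 ⟨_, h, hd⟩
  exact (eq_of_mul hq (P.mul_tgt_self d) hi rfl).1

variable (P)

theorem exists_mul_src (d : ι) : ∃ c, P.mul d c (P.src d) := by
  obtain ⟨i, j, hi, h⟩ := exists_mul_of_counit (P.counit_cosrc d) (P.src d)
  obtain rfl := eq_of_mul_src h hi
  exact ⟨j, h⟩

theorem exists_mul_tgt (d : ι) : ∃ c, P.mul c d (P.tgt d) := P.op.exists_mul_src d

/-- The index of the identity of `G`: the one that is both a unit and a counit. -/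
def e : ι := P.counit_unit.choose

theorem unit_e : P.unit P.e := P.counit_unit.choose_spec.1

theorem counit_e : P.counit P.e := P.counit_unit.choose_spec.2

variable {P}

theorem ext_src_cosrc {d d' : ι} (h : P.src d = P.src d') (h' : P.cosrc d = P.cosrc d') :
    d = d' := by
  obtain ⟨c, hc⟩ := P.exists_mul_src d
  rw [h] at hc
  exact eq_of_mul_src hc h'

theorem exists_src_cosrc {u x : ι} (hu : P.unit u) (hx : P.counit x) :
    ∃ d, P.src d = u ∧ P.cosrc d = x := by
  obtain ⟨i, j, hi, h⟩ := exists_mul_of_counit hx u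
  exact ⟨i, by rw [← src_mul h, src_unit hu], hi⟩

theorem ext_tgt_cotgt {d d' : ι} (h : P.tgt d = P.tgt d') (h' : P.cotgt d = P.cotgt d') :
    d = d' :=
  ext_src_cosrc (P := P.op) h h'

theorem exists_tgt_cotgt {u x : ι} (hu : P.unit u) (hx : P.counit x) :
    ∃ d, P.tgt d = u ∧ P.cotgt d = x :=
  exists_src_cosrc (P := P.op) hu hx

theorem eq_e {i : ι} (h : P.unit i) (h' : P.counit i) : i = P.e := by
  obtain ⟨m, hm, -⟩ := (P.counit_mul i P.e).2 ⟨h', P.counit_e⟩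
  exact eq_of_unit_mul_unit h P.unit_e hm

theorem dual_e : P.dual.e = P.e := eq_e P.dual.counit_e P.dual.unit_e

theorem counit_iff_src {x : ι} : P.counit x ↔ P.src x = P.e := by
  constructor
  · intro hx
    refine eq_e (P.unit_src x) ?_
    exact ((P.counit_mul (P.src x) x).1 ⟨x, P.src_mul_self x, hx⟩).1
  · intro h
    obtain ⟨c, hc⟩ := P.exists_mul_src x
    exact ((P.counit_mul x c).1 ⟨_, hc, h ▸ P.counit_e⟩).1

theorem counit_iff_tgt {x : ι} : P.counit x ↔ P.tgt x = P.e := counit_iff_src (P := P.op)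

theorem unit_iff_cosrc {x : ι} : P.unit x ↔ P.cosrc x = P.e := by
  rw [← dual_e]
  exact counit_iff_src (P := P.dual)

theorem unit_iff_cotgt {x : ι} : P.unit x ↔ P.cotgt x = P.e := by
  rw [← dual_e]
  exact counit_iff_tgt (P := P.dual)

theorem counit_of_mul {x y k : ι} (hx : P.counit x) (h : P.mul x y k) : P.counit k := by
  rw [counit_iff_src] at hx ⊢
  rw [src_mul h, hx]

theorem exists_mul_of_counit_counit {x y : ι} (hx : P.counit x) (hy : P.counit y) :
    ∃ k, P.mul x y k :=
  exists_mul ((counit_iff_tgt.1 hx).trans (counit_iff_src.1 hy).symm)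

theorem mul_cotgt {i j k : ι} (h : P.mul i j k) : P.mul (P.cotgt i) (P.cotgt j) (P.cotgt k) := by
  obtain ⟨l, hl⟩ := exists_mul_of_counit_counit (P.counit_cotgt i) (P.counit_cotgt j)
  obtain ⟨m, _, hm⟩ := (P.mul_comul i j k l).2
    ⟨_, _, _, _, P.comul_cotgt_self i, P.comul_cotgt_self j, h, hl⟩
  rwa [cotgt_eq (counit_of_mul (P.counit_cotgt i) hl) hm]

theorem mul_cosrc {i j k : ι} (h : P.mul i j k) : P.mul (P.cosrc i) (P.cosrc j) (P.cosrc k) :=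
  mul_cotgt (P := P.op) h

theorem comul_src {i j k : ι} (h : P.comul i j k) : P.comul (P.src i) (P.src j) (P.src k) :=
  mul_cosrc (P := P.dual) h

theorem comul_tgt {i j k : ι} (h : P.comul i j k) : P.comul (P.tgt i) (P.tgt j) (P.tgt k) :=
  mul_cotgt (P := P.dual) h

theorem ext_src_cotgt {d d' : ι} (h : P.src d = P.src d') (h' : P.cotgt d = P.cotgt d') :
    d = d' := by
  obtain ⟨c, hc⟩ := P.exists_mul_src d
  obtain ⟨c', hc'⟩ := P.exists_mul_src d'
  have hcot := mul_cotgt hc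
  have hcot' := mul_cotgt hc'
  rw [← h, ← h'] at hcot'
  obtain rfl : c = c' := by
    refine ext_tgt_cotgt ?_ (mul_left_cancel hcot hcot')
    rw [← tgt_mul hc, ← tgt_mul hc', h]
  rw [← h] at hc'
  exact mul_right_cancel hc hc'

theorem exists_src_cotgt {u x : ι} (hu : P.unit u) (hx : P.counit x) :
    ∃ d, P.src d = u ∧ P.cotgt d = x := by
  obtain ⟨y, hy⟩ := P.exists_mul_src x
  rw [counit_iff_src.1 hx] at hy
  have hy' : P.counit y := ((P.counit_mul x y).1 ⟨_, hy, P.counit_e⟩).2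
  obtain ⟨c, hc, hc'⟩ := exists_tgt_cotgt hu hy'
  obtain ⟨d, hd⟩ := P.exists_mul_tgt c
  rw [hc] at hd
  refine ⟨d, by rw [← src_mul hd, src_unit hu], ?_⟩
  have hcot := mul_cotgt hd
  rw [hc', unit_iff_cotgt.1 hu] at hcot
  exact mul_right_cancel hcot hy

end HopfSupport

/-! ### Matched pairs of groups -/

/-- A matched pair of groups: a right action `uˣ` of `V` on the set `U` and a left action `ᵘx` of
`U` on the set `V`, compatible with the products. -/
structure MatchedPair (U : Type u) (V : Type v) [Group U] [Group V] where
  pow : U → V → U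
  act : U → V → V
  pow_one : ∀ u, pow u 1 = u
  one_pow : ∀ x, pow 1 x = 1
  act_one : ∀ u, act u 1 = 1
  one_act : ∀ x, act 1 x = x
  pow_mul : ∀ u x y, pow u (x * y) = pow (pow u x) y
  act_mul : ∀ u x y, act u (x * y) = act u x * act (pow u x) y
  mul_act : ∀ u v x, act (u * v) x = act u (act v x)
  mul_pow : ∀ u v x, pow (u * v) x = pow u (act v x) * pow v x

namespace MatchedPair

variable {U : Type u} {V : Type v} [Group U] [Group V] (m : MatchedPair U V)

/-- The group `V U` defined by a matched pair; `⟨x, u⟩` is the product `x u`. -/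
@[ext]
structure Carrier (_m : MatchedPair U V) : Type (max u v) where
  neg : V
  pos : U

instance : Mul m.Carrier := ⟨fun g h => ⟨g.neg * m.act g.pos h.neg, m.pow g.pos h.neg * h.pos⟩⟩
instance : One m.Carrier := ⟨⟨1, 1⟩⟩
instance : Inv m.Carrier := ⟨fun g => ⟨m.act g.pos⁻¹ g.neg⁻¹, m.pow g.pos⁻¹ g.neg⁻¹⟩⟩

theorem mul_def (g h : m.Carrier) :
    g * h = ⟨g.neg * m.act g.pos h.neg, m.pow g.pos h.neg * h.pos⟩ := rfl
theorem one_def : (1 : m.Carrier) = ⟨1, 1⟩ := rfl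
theorem inv_def (g : m.Carrier) : g⁻¹ = ⟨m.act g.pos⁻¹ g.neg⁻¹, m.pow g.pos⁻¹ g.neg⁻¹⟩ := rfl

instance : Group m.Carrier :=
  Group.ofLeftAxioms
    (fun _ _ _ => by
      simp only [mul_def, m.pow_mul, m.act_mul, m.mul_act, m.mul_pow, mul_assoc])
    (fun _ => by simp only [mul_def, one_def, m.one_act, m.one_pow, one_mul])
    (fun _ => by
      simp only [mul_def, inv_def, one_def, ← m.act_mul, ← m.pow_mul, inv_mul_cancel, m.act_one,
        m.pow_one])

instance [Finite U] [Finite V] : Finite m.Carrier :=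
  Finite.of_injective (fun g : m.Carrier => (g.neg, g.pos)) fun _ _ hgh =>
    Carrier.ext (Prod.mk.inj hgh).1 (Prod.mk.inj hgh).2

/-- The inclusion of `U` in the group `V U`. -/
def ofPos : U →* m.Carrier :=
  MonoidHom.mk' (fun u => ⟨1, u⟩) fun u v => by simp [mul_def, m.act_one, m.pow_one]

/-- The inclusion of `V` in the group `V U`. -/
def ofNeg : V →* m.Carrier :=
  MonoidHom.mk' (fun x => ⟨x, 1⟩) fun x y => by simp [mul_def, m.one_act, m.one_pow]

theorem ofPos_injective : Function.Injective m.ofPos := fun _ _ h => congrArg Carrier.pos h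

theorem ofNeg_injective : Function.Injective m.ofNeg := fun _ _ h => congrArg Carrier.neg h

theorem ofNeg_mul_ofPos (x : V) (u : U) : m.ofNeg x * m.ofPos u = ⟨x, u⟩ := by
  rw [mul_def]
  simp [ofNeg, ofPos, m.act_one, m.pow_one]

theorem ofPos_mul_ofNeg (u : U) (x : V) :
    m.ofPos u * m.ofNeg x = m.ofNeg (m.act u x) * m.ofPos (m.pow u x) := by
  rw [ofNeg_mul_ofPos, mul_def]
  simp [ofNeg, ofPos]

/-- The unique factorization of the group defined by a matched pair. -/
def factorization : UniqueFactorization m.Carrier where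
  pos := m.ofPos.range
  neg := m.ofNeg.range
  isComplement := by
    refine Subgroup.IsComplement'.symm ⟨?_, ?_⟩
    · rintro ⟨⟨_, x, rfl⟩, ⟨_, u, rfl⟩⟩ ⟨⟨_, y, rfl⟩, ⟨_, v, rfl⟩⟩ h
      have hmul : m.ofNeg x * m.ofPos u = m.ofNeg y * m.ofPos v := h
      rw [ofNeg_mul_ofPos, ofNeg_mul_ofPos, Carrier.mk.injEq] at hmul
      obtain ⟨rfl, rfl⟩ := hmul
      rfl
    · rintro ⟨x, u⟩
      exact ⟨⟨⟨_, x, rfl⟩, ⟨_, u, rfl⟩⟩, m.ofNeg_mul_ofPos x u⟩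

/-- `U` as the factor `G₊`. -/
def posEquiv : U ≃* m.factorization.pos := MonoidHom.ofInjective m.ofPos_injective

/-- `V` as the factor `G₋`. -/
def negEquiv : V ≃* m.factorization.neg := MonoidHom.ofInjective m.ofNeg_injective

theorem posPow_eq (u : U) (x : V) :
    m.factorization.posPow (m.posEquiv u) (m.negEquiv x) = m.posEquiv (m.pow u x) :=
  m.factorization.posBar_eq (m.negEquiv (m.act u x)) _ (m.ofPos_mul_ofNeg u x)

theorem posOnNeg_eq (u : U) (x : V) :
    m.factorization.posOnNeg (m.posEquiv u) (m.negEquiv x) = m.negEquiv (m.act u x) :=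
  m.factorization.negBar_eq _ (m.posEquiv (m.pow u x)) (m.ofPos_mul_ofNeg u x)

end MatchedPair

/-! ### The group attached to the supports of the structure constants -/

namespace HopfSupport

variable {ι : Type u} (P : HopfSupport ι)

/-- The set of counits, which is a group for the product. -/
def Counits : Type u := {x : ι // P.counit x}

/-- The product of two counits. -/
def counitMul (x y : P.Counits) : P.Counits :=
  ⟨(exists_mul_of_counit_counit x.2 y.2).choose,
    counit_of_mul x.2 (exists_mul_of_counit_counit x.2 y.2).choose_spec⟩

theorem mul_counitMul (x y : P.Counits) : P.mul x.1 y.1 (P.counitMul x y).1 :=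
  (exists_mul_of_counit_counit x.2 y.2).choose_spec

theorem exists_counitInv (x : P.Counits) : ∃ y : P.Counits, P.mul y.1 x.1 P.e := by
  obtain ⟨c, hc⟩ := P.exists_mul_tgt x.1
  rw [counit_iff_tgt.1 x.2] at hc
  exact ⟨⟨c, ((P.counit_mul c x.1).1 ⟨_, hc, P.counit_e⟩).1⟩, hc⟩

instance : Mul P.Counits := ⟨P.counitMul⟩
instance : One P.Counits := ⟨⟨P.e, P.counit_e⟩⟩
instance : Inv P.Counits := ⟨fun x => (P.exists_counitInv x).choose⟩

theorem mul_coe (x y : P.Counits) : P.mul x.1 y.1 (x * y).1 := P.mul_counitMul x y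

variable {P} in
theorem eq_coe_mul {x y : P.Counits} {k : ι} (h : P.mul x.1 y.1 k) : k = (x * y).1 :=
  mul_unique h (P.mul_coe x y)

instance : Group P.Counits :=
  Group.ofLeftAxioms
    (fun x y z => Subtype.ext <| by
      obtain ⟨k, hk, hk'⟩ := (P.assoc x.1 y.1 z.1 _).1 ⟨_, P.mul_coe x y, P.mul_coe (x * y) z⟩
      rw [eq_coe_mul hk] at hk'
      exact eq_coe_mul hk')
    (fun x => Subtype.ext (eq_of_unit_mul P.unit_e (P.mul_coe 1 x)).symm)
    (fun x => Subtype.ext (eq_coe_mul (P.exists_counitInv x).choose_spec).symm)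

theorem coe_one_counits : (1 : P.Counits).1 = P.e := rfl

/-- The set of units, which is a group for the product of the dual Hopf algebra. -/
abbrev Units : Type u := P.dual.Counits

theorem coe_one_units : (1 : P.Units).1 = P.e := dual_e

/-- The index with left unit `u` and right counit `x`, which is `{u x}` in `H(G; G₊, G₋)`. -/
def pair (u : P.Units) (x : P.Counits) : ι :=
  (exists_src_cotgt (P := P) (u := u.1) (x := x.1) u.2 x.2).choose

theorem src_pair (u : P.Units) (x : P.Counits) : P.src (P.pair u x) = u.1 :=
  (exists_src_cotgt (P := P) (u := u.1) (x := x.1) u.2 x.2).choose_spec.1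

theorem cotgt_pair (u : P.Units) (x : P.Counits) : P.cotgt (P.pair u x) = x.1 :=
  (exists_src_cotgt (P := P) (u := u.1) (x := x.1) u.2 x.2).choose_spec.2

variable {P} in
theorem eq_pair {i : ι} {u : P.Units} {x : P.Counits} (h : P.src i = u.1) (h' : P.cotgt i = x.1) :
    i = P.pair u x :=
  ext_src_cotgt (by rw [h, src_pair]) (by rw [h', cotgt_pair])

/-- The right unit of `P.pair u x`, which is `uˣ`. -/
def pow (u : P.Units) (x : P.Counits) : P.Units := ⟨P.tgt (P.pair u x), P.unit_tgt _⟩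

/-- The left counit of `P.pair u x`, which is `ᵘx`. -/
def act (u : P.Units) (x : P.Counits) : P.Counits := ⟨P.cosrc (P.pair u x), P.counit_cosrc _⟩

theorem pair_one (u : P.Units) : P.pair u 1 = u.1 :=
  (eq_pair (src_unit u.2) (unit_iff_cotgt.1 u.2)).symm

theorem one_pair (x : P.Counits) : P.pair 1 x = x.1 :=
  (eq_pair ((counit_iff_src.1 x.2).trans P.coe_one_units.symm) (cotgt_counit x.2)).symm

theorem mul_pair (u : P.Units) (x y : P.Counits) :
    P.mul (P.pair u x) (P.pair (P.pow u x) y) (P.pair u (x * y)) := by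
  obtain ⟨k, hk⟩ := exists_mul (P := P) (i := P.pair u x) (j := P.pair (P.pow u x) y)
    (by rw [src_pair]; rfl)
  have hcotgt := mul_cotgt hk
  rw [cotgt_pair, cotgt_pair] at hcotgt
  rwa [← eq_pair ((src_mul hk).trans (P.src_pair u x)) (eq_coe_mul hcotgt)]

theorem comul_pair (u v : P.Units) (x : P.Counits) :
    P.comul (P.pair u (P.act v x)) (P.pair v x) (P.pair (u * v) x) := by
  obtain ⟨k, hk⟩ := exists_mul (P := P.dual) (i := P.pair u (P.act v x)) (j := P.pair v x)
    (P.cotgt_pair _ _)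
  have hsrc := comul_src hk
  rw [src_pair, src_pair] at hsrc
  rwa [← eq_pair (eq_coe_mul (P := P.dual) hsrc) ((cotgt_comul hk).trans (P.cotgt_pair v x))]

/-- The matched pair formed by the units and the counits. -/
def matchedPair : MatchedPair P.Units P.Counits where
  pow := P.pow
  act := P.act
  pow_one u := Subtype.ext <| (congrArg P.tgt (P.pair_one u)).trans (tgt_unit u.2)
  one_pow x := Subtype.ext <| (congrArg P.tgt (P.one_pair x)).trans
    ((counit_iff_tgt.1 x.2).trans P.coe_one_units.symm)
  act_one u := Subtype.ext <| (congrArg P.cosrc (P.pair_one u)).trans (unit_iff_cosrc.1 u.2)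
  one_act x := Subtype.ext <| (congrArg P.cosrc (P.one_pair x)).trans (cosrc_counit x.2)
  pow_mul u x y := Subtype.ext <| tgt_mul (P.mul_pair u x y)
  act_mul u x y := Subtype.ext <| eq_coe_mul (x := P.act u x) (y := P.act (P.pow u x) y) <|
    mul_cosrc (P.mul_pair u x y)
  mul_act u v x := Subtype.ext <| cosrc_comul (P.comul_pair u v x)
  mul_pow u v x := Subtype.ext <|
    eq_coe_mul (P := P.dual) (x := P.pow u (P.act v x)) (y := P.pow v x) <|
      comul_tgt (P.comul_pair u v x)

theorem mul_pair_iff {u v : P.Units} {x y : P.Counits} {k : ι} :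
    P.mul (P.pair u x) (P.pair v y) k ↔ P.pow u x = v ∧ k = P.pair u (x * y) := by
  constructor
  · intro h
    obtain rfl : P.pow u x = v := Subtype.ext ((tgt_eq_src h).trans (P.src_pair v y))
    exact ⟨rfl, mul_unique h (P.mul_pair u x y)⟩
  · rintro ⟨rfl, rfl⟩
    exact P.mul_pair u x y

theorem comul_pair_iff {u v : P.Units} {x y : P.Counits} {k : ι} :
    P.comul (P.pair u x) (P.pair v y) k ↔ P.act v y = x ∧ k = P.pair (u * v) y := by
  constructor
  · intro h
    have hsrc : P.cotgt (P.pair u x) = P.cosrc (P.pair v y) := tgt_eq_src (P := P.dual) h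
    obtain rfl : P.act v y = x := Subtype.ext (hsrc.symm.trans (P.cotgt_pair u x))
    exact ⟨rfl, mul_unique (P := P.dual) h (P.comul_pair u v y)⟩
  · rintro ⟨rfl, rfl⟩
    exact P.comul_pair u v y

theorem unit_pair_iff {u : P.Units} {x : P.Counits} : P.unit (P.pair u x) ↔ x = 1 := by
  rw [unit_iff_cotgt, cotgt_pair, ← P.coe_one_counits]
  exact Subtype.ext_iff.symm

theorem counit_pair_iff {u : P.Units} {x : P.Counits} : P.counit (P.pair u x) ↔ u = 1 := by
  rw [counit_iff_src, src_pair, ← P.coe_one_units]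
  exact Subtype.ext_iff.symm

/-- The indices as pairs of a left unit and a right counit. -/
def pairEquiv : P.Units × P.Counits ≃ ι :=
  Equiv.ofBijective (fun w => P.pair w.1 w.2) (by
    constructor
    · rintro ⟨u, x⟩ ⟨v, y⟩ h
      have h' : P.pair u x = P.pair v y := h
      exact Prod.ext (Subtype.ext (by rw [← P.src_pair u x, h', P.src_pair]))
        (Subtype.ext (by rw [← P.cotgt_pair u x, h', P.cotgt_pair]))
    · intro i
      exact ⟨(⟨P.src i, P.unit_src i⟩, ⟨P.cotgt i, P.counit_cotgt i⟩), (eq_pair rfl rfl).symm⟩)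

/-- The supports of the structure constants are those of `H(G; G₊, G₋)`. -/
structure IsBicross {G : Type*} [Group G] (F : UniqueFactorization G)
    (idx : F.pos × F.neg ≃ ι) : Prop where
  mul_iff : ∀ p x q y k,
    P.mul (idx (p, x)) (idx (q, y)) k ↔ F.posPow p x = q ∧ k = idx (p, x * y)
  comul_iff : ∀ p x q y k,
    P.comul (idx (p, x)) (idx (q, y)) k ↔ F.posOnNeg q y = x ∧ k = idx (p * q, y)
  unit_iff : ∀ p x, P.unit (idx (p, x)) ↔ x = 1
  counit_iff : ∀ p x, P.counit (idx (p, x)) ↔ p = 1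

/-- The index `{p x}`, for `p` and `x` in the two factors of the group of the matched pair. -/
def factorEquiv : P.matchedPair.factorization.pos × P.matchedPair.factorization.neg ≃ ι :=
  (P.matchedPair.posEquiv.toEquiv.prodCongr P.matchedPair.negEquiv.toEquiv).symm.trans P.pairEquiv

theorem factorEquiv_apply (u : P.Units) (x : P.Counits) :
    P.factorEquiv (P.matchedPair.posEquiv u, P.matchedPair.negEquiv x) = P.pair u x :=
  congrArg P.pairEquiv (Equiv.symm_apply_apply _ (u, x))

theorem isBicross_factorEquiv : P.IsBicross P.matchedPair.factorization P.factorEquiv where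
  mul_iff := by
    simp only [P.matchedPair.posEquiv.surjective.forall, P.matchedPair.negEquiv.surjective.forall,
      P.matchedPair.posPow_eq, ← map_mul, factorEquiv_apply, EmbeddingLike.apply_eq_iff_eq]
    exact fun _ _ _ _ _ => P.mul_pair_iff
  comul_iff := by
    simp only [P.matchedPair.posEquiv.surjective.forall, P.matchedPair.negEquiv.surjective.forall,
      P.matchedPair.posOnNeg_eq, ← map_mul, factorEquiv_apply, EmbeddingLike.apply_eq_iff_eq]
    exact fun _ _ _ _ _ => P.comul_pair_iff
  unit_iff := by
    simp only [P.matchedPair.posEquiv.surjective.forall, P.matchedPair.negEquiv.surjective.forall,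
      factorEquiv_apply, map_eq_one_iff _ P.matchedPair.negEquiv.injective]
    exact fun _ _ => P.unit_pair_iff
  counit_iff := by
    simp only [P.matchedPair.posEquiv.surjective.forall, P.matchedPair.negEquiv.surjective.forall,
      factorEquiv_apply, map_eq_one_iff _ P.matchedPair.posEquiv.injective]
    exact fun _ _ => P.counit_pair_iff

theorem exists_isBicross [Finite ι] : ∃ (G : Type u) (_ : Group G) (_ : Finite G)
    (F : UniqueFactorization G) (idx : F.pos × F.neg ≃ ι), P.IsBicross F idx := by
  have : Finite P.Units := Subtype.finite
  have : Finite P.Counits := Subtype.finite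
  exact ⟨P.matchedPair.Carrier, inferInstance, inferInstance, _, _, P.isBicross_factorEquiv⟩

end HopfSupport

/-! ### Averaging real cocycles -/

section Averaging

open scoped BigOperators

variable {V : Type*} [AddCommGroup V] [Module ℚ≥0 V]

theorem eq_expect_of_cocycle_right {X K : Type*} [Group K] [Fintype K] {act : X → K → X}
    {L : X → K → K → V}
    (hL : ∀ p x y z, L p x y + L p (x * y) z = L (act p x) y z + L p x (y * z))
    (p : X) (x y : K) :
    L p x y = 𝔼 z, L p x z + 𝔼 z, L (act p x) y z - 𝔼 z, L p (x * y) z := by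
  refine eq_sub_of_add_eq ?_
  calc L p x y + 𝔼 z, L p (x * y) z
      = 𝔼 z, (L p x y + L p (x * y) z) := by
        rw [Finset.expect_add_distrib, Fintype.expect_const]
    _ = 𝔼 z, L (act p x) y z + 𝔼 z, L p x (y * z) := by
        simp only [hL, Finset.expect_add_distrib]
    _ = 𝔼 z, L p x z + 𝔼 z, L (act p x) y z := by
        rw [add_comm, Fintype.expect_equiv (Equiv.mulLeft y) (fun z => L p x (y * z)) (L p x)
          fun _ => rfl]

theorem eq_expect_of_cocycle_left {X K : Type*} [Group K] [Fintype K] {act : K → X → X}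
    {N : K → K → X → V}
    (hN : ∀ p q r x, N p q (act r x) + N (p * q) r x = N q r x + N p (q * r) x)
    (q r : K) (x : X) :
    N q r x = 𝔼 p, N p q (act r x) + 𝔼 p, N p r x - 𝔼 p, N p (q * r) x := by
  refine eq_sub_of_add_eq ?_
  calc N q r x + 𝔼 p, N p (q * r) x
      = 𝔼 p, (N q r x + N p (q * r) x) := by
        rw [Finset.expect_add_distrib, Fintype.expect_const]
    _ = 𝔼 p, N p q (act r x) + 𝔼 p, N (p * q) r x := by
        simp only [← hN, Finset.expect_add_distrib]
    _ = 𝔼 p, N p q (act r x) + 𝔼 p, N p r x := by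
        rw [Fintype.expect_equiv (Equiv.mulRight q) (fun p => N (p * q) r x)
          (fun p => N p r x) fun _ => rfl]

namespace UniqueFactorization

variable {G : Type*} [Group G] [Finite G] (F : UniqueFactorization G)

theorem exists_additive_coboundary {N : F.pos → F.pos → F.neg → V}
    (hN : ∀ p q r x, N p q (F.posOnNeg r x) + N (p * q) r x = N q r x + N p (q * r) x)
    (hN_add : ∀ p q x y, N p q (x * y) =
      N p q x + N (F.posPow p (F.posOnNeg q x)) (F.posPow q x) y) :
    ∃ c : F.pos → F.neg → V,
      (∀ p x y, c p (x * y) = c p x + c (F.posPow p x) y) ∧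
      ∀ p q x, N p q x = c p (F.posOnNeg q x) + c q x - c (p * q) x := by
  refine ⟨fun q x => 𝔼 p, N p q x, fun q x y => ?_, eq_expect_of_cocycle_left hN⟩
  simp only [hN_add, Finset.expect_add_distrib]
  congr 1
  exact Fintype.expect_equiv (F.posPowEquiv (F.posOnNeg q x)) _ _ fun _ => rfl

-- Averaging `L` trivialises it and makes `N` additive in its last argument; averaging the new `N`
-- over its first argument then trivialises it without disturbing `L`.
theorem exists_coboundary {L : F.pos → F.neg → F.neg → V} {N : F.pos → F.pos → F.neg → V}
    (hL : ∀ p x y z, L p x y + L p (x * y) z = L (F.posPow p x) y z + L p x (y * z))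
    (hN : ∀ p q r x, N p q (F.posOnNeg r x) + N (p * q) r x = N q r x + N p (q * r) x)
    (hLN : ∀ p q x y, L (p * q) x y + N p q (x * y) =
      L p (F.posOnNeg q x) (F.posOnNeg (F.posPow q x) y) + L q x y + N p q x +
        N (F.posPow p (F.posOnNeg q x)) (F.posPow q x) y) :
    ∃ c : F.pos → F.neg → V,
      (∀ p x y, L p x y = c p x + c (F.posPow p x) y - c p (x * y)) ∧
      ∀ p q x, N p q x = c (p * q) x - c p (F.posOnNeg q x) - c q x := by
  have := Fintype.ofFinite F.neg
  set c₁ : F.pos → F.neg → V := fun p x => 𝔼 y, L p x y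
  have hLc : ∀ p x y, L p x y = c₁ p x + c₁ (F.posPow p x) y - c₁ p (x * y) :=
    eq_expect_of_cocycle_right hL
  obtain ⟨c₂, hc_add, hNc⟩ := F.exists_additive_coboundary
    (N := fun p q x => N p q x + c₁ p (F.posOnNeg q x) + c₁ q x - c₁ (p * q) x)
    (fun p q r x => by
      rw [F.mul_posOnNeg, mul_assoc]
      linear_combination (norm := module) hN p q r x)
    (fun p q x y => by
      have h := hLN p q x y
      rw [hLc (p * q), hLc p, hLc q, F.mul_posPow, ← F.posOnNeg_mul] at h
      linear_combination (norm := module) h)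
  refine ⟨fun p x => c₁ p x - c₂ p x, fun p x y => ?_, fun p q x => ?_⟩
  · simp only [hLc, hc_add]
    abel
  · linear_combination (norm := module) hNc p q x

end UniqueFactorization

end Averaging

/-! ### Canonical maps of a Hopf algebra -/

section Canon

variable {R H : Type*} [CommSemiring R] [Semiring H]

section Bialgebra

variable [Bialgebra R H]

/-- The map `a ⊗ b ↦ a₁ ⊗ f(a₂) b`. It is bijective for `f = id` when `H` is a Hopf algebra, and
is then inverted by taking the antipode for `f`. -/
def leftCanon (f : H →ₗ[R] H) : H ⊗[R] H →ₗ[R] H ⊗[R] H :=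
  LinearMap.lTensor H (LinearMap.mul' R H ∘ₗ LinearMap.rTensor H f) ∘ₗ
    (TensorProduct.assoc R H H H).toLinearMap ∘ₗ LinearMap.rTensor H (Coalgebra.comul (R := R))

/-- The map `a ⊗ b ↦ a f(b₁) ⊗ b₂`, the mirror image of `leftCanon`. -/
def rightCanon (f : H →ₗ[R] H) : H ⊗[R] H →ₗ[R] H ⊗[R] H :=
  LinearMap.rTensor H (LinearMap.mul' R H ∘ₗ LinearMap.lTensor H f) ∘ₗ
    (TensorProduct.assoc R H H H).symm.toLinearMap ∘ₗ
      LinearMap.lTensor H (Coalgebra.comul (R := R))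

theorem leftCanon_tmul (f : H →ₗ[R] H) (a b : H) : leftCanon f (a ⊗ₜ[R] b) =
    LinearMap.lTensor H (LinearMap.mulRight R b ∘ₗ f) (Coalgebra.comul (R := R) a) := by
  simp only [leftCanon, LinearMap.comp_apply, LinearMap.rTensor_tmul, LinearEquiv.coe_coe]
  induction Coalgebra.comul (R := R) a with
  | zero => simp
  | tmul x y => simp
  | add x y hx hy => rw [TensorProduct.add_tmul, map_add, map_add, map_add, hx, hy]

theorem rightCanon_tmul (f : H →ₗ[R] H) (a b : H) : rightCanon f (a ⊗ₜ[R] b) =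
    LinearMap.rTensor H (LinearMap.mulLeft R a ∘ₗ f) (Coalgebra.comul (R := R) b) := by
  simp only [rightCanon, LinearMap.comp_apply, LinearMap.lTensor_tmul, LinearEquiv.coe_coe]
  induction Coalgebra.comul (R := R) b with
  | zero => simp
  | tmul x y => simp
  | add x y hx hy => rw [TensorProduct.tmul_add, map_add, map_add, map_add, hx, hy]

theorem leftCanon_lTensor_mulRight (f : H →ₗ[R] H) (b : H) (t : H ⊗[R] H) :
    leftCanon f (LinearMap.lTensor H (LinearMap.mulRight R b) t) =
      LinearMap.lTensor H (LinearMap.mulRight R b ∘ₗ LinearMap.mul' R H ∘ₗ LinearMap.rTensor H f)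
        (TensorProduct.assoc R H H H (LinearMap.rTensor H (Coalgebra.comul (R := R)) t)) := by
  induction t with
  | zero => simp
  | tmul x y =>
    rw [LinearMap.lTensor_tmul, leftCanon_tmul, LinearMap.rTensor_tmul]
    induction Coalgebra.comul (R := R) x with
    | zero => simp
    | tmul x y => simp [mul_assoc]
    | add x y hx hy => rw [TensorProduct.add_tmul, map_add, map_add, map_add, hx, hy]
  | add x y hx hy => simp only [map_add, hx, hy]

theorem rightCanon_rTensor_mulLeft (f : H →ₗ[R] H) (a : H) (t : H ⊗[R] H) :
    rightCanon f (LinearMap.rTensor H (LinearMap.mulLeft R a) t) =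
      LinearMap.rTensor H (LinearMap.mulLeft R a ∘ₗ LinearMap.mul' R H ∘ₗ LinearMap.lTensor H f)
        ((TensorProduct.assoc R H H H).symm
          (LinearMap.lTensor H (Coalgebra.comul (R := R)) t)) := by
  induction t with
  | zero => simp
  | tmul x y =>
    rw [LinearMap.rTensor_tmul, rightCanon_tmul, LinearMap.lTensor_tmul]
    induction Coalgebra.comul (R := R) y with
    | zero => simp
    | tmul x y => simp
    | add x y hx hy => rw [TensorProduct.tmul_add, map_add, map_add, map_add, hx, hy]
  | add x y hx hy => simp only [map_add, hx, hy]

end Bialgebra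

variable [HopfAlgebra R H]

theorem leftCanon_antipode_comp_leftCanon_id :
    leftCanon (HopfAlgebra.antipode R (A := H)) ∘ₗ leftCanon LinearMap.id = LinearMap.id := by
  refine TensorProduct.ext' fun a b => ?_
  have hcounit : (LinearMap.mulRight R b ∘ₗ LinearMap.mul' R H ∘ₗ
      LinearMap.rTensor H (HopfAlgebra.antipode R)) ∘ₗ Coalgebra.comul (R := R) =
      LinearMap.toSpanSingleton R H b ∘ₗ Coalgebra.counit (R := R) := by
    rw [LinearMap.comp_assoc, LinearMap.comp_assoc, HopfAlgebra.mul_antipode_rTensor_comul]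
    ext x
    simp [Algebra.smul_def]
  rw [LinearMap.comp_apply, leftCanon_tmul, LinearMap.id_apply, LinearMap.comp_id,
    leftCanon_lTensor_mulRight, Coalgebra.coassoc_apply, ← LinearMap.comp_apply,
    ← LinearMap.lTensor_comp, hcounit, LinearMap.lTensor_comp, LinearMap.comp_apply,
    Coalgebra.lTensor_counit_comul, LinearMap.lTensor_tmul, LinearMap.toSpanSingleton_apply,
    one_smul]

theorem rightCanon_antipode_comp_rightCanon_id :
    rightCanon (HopfAlgebra.antipode R (A := H)) ∘ₗ rightCanon LinearMap.id = LinearMap.id := by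
  refine TensorProduct.ext' fun a b => ?_
  have hcounit : (LinearMap.mulLeft R a ∘ₗ LinearMap.mul' R H ∘ₗ
      LinearMap.lTensor H (HopfAlgebra.antipode R)) ∘ₗ Coalgebra.comul (R := R) =
      LinearMap.toSpanSingleton R H a ∘ₗ Coalgebra.counit (R := R) := by
    rw [LinearMap.comp_assoc, LinearMap.comp_assoc, HopfAlgebra.mul_antipode_lTensor_comul]
    ext x
    simp [Algebra.algebraMap_eq_smul_one]
  rw [LinearMap.comp_apply, rightCanon_tmul, LinearMap.id_apply, LinearMap.comp_id,
    rightCanon_rTensor_mulLeft, Coalgebra.coassoc_symm_apply, ← LinearMap.comp_apply,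
    ← LinearMap.rTensor_comp, hcounit, LinearMap.rTensor_comp, LinearMap.comp_apply,
    Coalgebra.rTensor_counit_comul, LinearMap.rTensor_tmul, LinearMap.toSpanSingleton_apply,
    one_smul]

end Canon

/-! ### Structure constants -/

namespace StructureConstants

variable {R H ι : Type*} [CommSemiring R] [Semiring H]

/-- The coefficient of `b k` in `b i * b j`. -/
def mulCoeff [Algebra R H] (b : Module.Basis ι R H) (i j k : ι) : R := b.repr (b i * b j) k

variable [Bialgebra R H] (b : Module.Basis ι R H)

/-- The coefficient of `b i ⊗ b j` in the coproduct of `b k`. -/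
def comulCoeff (i j k : ι) : R := (b.tensorProduct b).repr (Coalgebra.comul (R := R) (b k)) (i, j)

variable [Fintype ι]

theorem mul_eq (i j : ι) : b i * b j = ∑ k, mulCoeff b i j k • b k := (b.sum_repr _).symm

theorem one_eq : (1 : H) = ∑ k, b.repr 1 k • b k := (b.sum_repr _).symm

theorem comul_eq (k : ι) : Coalgebra.comul (R := R) (b k) =
    ∑ i, ∑ j, comulCoeff b i j k • (b i ⊗ₜ[R] b j) := by
  conv_lhs => rw [← (b.tensorProduct b).sum_repr (Coalgebra.comul (R := R) (b k))]
  simp only [Fintype.sum_prod_type, Module.Basis.tensorProduct_apply, comulCoeff]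

theorem mulCoeff_assoc (i j k l : ι) : ∑ m, mulCoeff b i j m * mulCoeff b m k l =
    ∑ m, mulCoeff b j k m * mulCoeff b i m l := by
  have h := congrArg (fun v => b.repr v l) (mul_assoc (b i) (b j) (b k))
  rw [mul_eq b i j, mul_eq b j k, Finset.sum_mul, Finset.mul_sum] at h
  simpa [mulCoeff] using h

theorem one_mulCoeff [DecidableEq ι] (j k : ι) :
    ∑ i, b.repr 1 i * mulCoeff b i j k = if j = k then 1 else 0 := by
  have h := congrArg (fun v => b.repr v k) (one_mul (b j))
  nth_rw 1 [one_eq b] at h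
  simpa [Finset.sum_mul, mulCoeff, Finsupp.single_apply, -Module.Basis.sum_repr] using h

theorem mulCoeff_one [DecidableEq ι] (j k : ι) :
    ∑ i, b.repr 1 i * mulCoeff b j i k = if j = k then 1 else 0 := by
  have h := congrArg (fun v => b.repr v k) (mul_one (b j))
  nth_rw 1 [one_eq b] at h
  simpa [Finset.mul_sum, mulCoeff, Finsupp.single_apply, -Module.Basis.sum_repr] using h

theorem comulCoeff_coassoc (i j k l : ι) : ∑ m, comulCoeff b i j m * comulCoeff b m k l =
    ∑ m, comulCoeff b j k m * comulCoeff b i m l := by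
  classical
  have h := Coalgebra.coassoc_apply (R := R) (b l)
  simp only [comul_eq, map_sum, map_smul, LinearMap.rTensor_tmul, LinearMap.lTensor_tmul,
    TensorProduct.sum_tmul, TensorProduct.tmul_sum, TensorProduct.tmul_smul,
    ← TensorProduct.smul_tmul', TensorProduct.assoc_tmul, Finset.smul_sum, smul_smul] at h
  have hrepr := congrArg (fun v => (b.tensorProduct (b.tensorProduct b)).repr v (i, j, k)) h
  simpa [Module.Basis.tensorProduct_repr_tmul_apply, Finsupp.single_apply, mul_comm,
    Finset.sum_ite_eq, Finset.sum_ite_eq', ite_and] using hrepr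

theorem counit_comulCoeff [DecidableEq ι] (j k : ι) :
    ∑ i, Coalgebra.counit (R := R) (b i) * comulCoeff b i j k = if j = k then 1 else 0 := by
  have h := congrArg (TensorProduct.lid R H) (Coalgebra.rTensor_counit_comul (R := R) (b k))
  rw [comul_eq b] at h
  have hrepr := congrArg (fun v => b.repr v j) h
  simpa [Finsupp.single_apply, mul_comm, eq_comm] using hrepr

theorem comulCoeff_counit [DecidableEq ι] (j k : ι) :
    ∑ i, Coalgebra.counit (R := R) (b i) * comulCoeff b j i k = if j = k then 1 else 0 := by
  have h := congrArg (TensorProduct.rid R H) (Coalgebra.lTensor_counit_comul (R := R) (b k))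
  rw [comul_eq b] at h
  have hrepr := congrArg (fun v => b.repr v j) h
  simpa [Finsupp.single_apply, mul_comm, eq_comm] using hrepr

theorem counit_mulCoeff (i j : ι) :
    ∑ m, mulCoeff b i j m * Coalgebra.counit (R := R) (b m) =
      Coalgebra.counit (R := R) (b i) * Coalgebra.counit (R := R) (b j) := by
  have h := Bialgebra.counit_mul (R := R) (b i) (b j)
  rw [mul_eq b] at h
  simpa using h

theorem comulCoeff_one (i j : ι) :
    ∑ m, comulCoeff b i j m * b.repr 1 m = b.repr 1 i * b.repr 1 j := by
  have h := congrArg (fun v => (b.tensorProduct b).repr v (i, j))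
    (Bialgebra.comul_one (R := R) (A := H))
  nth_rw 1 [one_eq b] at h
  rw [Algebra.TensorProduct.one_def] at h
  simpa [comulCoeff, mul_comm, Module.Basis.tensorProduct_repr_tmul_apply,
    -Module.Basis.sum_repr] using h

theorem counit_one : ∑ i, b.repr 1 i * Coalgebra.counit (R := R) (b i) = 1 := by
  have h := Bialgebra.counit_one (R := R) (A := H)
  rw [one_eq b] at h
  simpa [-Module.Basis.sum_repr] using h

theorem mulCoeff_comulCoeff (i j k l : ι) :
    ∑ m, mulCoeff b i j m * comulCoeff b k l m =
      ∑ w : ι × ι × ι × ι, comulCoeff b w.1 w.2.1 i * comulCoeff b w.2.2.1 w.2.2.2 j *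
        (mulCoeff b w.1 w.2.2.1 k * mulCoeff b w.2.1 w.2.2.2 l) := by
  have h := congrArg (fun v => (b.tensorProduct b).repr v (k, l))
    (Bialgebra.comul_mul (R := R) (b i) (b j))
  have hleft : (b.tensorProduct b).repr (Coalgebra.comul (R := R) (b i * b j)) (k, l) =
      ∑ m, mulCoeff b i j m * comulCoeff b k l m := by
    rw [mul_eq b i j]
    simp [comulCoeff]
  rw [← hleft]
  refine h.trans ?_
  rw [comul_eq b i, comul_eq b j]
  simp only [Finset.sum_mul]
  simp only [Finset.mul_sum, smul_mul_smul_comm, Algebra.TensorProduct.tmul_mul_tmul, map_sum,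
    map_smul, Finsupp.coe_finsetSum, Finset.sum_apply, Finsupp.smul_apply, smul_eq_mul,
    Module.Basis.tensorProduct_repr_tmul_apply, mulCoeff, Fintype.sum_prod_type]
  exact Finset.sum_congr rfl fun _ _ => Finset.sum_congr rfl fun _ _ =>
    Finset.sum_congr rfl fun _ _ => Finset.sum_congr rfl fun _ _ => by rw [mul_comm (b.repr _ l)]

theorem repr_leftCanon (i j k l : ι) :
    (b.tensorProduct b).repr (leftCanon LinearMap.id (b.tensorProduct b (i, j))) (k, l) =
      ∑ m, comulCoeff b k m i * mulCoeff b m j l := by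
  classical
  rw [Module.Basis.tensorProduct_apply', leftCanon_tmul, comul_eq b, Finset.sum_comm]
  simp only [map_sum, map_smul, LinearMap.lTensor_tmul, Finsupp.coe_finsetSum, Finset.sum_apply,
    Finsupp.smul_apply, Module.Basis.tensorProduct_repr_tmul_apply, smul_eq_mul,
    Module.Basis.repr_self, Finsupp.single_apply, LinearMap.comp_apply, LinearMap.id_apply,
    LinearMap.mulRight_apply, mul_ite, mul_one, mul_zero, Finset.sum_ite_eq', Finset.mem_univ,
    if_true, mulCoeff]

theorem repr_rightCanon (i j k l : ι) :
    (b.tensorProduct b).repr (rightCanon LinearMap.id (b.tensorProduct b (i, j))) (k, l) =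
      ∑ m, comulCoeff b m l j * mulCoeff b i m k := by
  classical
  rw [Module.Basis.tensorProduct_apply', rightCanon_tmul, comul_eq b]
  simp only [map_sum, map_smul, LinearMap.rTensor_tmul, Finsupp.coe_finsetSum, Finset.sum_apply,
    Finsupp.smul_apply, Module.Basis.tensorProduct_repr_tmul_apply, smul_eq_mul,
    Module.Basis.repr_self, Finsupp.single_apply, LinearMap.comp_apply, LinearMap.id_apply,
    LinearMap.mulLeft_apply, ite_mul, one_mul, zero_mul, mul_ite, mul_zero, Finset.sum_ite_eq',
    Finset.mem_univ, if_true, mulCoeff]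

end StructureConstants

/-! ### Hopf algebras with a positive basis -/

section PositiveSums

variable {α R : Type*} [Fintype α] [Semiring R] [PartialOrder R] [IsOrderedRing R] {f g : α → R}

theorem sum_ne_zero_iff_exists (hf : ∀ a, 0 ≤ f a) : ∑ a, f a ≠ 0 ↔ ∃ a, f a ≠ 0 := by
  rw [Ne, Finset.sum_eq_zero_iff_of_nonneg fun a _ => hf a]
  simp

theorem exists_ne_zero_and_iff [NoZeroDivisors R] (hf : ∀ a, 0 ≤ f a) (hg : ∀ a, 0 ≤ g a) :
    (∃ a, f a ≠ 0 ∧ g a ≠ 0) ↔ ∑ a, f a * g a ≠ 0 := by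
  simp only [sum_ne_zero_iff_exists fun a => mul_nonneg (hf a) (hg a), mul_ne_zero_iff]

end PositiveSums

namespace IsPositiveBasis

open StructureConstants

variable {H ι : Type*} [Ring H] [HopfAlgebra ℂ H] {b : Module.Basis ι ℂ H}
  (hb : IsPositiveBasis b)

include hb

theorem mulCoeff_nonneg (i j k : ι) : 0 ≤ mulCoeff b i j k := hb.mul_nonneg i j k

theorem comulCoeff_nonneg (i j k : ι) : 0 ≤ comulCoeff b i j k := hb.comul_nonneg k i j

section Finite

variable [Finite ι]

theorem isNonneg_leftCanon {f : H →ₗ[ℂ] H} (hf : ∀ i, IsNonneg b (f (b i))) (w : ι × ι) :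
    IsNonneg (b.tensorProduct b) (leftCanon f (b.tensorProduct b w)) := by
  rw [Module.Basis.tensorProduct_apply', leftCanon_tmul]
  refine IsNonneg.map (b := b.tensorProduct b) (fun i => ?_) fun ij => hb.comul_nonneg w.1 ij.1 ij.2
  rw [Module.Basis.tensorProduct_apply', LinearMap.lTensor_tmul]
  exact (IsNonneg.self _).tmul (IsNonneg.mul hb.mul_nonneg (hf _) (IsNonneg.self _))

theorem isNonneg_rightCanon {f : H →ₗ[ℂ] H} (hf : ∀ i, IsNonneg b (f (b i))) (w : ι × ι) :
    IsNonneg (b.tensorProduct b) (rightCanon f (b.tensorProduct b w)) := by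
  rw [Module.Basis.tensorProduct_apply', rightCanon_tmul]
  refine IsNonneg.map (b := b.tensorProduct b) (fun i => ?_) fun ij => hb.comul_nonneg w.2 ij.1 ij.2
  rw [Module.Basis.tensorProduct_apply', LinearMap.rTensor_tmul]
  exact (IsNonneg.mul hb.mul_nonneg (IsNonneg.self _) (hf _)).tmul (IsNonneg.self _)

end Finite

variable [Fintype ι]

theorem exists_perm_leftCanon : ∃ σ : Equiv.Perm (ι × ι), ∀ i j k l,
    ∑ m, comulCoeff b k m i * mulCoeff b m j l ≠ 0 ↔ (k, l) = σ (i, j) := by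
  have := Module.Finite.of_basis b
  obtain ⟨σ, hσ⟩ := exists_perm_of_nonneg_linearMap_inverse (b.tensorProduct b)
    (hb.isNonneg_leftCanon fun i => IsNonneg.self i) (hb.isNonneg_leftCanon hb.antipode_nonneg)
    ((LinearMap.comp_eq_id_comm ℂ _).1 leftCanon_antipode_comp_leftCanon_id)
  exact ⟨σ, fun i j k l => by rw [← repr_leftCanon, hσ]⟩

theorem exists_perm_rightCanon : ∃ σ : Equiv.Perm (ι × ι), ∀ i j k l,
    ∑ m, comulCoeff b m l j * mulCoeff b i m k ≠ 0 ↔ (k, l) = σ (i, j) := by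
  have := Module.Finite.of_basis b
  obtain ⟨σ, hσ⟩ := exists_perm_of_nonneg_linearMap_inverse (b.tensorProduct b)
    (hb.isNonneg_rightCanon fun i => IsNonneg.self i) (hb.isNonneg_rightCanon hb.antipode_nonneg)
    ((LinearMap.comp_eq_id_comm ℂ _).1 rightCanon_antipode_comp_rightCanon_id)
  exact ⟨σ, fun i j k l => by rw [← repr_rightCanon, hσ]⟩

theorem sum_mulCoeff_mul_comulCoeff_ne_zero_iff (i j k l : ι) :
    ∑ m, mulCoeff b i j m * comulCoeff b k l m ≠ 0 ↔ ∃ w x y z, comulCoeff b w x i ≠ 0 ∧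
      comulCoeff b y z j ≠ 0 ∧ mulCoeff b w y k ≠ 0 ∧ mulCoeff b x z l ≠ 0 := by
  have hc := hb.comulCoeff_nonneg
  have hm := hb.mulCoeff_nonneg
  rw [mulCoeff_comulCoeff, sum_ne_zero_iff_exists fun w : ι × ι × ι × ι => _root_.mul_nonneg
    (_root_.mul_nonneg (hc _ _ _) (hc _ _ _)) (_root_.mul_nonneg (hm _ _ _) (hm _ _ _))]
  simp only [Prod.exists, mul_ne_zero_iff, and_assoc]

/-- The supports of the structure constants of a Hopf algebra with a positive basis. -/
def support : HopfSupport ι where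
  mul i j k := mulCoeff b i j k ≠ 0
  comul i j k := comulCoeff b i j k ≠ 0
  unit i := b.repr 1 i ≠ 0
  counit i := Coalgebra.counit (R := ℂ) (b i) ≠ 0
  assoc i j k l := by
    rw [exists_ne_zero_and_iff, exists_ne_zero_and_iff, mulCoeff_assoc]
    all_goals exact fun _ => hb.mulCoeff_nonneg _ _ _
  coassoc i j k l := by
    rw [exists_ne_zero_and_iff, exists_ne_zero_and_iff, comulCoeff_coassoc]
    all_goals exact fun _ => hb.comulCoeff_nonneg _ _ _
  unit_mul j k := by
    classical
    rw [exists_ne_zero_and_iff hb.one_nonneg fun _ => hb.mulCoeff_nonneg _ _ _, one_mulCoeff]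
    simp
  mul_unit j k := by
    classical
    rw [exists_ne_zero_and_iff hb.one_nonneg fun _ => hb.mulCoeff_nonneg _ _ _, mulCoeff_one]
    simp
  counit_comul j k := by
    classical
    rw [exists_ne_zero_and_iff hb.counit_nonneg fun _ => hb.comulCoeff_nonneg _ _ _,
      counit_comulCoeff]
    simp
  comul_counit j k := by
    classical
    rw [exists_ne_zero_and_iff hb.counit_nonneg fun _ => hb.comulCoeff_nonneg _ _ _,
      comulCoeff_counit]
    simp
  mul_comul i j k l := by
    rw [exists_ne_zero_and_iff (hb.mulCoeff_nonneg _ _) (hb.comulCoeff_nonneg _ _),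
      hb.sum_mulCoeff_mul_comulCoeff_ne_zero_iff]
  counit_mul i j := by
    rw [exists_ne_zero_and_iff (hb.mulCoeff_nonneg _ _) hb.counit_nonneg, counit_mulCoeff,
      mul_ne_zero_iff]
  unit_comul i j := by
    rw [exists_ne_zero_and_iff (hb.comulCoeff_nonneg _ _) hb.one_nonneg, comulCoeff_one,
      mul_ne_zero_iff]
  counit_unit := by
    rw [exists_ne_zero_and_iff hb.one_nonneg hb.counit_nonneg, counit_one]
    exact one_ne_zero
  left_perm := by
    obtain ⟨σ, hσ⟩ := hb.exists_perm_leftCanon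
    exact ⟨σ, fun i j k l => by rw [← hσ, exists_ne_zero_and_iff (fun _ =>
      hb.comulCoeff_nonneg _ _ _) fun _ => hb.mulCoeff_nonneg _ _ _]⟩
  right_perm := by
    obtain ⟨σ, hσ⟩ := hb.exists_perm_rightCanon
    exact ⟨σ, fun i j k l => by rw [← hσ, exists_ne_zero_and_iff (fun _ =>
      hb.comulCoeff_nonneg _ _ _) fun _ => hb.mulCoeff_nonneg _ _ _]⟩

end IsPositiveBasis

section Factors

open StructureConstants

variable {H ι : Type*} [Ring H] [HopfAlgebra ℂ H] {b : Module.Basis ι ℂ H} {G : Type*} [Group G]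
  {F : UniqueFactorization G} {idx : F.pos × F.neg ≃ ι}

/-- The positive factor in the product of `b (idx (p, x))` and `b (idx (pˣ, y))`. -/
def mulFactor (b : Module.Basis ι ℂ H) (idx : F.pos × F.neg ≃ ι) (p : F.pos) (x y : F.neg) : ℝ :=
  (mulCoeff b (idx (p, x)) (idx (F.posPow p x, y)) (idx (p, x * y))).re

/-- The positive factor of `b (idx (p, ᵠx)) ⊗ b (idx (q, x))` in the coproduct of
`b (idx (p * q, x))`. -/
def comulFactor (b : Module.Basis ι ℂ H) (idx : F.pos × F.neg ≃ ι) (p q : F.pos) (x : F.neg) : ℝ :=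
  (comulCoeff b (idx (p, F.posOnNeg q x)) (idx (q, x)) (idx (p * q, x))).re

namespace HopfSupport.IsBicross

variable [Fintype ι] {hb : IsPositiveBasis b} (h : hb.support.IsBicross F idx)

include h

theorem mulCoeff_pos (p : F.pos) (x y : F.neg) :
    0 < mulCoeff b (idx (p, x)) (idx (F.posPow p x, y)) (idx (p, x * y)) :=
  (hb.mulCoeff_nonneg _ _ _).lt_of_ne' ((h.mul_iff _ _ _ _ _).2 ⟨rfl, rfl⟩)

theorem comulCoeff_pos (p q : F.pos) (x : F.neg) :
    0 < comulCoeff b (idx (p, F.posOnNeg q x)) (idx (q, x)) (idx (p * q, x)) :=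
  (hb.comulCoeff_nonneg _ _ _).lt_of_ne' ((h.comul_iff _ _ _ _ _).2 ⟨rfl, rfl⟩)

theorem mulFactor_pos (p : F.pos) (x y : F.neg) : 0 < mulFactor b idx p x y :=
  (Complex.pos_iff.1 (h.mulCoeff_pos p x y)).1

theorem comulFactor_pos (p q : F.pos) (x : F.neg) : 0 < comulFactor b idx p q x :=
  (Complex.pos_iff.1 (h.comulCoeff_pos p q x)).1

theorem mulCoeff_eq (p : F.pos) (x y : F.neg) :
    mulCoeff b (idx (p, x)) (idx (F.posPow p x, y)) (idx (p, x * y)) = mulFactor b idx p x y :=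
  Complex.ext rfl (Complex.pos_iff.1 (h.mulCoeff_pos p x y)).2.symm

theorem comulCoeff_eq (p q : F.pos) (x : F.neg) :
    comulCoeff b (idx (p, F.posOnNeg q x)) (idx (q, x)) (idx (p * q, x)) =
      comulFactor b idx p q x :=
  Complex.ext rfl (Complex.pos_iff.1 (h.comulCoeff_pos p q x)).2.symm

theorem mulCoeff_eq_zero {p q : F.pos} {x y : F.neg} {k : ι}
    (hk : ¬ (F.posPow p x = q ∧ k = idx (p, x * y))) :
    mulCoeff b (idx (p, x)) (idx (q, y)) k = 0 :=
  not_not.1 (mt (h.mul_iff _ _ _ _ _).1 hk)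

theorem comulCoeff_eq_zero {p q : F.pos} {x y : F.neg} {k : ι}
    (hk : ¬ (F.posOnNeg q y = x ∧ k = idx (p * q, y))) :
    comulCoeff b (idx (p, x)) (idx (q, y)) k = 0 :=
  not_not.1 (mt (h.comul_iff _ _ _ _ _).1 hk)

theorem sum_mulCoeff_smul {V : Type*} [AddCommMonoid V] [Module ℂ V] (p : F.pos) (x y : F.neg)
    (f : ι → V) : ∑ k, mulCoeff b (idx (p, x)) (idx (F.posPow p x, y)) k • f k =
      (mulFactor b idx p x y : ℂ) • f (idx (p, x * y)) := by
  rw [Fintype.sum_eq_single (idx (p, x * y)) fun k hk => by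
    rw [h.mulCoeff_eq_zero fun h' => hk h'.2, zero_smul], h.mulCoeff_eq]

theorem sum_comulCoeff_smul {V : Type*} [AddCommMonoid V] [Module ℂ V] (p q : F.pos) (x : F.neg)
    (f : ι → V) : ∑ k, comulCoeff b (idx (p, F.posOnNeg q x)) (idx (q, x)) k • f k =
      (comulFactor b idx p q x : ℂ) • f (idx (p * q, x)) := by
  rw [Fintype.sum_eq_single (idx (p * q, x)) fun k hk => by
    rw [h.comulCoeff_eq_zero fun h' => hk h'.2, zero_smul], h.comulCoeff_eq]

theorem mulFactor_assoc (p : F.pos) (x y z : F.neg) :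
    mulFactor b idx p x y * mulFactor b idx p (x * y) z =
      mulFactor b idx (F.posPow p x) y z * mulFactor b idx p x (y * z) := by
  have hassoc := mulCoeff_assoc b (idx (p, x)) (idx (F.posPow p x, y))
    (idx (F.posPow p (x * y), z)) (idx (p, x * y * z))
  simp only [← smul_eq_mul (α := ℂ)] at hassoc
  rw [h.sum_mulCoeff_smul, h.mulCoeff_eq, F.posPow_mul, h.sum_mulCoeff_smul, mul_assoc,
    h.mulCoeff_eq] at hassoc
  simp only [smul_eq_mul] at hassoc
  exact_mod_cast hassoc

theorem comulFactor_coassoc (p q r : F.pos) (x : F.neg) :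
    comulFactor b idx p q (F.posOnNeg r x) * comulFactor b idx (p * q) r x =
      comulFactor b idx q r x * comulFactor b idx p (q * r) x := by
  have hcoassoc := comulCoeff_coassoc b (idx (p, F.posOnNeg (q * r) x))
    (idx (q, F.posOnNeg r x)) (idx (r, x)) (idx (p * q * r, x))
  simp only [← smul_eq_mul (α := ℂ)] at hcoassoc
  rw [h.sum_comulCoeff_smul, mul_assoc, h.comulCoeff_eq, F.mul_posOnNeg, h.sum_comulCoeff_smul,
    ← mul_assoc, h.comulCoeff_eq] at hcoassoc
  simp only [smul_eq_mul] at hcoassoc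
  exact_mod_cast hcoassoc

theorem eq_of_comul_of_mul {p q : F.pos} {x y : F.neg} {i i' j j' : ι}
    (hi : hb.support.comul i i' (idx (p * q, x)))
    (hj : hb.support.comul j j' (idx (F.posPow (p * q) x, y)))
    (hij : hb.support.mul i j (idx (p, F.posOnNeg q (x * y))))
    (hij' : hb.support.mul i' j' (idx (q, x * y))) :
    i = idx (p, F.posOnNeg q x) ∧ i' = idx (q, x) ∧
      j = idx (F.posPow p (F.posOnNeg q x), F.posOnNeg (F.posPow q x) y) ∧
      j' = idx (F.posPow q x, y) := by
  obtain ⟨⟨r, _⟩, rfl⟩ := idx.surjective i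
  obtain ⟨⟨s, z⟩, rfl⟩ := idx.surjective i'
  obtain ⟨⟨_, _⟩, rfl⟩ := idx.surjective j
  obtain ⟨⟨_, w⟩, rfl⟩ := idx.surjective j'
  obtain ⟨rfl, hpq⟩ := (h.comul_iff _ _ _ _ _).1 hi
  obtain ⟨rfl, -⟩ := (h.comul_iff _ _ _ _ _).1 hj
  obtain ⟨rfl, -⟩ := (h.mul_iff _ _ _ _ _).1 hij
  obtain ⟨rfl, hqx⟩ := (h.mul_iff _ _ _ _ _).1 hij'
  simp only [EmbeddingLike.apply_eq_iff_eq, Prod.mk.injEq] at hpq hqx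
  obtain ⟨rfl, hyw⟩ := hqx
  obtain ⟨hpr, rfl⟩ := hpq
  obtain rfl := _root_.mul_left_cancel hyw
  obtain rfl := _root_.mul_right_cancel hpr
  exact ⟨rfl, rfl, rfl, rfl⟩

theorem mulFactor_comulFactor (p q : F.pos) (x y : F.neg) :
    mulFactor b idx (p * q) x y * comulFactor b idx p q (x * y) =
      mulFactor b idx p (F.posOnNeg q x) (F.posOnNeg (F.posPow q x) y) *
        mulFactor b idx q x y * comulFactor b idx p q x *
        comulFactor b idx (F.posPow p (F.posOnNeg q x)) (F.posPow q x) y := by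
  have hcompat := mulCoeff_comulCoeff b (idx (p * q, x)) (idx (F.posPow (p * q) x, y))
    (idx (p, F.posOnNeg q (x * y))) (idx (q, x * y))
  rw [Fintype.sum_eq_single (idx (p, F.posOnNeg q x), idx (q, x),
    idx (F.posPow p (F.posOnNeg q x), F.posOnNeg (F.posPow q x) y),
    idx (F.posPow q x, y))] at hcompat
  · simp only [← smul_eq_mul (α := ℂ)] at hcompat
    rw [h.sum_mulCoeff_smul, h.comulCoeff_eq, h.comulCoeff_eq, F.mul_posPow, h.comulCoeff_eq,
      F.posOnNeg_mul, h.mulCoeff_eq, h.mulCoeff_eq] at hcompat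
    simp only [smul_eq_mul] at hcompat
    norm_cast at hcompat
    rw [hcompat]
    ring
  · rintro ⟨i, i', j, j'⟩ hne
    contrapose! hne
    simp only [mul_ne_zero_iff] at hne
    obtain ⟨⟨hi, hj⟩, hij, hij'⟩ := hne
    obtain ⟨rfl, rfl, rfl, rfl⟩ := h.eq_of_comul_of_mul hi hj hij hij'
    rfl

theorem exists_scaling [Finite G] : ∃ s : F.pos → F.neg → ℝ, (∀ p x, 0 < s p x) ∧
    (∀ p x y, mulFactor b idx p x y * s p (x * y) = s p x * s (F.posPow p x) y) ∧
    ∀ p q x, comulFactor b idx p q x * (s p (F.posOnNeg q x) * s q x) = s (p * q) x := by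
  have hm p x y := (h.mulFactor_pos p x y).ne'
  have hc p q x := (h.comulFactor_pos p q x).ne'
  obtain ⟨c, hmc, hcc⟩ := F.exists_coboundary (L := fun p x y => Real.log (mulFactor b idx p x y))
    (N := fun p q x => Real.log (comulFactor b idx p q x))
    (fun p x y z => by
      rw [← Real.log_mul (hm _ _ _) (hm _ _ _), ← Real.log_mul (hm _ _ _) (hm _ _ _),
        h.mulFactor_assoc])
    (fun p q r x => by
      rw [← Real.log_mul (hc _ _ _) (hc _ _ _), ← Real.log_mul (hc _ _ _) (hc _ _ _),
        h.comulFactor_coassoc])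
    (fun p q x y => by
      rw [← Real.log_mul (hm _ _ _) (hc _ _ _), ← Real.log_mul (hm _ _ _) (hm _ _ _),
        ← Real.log_mul (mul_ne_zero (hm _ _ _) (hm _ _ _)) (hc _ _ _),
        ← Real.log_mul (mul_ne_zero (mul_ne_zero (hm _ _ _) (hm _ _ _)) (hc _ _ _)) (hc _ _ _),
        h.mulFactor_comulFactor])
  refine ⟨fun p x => Real.exp (c p x), fun p x => Real.exp_pos _, fun p x y => ?_,
    fun p q x => ?_⟩
  · rw [← Real.exp_log (h.mulFactor_pos p x y), hmc, ← Real.exp_add, ← Real.exp_add,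
      sub_add_cancel]
  · rw [← Real.exp_log (h.comulFactor_pos p q x), hcc, ← Real.exp_add, ← Real.exp_add]
    congr 1
    ring

theorem basis_mul_basis (p q : F.pos) (x y : F.neg) : b (idx (p, x)) * b (idx (q, y)) =
    if F.posPow p x = q then (mulFactor b idx p x y : ℂ) • b (idx (p, x * y)) else 0 := by
  rw [mul_eq b]
  split_ifs with hq
  · subst hq
    exact h.sum_mulCoeff_smul p x y b
  · exact Finset.sum_eq_zero fun k _ => by rw [h.mulCoeff_eq_zero fun h' => hq h'.1, zero_smul]

theorem comul_basis [Finite G] (p : F.pos) (x : F.neg) :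
    Coalgebra.comul (R := ℂ) (b (idx (p, x))) =
      ∑ q : F.pos, (comulFactor b idx (p * q⁻¹) q x : ℂ) •
        (b (idx (p * q⁻¹, F.posOnNeg q x)) ⊗ₜ[ℂ] b (idx (q, x))) := by
  have := Fintype.ofFinite F.neg
  have hterm (q : F.pos) (y : F.neg) (i : ι)
      (hne : ¬ (i = idx (p * q⁻¹, F.posOnNeg q x) ∧ y = x)) :
      comulCoeff b i (idx (q, y)) (idx (p, x)) = 0 := by
    obtain ⟨⟨p', x'⟩, rfl⟩ := idx.surjective i
    refine h.comulCoeff_eq_zero ?_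
    rintro ⟨rfl, heq⟩
    simp only [EmbeddingLike.apply_eq_iff_eq, Prod.mk.injEq] at heq
    obtain ⟨rfl, rfl⟩ := heq
    exact hne ⟨by rw [mul_inv_cancel_right], rfl⟩
  rw [comul_eq b, Finset.sum_comm, ← idx.sum_comp, Fintype.sum_prod_type]
  refine Finset.sum_congr rfl fun q _ => ?_
  rw [Fintype.sum_eq_single x fun y hy => Finset.sum_eq_zero fun i _ => by
      rw [hterm q y i fun h' => hy h'.2, zero_smul],
    Fintype.sum_eq_single (idx (p * q⁻¹, F.posOnNeg q x)) fun i hi => by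
      rw [hterm q x i fun h' => hi h'.1, zero_smul], ← h.comulCoeff_eq, inv_mul_cancel_right]

end HopfSupport.IsBicross

end Factors

section BialgEquivOfBasis

variable {R A B ι : Type*} [CommSemiring R]

theorem counit_comp_eq_of_map_comp_comul [AddCommMonoid A] [Module R A] [Coalgebra R A]
    [AddCommMonoid B] [Module R B] [Coalgebra R B] (l : A ≃ₗ[R] B)
    (hl : TensorProduct.map l.toLinearMap l.toLinearMap ∘ₗ Coalgebra.comul (R := R) =
      Coalgebra.comul (R := R) ∘ₗ l.toLinearMap) :
    Coalgebra.counit (R := R) ∘ₗ l.toLinearMap = Coalgebra.counit (R := R) := by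
  ext a
  have hcounit : LinearMap.rTensor A (Coalgebra.counit (R := R) ∘ₗ l.toLinearMap)
      (Coalgebra.comul (R := R) a) = 1 ⊗ₜ a := by
    refine (LinearEquiv.lTensor R l).injective ?_
    change LinearMap.lTensor R l.toLinearMap _ = LinearMap.lTensor R l.toLinearMap _
    calc LinearMap.lTensor R l.toLinearMap (LinearMap.rTensor A _ (Coalgebra.comul (R := R) a))
        = LinearMap.rTensor B (Coalgebra.counit (R := R))
            (TensorProduct.map l.toLinearMap l.toLinearMap (Coalgebra.comul (R := R) a)) := by
          rw [← LinearMap.comp_apply, LinearMap.lTensor_comp_rTensor,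
            ← LinearMap.comp_apply (LinearMap.rTensor B _), LinearMap.rTensor_comp_map]
      _ = LinearMap.lTensor R l.toLinearMap (1 ⊗ₜ a) := by
          rw [← LinearMap.comp_apply (TensorProduct.map _ _), hl, LinearMap.comp_apply,
            LinearEquiv.coe_coe, Coalgebra.rTensor_counit_comul,
            LinearMap.lTensor_tmul, LinearEquiv.coe_coe]
  have hcomm := LinearMap.congr_fun ((LinearMap.lTensor_comp_rTensor _ _ _).trans
    (LinearMap.rTensor_comp_lTensor _ (Coalgebra.counit (R := R) ∘ₗ l.toLinearMap)
      (Coalgebra.counit (R := R) (A := A))).symm) (Coalgebra.comul (R := R) a)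
  rw [LinearMap.comp_apply, LinearMap.comp_apply, hcounit, Coalgebra.lTensor_counit_comul,
    LinearMap.lTensor_tmul, LinearMap.rTensor_tmul] at hcomm
  simpa using (congrArg (TensorProduct.lid R R) hcomm).symm

/-- A linear equivalence that is compatible with products and coproducts of basis vectors is an
isomorphism of bialgebras: units and counits are unique, hence preserved. -/
def bialgEquivOfBasis [Semiring A] [Bialgebra R A] [Semiring B] [Bialgebra R B]
    (b : Module.Basis ι R A) (l : A ≃ₗ[R] B) (hmul : ∀ i j, l (b i * b j) = l (b i) * l (b j))
    (hcomul : ∀ i, TensorProduct.map l.toLinearMap l.toLinearMap (Coalgebra.comul (R := R) (b i)) =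
      Coalgebra.comul (R := R) (l (b i))) : A ≃ₐc[R] B :=
  have hl_mul (v w : A) : l (v * w) = l v * l w := by
    have hbilin : (LinearMap.mul R A).compr₂ l.toLinearMap =
        (LinearMap.mul R B).compl₁₂ l.toLinearMap l.toLinearMap := LinearMap.ext_basis b b hmul
    exact LinearMap.congr_fun₂ hbilin v w
  have hl_one : l 1 = 1 := by
    obtain ⟨v, hv⟩ := l.surjective 1
    rw [← mul_one (l 1), ← hv, ← hl_mul, one_mul]
  have hl_comul : TensorProduct.map l.toLinearMap l.toLinearMap ∘ₗ Coalgebra.comul (R := R) =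
      Coalgebra.comul (R := R) ∘ₗ l.toLinearMap := b.ext hcomul
  BialgEquiv.ofAlgEquiv (AlgEquiv.ofLinearEquiv l hl_one hl_mul)
    (AlgHom.toLinearMap_injective (counit_comp_eq_of_map_comp_comul l hl_comul))
    (AlgHom.toLinearMap_injective hl_comul)

end BialgEquivOfBasis

section Classification

variable {H : Type*} {ι : Type u} [Ring H] [HopfAlgebra ℂ H] {b : Module.Basis ι ℂ H}

theorem HopfSupport.IsBicross.exists_bialgEquiv [Fintype ι] {hb : IsPositiveBasis b} {G : Type*}
    [Group G] [Finite G] {F : UniqueFactorization G} {idx : F.pos × F.neg ≃ ι}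
    (h : hb.support.IsBicross F idx) : ∃ (e : H ≃ₐc[ℂ] Bicross F) (s : F.pos → F.neg → ℝ),
      ∀ p x, 0 < s p x ∧ e (b (idx (p, x))) = (s p x : ℂ) • Bicross.el F p x := by
  obtain ⟨s, hs, hm, hc⟩ := h.exists_scaling
  have hs₀ p x : (s p x : ℂ) ≠ 0 := by exact_mod_cast (hs p x).ne'
  let l : H ≃ₗ[ℂ] Bicross F := b.equiv
    ((Bicross.elBasis F).unitsSMul fun w => Units.mk0 (s w.1 w.2 : ℂ) (hs₀ _ _)) idx.symm
  have hl (p : F.pos) (x : F.neg) : l (b (idx (p, x))) = (s p x : ℂ) • Bicross.el F p x := by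
    simp only [l, Module.Basis.equiv_apply, Equiv.symm_apply_apply,
      Module.Basis.unitsSMul_apply, Bicross.elBasis_apply]
    rfl
  refine ⟨bialgEquivOfBasis (b.reindex idx.symm) l (fun ⟨p, x⟩ ⟨q, y⟩ => ?_) fun ⟨p, x⟩ => ?_, s,
    fun p x => ⟨hs p x, hl p x⟩⟩
  · simp only [Module.Basis.reindex_apply, Equiv.symm_symm, h.basis_mul_basis, hl,
      smul_mul_smul_comm, Bicross.el_mul_el]
    split_ifs with hq
    · subst hq
      rw [map_smul, hl, smul_smul]
      exact_mod_cast congrArg (fun r : ℝ => (r : ℂ) • Bicross.el F p (x * y)) (hm p x y)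
    · rw [map_zero, smul_zero]
  · simp only [Module.Basis.reindex_apply, Equiv.symm_symm, h.comul_basis, hl, map_sum, map_smul,
      TensorProduct.map_tmul, LinearEquiv.coe_coe, Bicross.comul_el, Finset.smul_sum,
      TensorProduct.smul_tmul_smul, smul_smul]
    refine Finset.sum_congr rfl fun q _ => congrArg (· • _) ?_
    have hcq := hc (p * q⁻¹) q x
    rw [inv_mul_cancel_right] at hcq
    exact_mod_cast hcq

theorem IsPositiveBasis.exists_bialgEquiv [Finite ι] (hb : IsPositiveBasis b) :
    ∃ (G : Type u) (_ : Group G) (_ : Finite G) (F : UniqueFactorization G)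
      (e : H ≃ₐc[ℂ] Bicross F) (σ : ι ≃ G) (c : ι → ℝ),
      ∀ i, 0 < c i ∧ e (b i) = (c i : ℂ) • Bicross.basis F (σ i) := by
  have := Fintype.ofFinite ι
  obtain ⟨G, _, _, F, idx, h⟩ := hb.support.exists_isBicross
  obtain ⟨e, s, he⟩ := h.exists_bialgEquiv
  refine ⟨G, inferInstance, inferInstance, F, e,
    idx.symm.trans (Subgroup.IsComplement.equiv F.isComplement).symm,
    fun i => s (idx.symm i).1 (idx.symm i).2, fun i => ⟨(he _ _).1, ?_⟩⟩
  conv_lhs => rw [← idx.apply_symm_apply i]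
  exact (he _ _).2

end Classification

/-! ### Transport of triangular structures -/

section TensorPowers

variable {R A B : Type*} [CommSemiring R] [Semiring A] [Bialgebra R A] [Semiring B]
  [Bialgebra R B]

/-- The isomorphism `e ⊗ e`, for transporting elements of `A ⊗ A`. -/
def tensorSquare (e : A ≃ₐc[R] B) : A ⊗[R] A ≃ₐ[R] B ⊗[R] B :=
  Algebra.TensorProduct.congr (e : A ≃ₐ[R] B) (e : A ≃ₐ[R] B)

/-- The isomorphism `e ⊗ e ⊗ e`, for transporting elements of `A ⊗ A ⊗ A`. -/
def tensorCube (e : A ≃ₐc[R] B) : A ⊗[R] (A ⊗[R] A) ≃ₐ[R] B ⊗[R] (B ⊗[R] B) :=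
  Algebra.TensorProduct.congr (e : A ≃ₐ[R] B) (tensorSquare e)

variable (e : A ≃ₐc[R] B)

theorem tensorSquare_tmul (a b : A) : tensorSquare e (a ⊗ₜ[R] b) = e a ⊗ₜ[R] e b := rfl

theorem tensorCube_tmul (a : A) (z : A ⊗[R] A) :
    tensorCube e (a ⊗ₜ[R] z) = e a ⊗ₜ[R] tensorSquare e z := rfl

theorem tensorSquare_comul (a : A) :
    tensorSquare e (Coalgebra.comul (R := R) a) = Coalgebra.comul (R := R) (e a) :=
  CoalgHomClass.map_comp_comul_apply e a

theorem tensorSquare_comm (z : A ⊗[R] A) :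
    tensorSquare e (TensorProduct.comm R A A z) = TensorProduct.comm R B B (tensorSquare e z) := by
  induction z with
  | zero => simp only [map_zero]
  | add z w hz hw => simp only [map_add, hz, hw]
  | tmul a b => rfl

theorem tensorCube_assoc_tmul (z : A ⊗[R] A) (b : A) :
    tensorCube e (TensorProduct.assoc R A A A (z ⊗ₜ[R] b)) =
      TensorProduct.assoc R B B B (tensorSquare e z ⊗ₜ[R] e b) := by
  induction z with
  | zero => simp only [map_zero, TensorProduct.zero_tmul]
  | add z w hz hw => simp only [map_add, TensorProduct.add_tmul, hz, hw]
  | tmul a b => rfl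

theorem tensorCube_assoc_rTensor_comul (z : A ⊗[R] A) :
    tensorCube e
        (TensorProduct.assoc R A A A (LinearMap.rTensor A (Coalgebra.comul (R := R)) z)) =
      TensorProduct.assoc R B B B
        (LinearMap.rTensor B (Coalgebra.comul (R := R)) (tensorSquare e z)) := by
  induction z with
  | zero => simp only [map_zero]
  | add z w hz hw => simp only [map_add, hz, hw]
  | tmul a b =>
    rw [tensorSquare_tmul, LinearMap.rTensor_tmul, LinearMap.rTensor_tmul, tensorCube_assoc_tmul,
      tensorSquare_comul]

theorem tensorCube_lTensor_comul (z : A ⊗[R] A) :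
    tensorCube e (LinearMap.lTensor A (Coalgebra.comul (R := R)) z) =
      LinearMap.lTensor B (Coalgebra.comul (R := R)) (tensorSquare e z) := by
  induction z with
  | zero => simp only [map_zero]
  | add z w hz hw => simp only [map_add, hz, hw]
  | tmul a b =>
    rw [tensorSquare_tmul, LinearMap.lTensor_tmul, LinearMap.lTensor_tmul, tensorCube_tmul,
      tensorSquare_comul]

theorem map_lid_rTensor_counit (z : A ⊗[R] A) :
    e (TensorProduct.lid R A (LinearMap.rTensor A (Coalgebra.counit (R := R)) z)) =
      TensorProduct.lid R B
        (LinearMap.rTensor B (Coalgebra.counit (R := R)) (tensorSquare e z)) := by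
  induction z with
  | zero => simp only [map_zero]
  | add z w hz hw => simp only [map_add, hz, hw]
  | tmul a b => simp [tensorSquare_tmul]

theorem map_rid_lTensor_counit (z : A ⊗[R] A) :
    e (TensorProduct.rid R A (LinearMap.lTensor A (Coalgebra.counit (R := R)) z)) =
      TensorProduct.rid R B
        (LinearMap.lTensor B (Coalgebra.counit (R := R)) (tensorSquare e z)) := by
  induction z with
  | zero => simp only [map_zero]
  | add z w hz hw => simp only [map_add, hz, hw]
  | tmul a b => simp [tensorSquare_tmul]

end TensorPowers

section Transport

variable {H H' : Type*} [Ring H] [HopfAlgebra ℂ H] [Ring H'] [HopfAlgebra ℂ H']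

section Legs

variable (e : H ≃ₐc[ℂ] H') (z : H ⊗[ℂ] H)

theorem tensorCube_leg₁₂ : tensorCube e (leg₁₂ z) = leg₁₂ (tensorSquare e z) := by
  rw [leg₁₂, tensorCube_assoc_tmul, map_one, leg₁₂]

theorem tensorCube_leg₁₃ : tensorCube e (leg₁₃ z) = leg₁₃ (tensorSquare e z) := by
  simp only [leg₁₃]
  induction z with
  | zero => simp only [map_zero]
  | add z w hz hw => simp only [map_add, hz, hw]
  | tmul a b => simp [tensorSquare_tmul, tensorCube_tmul]

theorem tensorCube_leg₂₃ : tensorCube e (leg₂₃ z) = leg₂₃ (tensorSquare e z) := by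
  rw [leg₂₃, tensorCube_tmul, map_one, leg₂₃]

end Legs

theorem IsTriangular.map (e : H ≃ₐc[ℂ] H') {R : H ⊗[ℂ] H} (h : IsTriangular R) :
    IsTriangular (tensorSquare e R) where
  exists_inv := by
    obtain ⟨S, hRS, hSR, hcomul⟩ := h.exists_inv
    refine ⟨tensorSquare e S, ?_, ?_, fun g => ?_⟩
    · rw [← map_mul, hRS, map_one]
    · rw [← map_mul, hSR, map_one]
    · obtain ⟨g, rfl⟩ := EquivLike.surjective e g
      rw [← tensorSquare_comul, ← tensorSquare_comm, hcomul, map_mul, map_mul]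
  comul_left := by
    rw [← tensorCube_assoc_rTensor_comul, h.comul_left, map_mul, tensorCube_leg₁₃,
      tensorCube_leg₂₃]
  comul_right := by
    rw [← tensorCube_lTensor_comul, h.comul_right, map_mul, tensorCube_leg₁₃, tensorCube_leg₁₂]
  counit_left := by rw [← map_lid_rTensor_counit, h.counit_left, map_one]
  counit_right := by rw [← map_rid_lTensor_counit, h.counit_right, map_one]
  comm_mul_self := by rw [← tensorSquare_comm, ← map_mul, h.comm_mul_self, map_one]

theorem IsPositiveTensor.map {ι ι' : Type*} [Finite ι] {b : Module.Basis ι ℂ H}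
    {b' : Module.Basis ι' ℂ H'} {e : H ≃ₐc[ℂ] H'} (he : ∀ i, IsNonneg b' (e (b i)))
    {R : H ⊗[ℂ] H} (hR : IsPositiveTensor b R) : IsPositiveTensor b' (tensorSquare e R) :=
  fun i j => IsNonneg.map (b := b.tensorProduct b) (c := b'.tensorProduct b')
    (f := (tensorSquare e).toLinearMap)
    (fun w => by
      rw [Module.Basis.tensorProduct_apply', AlgEquiv.toLinearMap_apply, tensorSquare_tmul]
      exact (he _).tmul (he _))
    (fun w => hR w.1 w.2) (i, j)

end Transport

/-! ### Isomorphisms of factorizations and of Hopf algebras -/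

section FactorIso

variable {G G' : Type u} [Group G] [Group G'] {F : UniqueFactorization G}
  {F' : UniqueFactorization G'} {f : G ≃* G'}

namespace UniqueFactorization

namespace IsFactorIso

variable (hf : F.IsFactorIso F' f)

theorem posPow_map (p : F.pos) (x : F.neg) :
    F'.posPow (hf.posEquiv p) (hf.negEquiv x) = hf.posEquiv (F.posPow p x) :=
  F'.posBar_eq (hf.negEquiv (F.posOnNeg p x)) _ <| by
    simp only [coe_posEquiv, coe_negEquiv, ← map_mul, posOnNeg_mul_posPow]

theorem posOnNeg_map (p : F.pos) (x : F.neg) :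
    F'.posOnNeg (hf.posEquiv p) (hf.negEquiv x) = hf.negEquiv (F.posOnNeg p x) :=
  F'.negBar_eq _ (hf.posEquiv (F.posPow p x)) <| by
    simp only [coe_posEquiv, coe_negEquiv, ← map_mul, posOnNeg_mul_posPow]

theorem negPow_map (x : F.neg) (p : F.pos) :
    F'.negPow (hf.negEquiv x) (hf.posEquiv p) = hf.negEquiv (F.negPow x p) :=
  F'.negPart_eq (hf.posEquiv (F.negOnPos x p)) _ <| by
    simp only [coe_posEquiv, coe_negEquiv, ← map_mul, negOnPos_mul_negPow]

end IsFactorIso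

/-- The bijection `p x ↦ φ(p) ψ(x)` from `G = G₊ G₋` to `G' = G'₊ G'₋`. -/
def factorMap (φ : F.pos ≃ F'.pos) (ψ : F.neg ≃ F'.neg) : G ≃ G' :=
  (Subgroup.IsComplement.equiv F.isComplement).trans
    ((φ.prodCongr ψ).trans (Subgroup.IsComplement.equiv F'.isComplement).symm)

theorem factorMap_apply (φ : F.pos ≃ F'.pos) (ψ : F.neg ≃ F'.neg) (g : G) :
    factorMap φ ψ g = φ (F.posPart g) * ψ (F.negPart g) := rfl

section FactorMap

variable {φ : F.pos ≃* F'.pos} {ψ : F.neg ≃* F'.neg}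

theorem factorMap_mem_pos_iff (g : G) :
    factorMap φ.toEquiv ψ.toEquiv g ∈ F'.pos ↔ g ∈ F.pos := by
  have hneg {G : Type u} [Group G] (F : UniqueFactorization G) (g : G) :
      g ∈ F.pos ↔ F.negPart g = 1 := by
    refine ⟨fun hg => F.negPart_eq ⟨g, hg⟩ 1 (mul_one g).symm, fun hg => ?_⟩
    rw [← F.posPart_mul_negPart g, hg, Subgroup.coe_one, mul_one]
    exact (F.posPart g).2
  rw [hneg, hneg, factorMap_apply, negPart_mul]
  exact map_eq_one_iff ψ ψ.injective

theorem factorMap_mem_neg_iff (g : G) :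
    factorMap φ.toEquiv ψ.toEquiv g ∈ F'.neg ↔ g ∈ F.neg := by
  have hpos {G : Type u} [Group G] (F : UniqueFactorization G) (g : G) :
      g ∈ F.neg ↔ F.posPart g = 1 := by
    refine ⟨fun hg => F.posPart_eq 1 ⟨g, hg⟩ (one_mul g).symm, fun hg => ?_⟩
    rw [← F.posPart_mul_negPart g, hg, Subgroup.coe_one, one_mul]
    exact (F.negPart g).2
  rw [hpos, hpos, factorMap_apply, posPart_mul]
  exact map_eq_one_iff φ φ.injective

variable (hpow : ∀ p x, F'.posPow (φ p) (ψ x) = φ (F.posPow p x))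
  (hon : ∀ p x, F'.posOnNeg (φ p) (ψ x) = ψ (F.posOnNeg p x))

include hpow hon

theorem factorMap_mul (g h : G) : factorMap φ.toEquiv ψ.toEquiv (g * h) =
    factorMap φ.toEquiv ψ.toEquiv g * factorMap φ.toEquiv ψ.toEquiv h := by
  have hswap (x : F.neg) (q : F.pos) :
      (φ (F.negOnPos x q) * ψ (F.negPow x q) : G') = ψ x * φ q := by
    rw [← posOnNeg_mul_posPow, hpow, hon, posPow_negOnPos, posOnNeg_negOnPos]
  have hmul (p q : F.pos) (x y : F.neg) : (p * x * (q * y) : G) =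
      (p * F.negOnPos x q : F.pos) * (F.negPow x q * y : F.neg) := by
    simp only [Subgroup.coe_mul, mul_assoc]
    rw [← mul_assoc (x : G), ← negOnPos_mul_negPow, mul_assoc]
  have hprod : g * h = (F.posPart g * F.negOnPos (F.negPart g) (F.posPart h) : F.pos) *
      (F.negPow (F.negPart g) (F.posPart h) * F.negPart h : F.neg) := by
    rw [← hmul, posPart_mul_negPart, posPart_mul_negPart]
  change (φ (F.posPart (g * h)) * ψ (F.negPart (g * h)) : G') =
    φ (F.posPart g) * ψ (F.negPart g) * (φ (F.posPart h) * ψ (F.negPart h))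
  rw [F.posPart_eq _ _ hprod, F.negPart_eq _ _ hprod, map_mul, map_mul, Subgroup.coe_mul,
    Subgroup.coe_mul, mul_assoc, ← mul_assoc (φ _ : G') (ψ _ : G'), hswap, mul_assoc, mul_assoc]

theorem exists_isFactorIso : ∃ (f : G ≃* G') (hf : F.IsFactorIso F' f),
    hf.posEquiv = φ ∧ hf.negEquiv = ψ := by
  refine ⟨⟨factorMap φ.toEquiv ψ.toEquiv, factorMap_mul hpow hon⟩,
    ⟨factorMap_mem_pos_iff, factorMap_mem_neg_iff⟩, MulEquiv.ext fun p => Subtype.ext ?_,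
    MulEquiv.ext fun x => Subtype.ext ?_⟩
  · change (φ (F.posPart p) * ψ (F.negPart p) : G') = φ p
    rw [F.posPart_eq p 1 (mul_one _).symm, F.negPart_eq p 1 (mul_one _).symm, map_one,
      Subgroup.coe_one, mul_one]
  · change (φ (F.posPart x) * ψ (F.negPart x) : G') = ψ x
    rw [F.posPart_eq 1 x (one_mul _).symm, F.negPart_eq 1 x (one_mul _).symm, map_one,
      Subgroup.coe_one, one_mul]

end FactorMap

end UniqueFactorization

namespace Bicross

variable [Finite G] [Finite G'] (hf : F.IsFactorIso F' f)

/-- The isomorphism `{g} ↦ {f g}` of Hopf algebras. -/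
def bialgEquivOfIsFactorIso : Bicross F ≃ₐc[ℂ] Bicross F' :=
  let l : Bicross F ≃ₗ[ℂ] Bicross F' := (basis F).equiv (basis F') f.toEquiv
  have hl (p : F.pos) (x : F.neg) : l (el F p x) = el F' (hf.posEquiv p) (hf.negEquiv x) :=
    ((basis F).equiv_apply _ (basis F') f.toEquiv).trans (congrArg _ (map_mul f _ _))
  bialgEquivOfBasis (elBasis F) l
    (fun ⟨p, x⟩ ⟨q, y⟩ => by
      simp only [elBasis_apply, el_mul_el, hl, hf.posPow_map, EmbeddingLike.apply_eq_iff_eq,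
        ← map_mul]
      split_ifs
      · rw [hl]
      · rw [map_zero])
    fun ⟨p, x⟩ => by
      simp only [elBasis_apply, hl, comul_el, map_sum, TensorProduct.map_tmul,
        LinearEquiv.coe_coe]
      refine Fintype.sum_equiv hf.posEquiv.toEquiv _ _ fun q => ?_
      simp only [MulEquiv.toEquiv_eq_coe, EquivLike.coe_coe, hf.posOnNeg_map, map_mul, map_inv]

theorem bialgEquivOfIsFactorIso_basis (g : G) :
    bialgEquivOfIsFactorIso hf (basis F g) = basis F' (f g) :=
  (basis F).equiv_apply g (basis F') f.toEquiv

theorem bialgEquivOfIsFactorIso_el (p : F.pos) (x : F.neg) :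
    bialgEquivOfIsFactorIso hf (el F p x) = el F' (hf.posEquiv p) (hf.negEquiv x) :=
  (bialgEquivOfIsFactorIso_basis hf _).trans (congrArg _ (map_mul f _ _))

theorem tensorSquare_bialgEquivOfIsFactorIso_rMatrix {ξ : F.pos →* F.neg}
    {ξ' : F'.pos →* F'.neg} (hξ : ∀ p, hf.negEquiv (ξ p) = ξ' (hf.posEquiv p)) :
    tensorSquare (bialgEquivOfIsFactorIso hf) (F.rMatrix ξ ξ) = F'.rMatrix ξ' ξ' := by
  simp only [rMatrix_eq_tens, tens, Pi.one_apply, one_smul, map_sum, tensorSquare_tmul,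
    bialgEquivOfIsFactorIso_el]
  refine Fintype.sum_equiv hf.posEquiv.toEquiv _ _ fun p =>
    Fintype.sum_equiv hf.posEquiv.toEquiv _ _ fun q => ?_
  simp only [MulEquiv.toEquiv_eq_coe, EquivLike.coe_coe, map_inv, ← hf.negPow_map, hξ]

end Bicross

end FactorIso

namespace HopfSupport.IsBicross

variable {ι : Type*} {P : HopfSupport ι} {G G' : Type u} [Group G] [Group G']
  {F : UniqueFactorization G} {F' : UniqueFactorization G'} {idx : F.pos × F.neg ≃ ι}
  {idx' : F'.pos × F'.neg ≃ ι}

theorem exists_pos_equiv (h : P.IsBicross F idx) (h' : P.IsBicross F' idx') :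
    ∃ φ : F.pos ≃ F'.pos, ∀ p, idx (p, 1) = idx' (φ p, 1) := by
  choose φ hφ using fun p : F.pos => show ∃ q, idx (p, 1) = idx' (q, 1) by
    obtain ⟨⟨q, x⟩, hq⟩ := idx'.surjective (idx (p, 1))
    obtain rfl := (h'.unit_iff q x).1 (hq ▸ (h.unit_iff p 1).2 rfl)
    exact ⟨q, hq.symm⟩
  refine ⟨Equiv.ofBijective φ ⟨fun p q hpq => ?_, fun q => ?_⟩, hφ⟩
  · have hidx : idx (p, 1) = idx (q, 1) := by rw [hφ, hφ, hpq]
    exact (Prod.mk.inj (idx.injective hidx)).1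
  · obtain ⟨⟨p, x⟩, hp⟩ := idx.surjective (idx' (q, 1))
    obtain rfl := (h.unit_iff p x).1 (hp ▸ (h'.unit_iff q 1).2 rfl)
    exact ⟨p, (Prod.mk.inj (idx'.injective ((hφ p).symm.trans hp))).1⟩

theorem exists_neg_equiv (h : P.IsBicross F idx) (h' : P.IsBicross F' idx') :
    ∃ ψ : F.neg ≃ F'.neg, ∀ x, idx (1, x) = idx' (1, ψ x) := by
  choose ψ hψ using fun x : F.neg => show ∃ y, idx (1, x) = idx' (1, y) by
    obtain ⟨⟨p, y⟩, hy⟩ := idx'.surjective (idx (1, x))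
    obtain rfl := (h'.counit_iff p y).1 (hy ▸ (h.counit_iff 1 x).2 rfl)
    exact ⟨y, hy.symm⟩
  refine ⟨Equiv.ofBijective ψ ⟨fun x y hxy => ?_, fun y => ?_⟩, hψ⟩
  · have hidx : idx (1, x) = idx (1, y) := by rw [hψ, hψ, hxy]
    exact (Prod.mk.inj (idx.injective hidx)).2
  · obtain ⟨⟨p, x⟩, hx⟩ := idx.surjective (idx' (1, y))
    obtain rfl := (h.counit_iff p x).1 (hx ▸ (h'.counit_iff 1 y).2 rfl)
    exact ⟨x, (Prod.mk.inj (idx'.injective ((hψ x).symm.trans hx))).2⟩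

theorem exists_isFactorIso (h : P.IsBicross F idx) (h' : P.IsBicross F' idx') :
    ∃ (f : G ≃* G') (hf : F.IsFactorIso F' f),
      ∀ p x, idx (p, x) = idx' (hf.posEquiv p, hf.negEquiv x) := by
  obtain ⟨φ, hφ⟩ := h.exists_pos_equiv h'
  obtain ⟨ψ, hψ⟩ := h.exists_neg_equiv h'
  have hidx (p : F.pos) (x : F.neg) : idx (p, x) = idx' (φ p, ψ x) := by
    obtain ⟨⟨q, y⟩, hq⟩ := idx'.surjective (idx (p, x))
    have hmul := (h.mul_iff p 1 p x _).2 ⟨F.posPow_one p, rfl⟩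
    have hcomul := (h.comul_iff p x 1 x _).2 ⟨F.one_posOnNeg x, rfl⟩
    rw [_root_.one_mul, hφ, ← hq, h'.mul_iff, F'.posPow_one] at hmul
    rw [_root_.mul_one, hψ, ← hq, h'.comul_iff, F'.one_posOnNeg] at hcomul
    rw [← hq, hmul.1, hcomul.1]
  have hmul (p : F.pos) (x y : F.neg) :
      F'.posPow (φ p) (ψ x) = φ (F.posPow p x) ∧ ψ (x * y) = ψ x * ψ y := by
    have hmul := (h.mul_iff p x _ y _).2 ⟨rfl, rfl⟩
    simp only [hidx, h'.mul_iff, EmbeddingLike.apply_eq_iff_eq, Prod.mk.injEq] at hmul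
    exact ⟨hmul.1, hmul.2.2⟩
  have hcomul (p q : F.pos) (x : F.neg) :
      F'.posOnNeg (φ q) (ψ x) = ψ (F.posOnNeg q x) ∧ φ (p * q) = φ p * φ q := by
    have hcomul := (h.comul_iff p _ q x _).2 ⟨rfl, rfl⟩
    simp only [hidx, h'.comul_iff, EmbeddingLike.apply_eq_iff_eq, Prod.mk.injEq] at hcomul
    exact ⟨hcomul.1, hcomul.2.1⟩
  obtain ⟨f, hf, hpos, hneg⟩ := UniqueFactorization.exists_isFactorIso
    (φ := ⟨φ, fun p q => (hcomul p q 1).2⟩) (ψ := ⟨ψ, fun x y => (hmul 1 x y).2⟩)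
    (fun p x => (hmul p x 1).1) fun p x => (hcomul 1 p x).1
  exact ⟨f, hf, fun p x => by rw [hpos, hneg]; exact hidx p x⟩

end HopfSupport.IsBicross

theorem repr_eq_of_apply_basis_eq_smul {ι κ R V W : Type*} [CommSemiring R] [AddCommMonoid V]
    [Module R V] [AddCommMonoid W] [Module R W] {b : Module.Basis ι R V} {c : Module.Basis κ R W}
    {l : V →ₗ[R] W} {idx : κ ≃ ι} {s : κ → R} (hl : ∀ k, l (b (idx k)) = s k • c k) (v : V)
    (k : κ) : c.repr (l v) k = s k * b.repr v (idx k) := by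
  have hcoord : (c.coord k).comp l = s k • b.coord (idx k) := by
    refine (b.reindex idx.symm).ext fun k' => ?_
    rcases eq_or_ne k' k with rfl | hne
    · simp [hl]
    · simp [hl, hne]
  exact LinearMap.congr_fun hcoord v

section Rescaling

open StructureConstants

variable {ι κ R H H' : Type*} [CommSemiring R] [Semiring H] [Bialgebra R H] [Semiring H']
  [Bialgebra R H'] {b : Module.Basis ι R H} {c : Module.Basis κ R H'} {idx : κ ≃ ι}
  {e : H ≃ₐc[R] H'} {s : κ → R} (he : ∀ k, e (b (idx k)) = s k • c k)

include he

theorem mul_mulCoeff_of_apply_basis_eq_smul (i j k : κ) :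
    s k * mulCoeff b (idx i) (idx j) (idx k) = s i * s j * mulCoeff c i j k := by
  rw [mulCoeff, ← repr_eq_of_apply_basis_eq_smul (l := (e : H →ₐ[R] H').toLinearMap) he]
  simp [mulCoeff, he, smul_smul, mul_comm (s i)]

theorem mul_comulCoeff_of_apply_basis_eq_smul (i j k : κ) :
    s i * s j * comulCoeff b (idx i) (idx j) (idx k) = s k * comulCoeff c i j k := by
  have hl (w : κ × κ) : (tensorSquare e).toLinearMap
      (b.tensorProduct b (idx.prodCongr idx w)) = (s w.1 * s w.2) • c.tensorProduct c w := by
    rw [Module.Basis.tensorProduct_apply', AlgEquiv.toLinearMap_apply, Equiv.prodCongr_apply,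
      Prod.map_fst, Prod.map_snd, tensorSquare_tmul, he, he, TensorProduct.smul_tmul_smul,
      Module.Basis.tensorProduct_apply']
  have hrepr := repr_eq_of_apply_basis_eq_smul hl (Coalgebra.comul (R := R) (b (idx k))) (i, j)
  rw [AlgEquiv.toLinearMap_apply, tensorSquare_comul, he, map_smul, map_smul] at hrepr
  exact hrepr.symm

end Rescaling

section Uniqueness

open StructureConstants

variable {G : Type u} [Group G] [Finite G] {F : UniqueFactorization G}

namespace Bicross

theorem mulCoeff_elBasis_ne_zero_iff (p q : F.pos) (x y : F.neg) (w : F.pos × F.neg) :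
    mulCoeff (elBasis F) (p, x) (q, y) w ≠ 0 ↔ F.posPow p x = q ∧ w = (p, x * y) := by
  classical
  rw [mulCoeff, elBasis_apply, elBasis_apply, el_mul_el]
  split_ifs with hpx
  · simp [hpx, ← elBasis_apply, Finsupp.single_apply, eq_comm (a := w)]
  · simp [hpx]

theorem comulCoeff_elBasis_ne_zero_iff (p q : F.pos) (x y : F.neg) (w : F.pos × F.neg) :
    comulCoeff (elBasis F) (p, x) (q, y) w ≠ 0 ↔ F.posOnNeg q y = x ∧ w = (p * q, y) := by
  classical
  obtain ⟨r, z⟩ := w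
  have hrepr (k : F.pos) : ((elBasis F).tensorProduct (elBasis F)).repr
      (el F (r * k⁻¹) (F.posOnNeg k z) ⊗ₜ[ℂ] el F k z) ((p, x), (q, y)) =
      if k = q then if F.posOnNeg q y = x ∧ (r, z) = (p * q, y) then 1 else 0 else 0 := by
    simp only [← elBasis_apply, Module.Basis.tensorProduct_repr_tmul_apply,
      Module.Basis.repr_self, Finsupp.single_apply, Prod.mk.injEq]
    rcases eq_or_ne k q with rfl | hk
    · simp only [true_and, if_true, mul_inv_eq_iff_eq_mul, smul_eq_mul]
      split_ifs with h <;> simp_all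
    · simp [hk]
  rw [comulCoeff, elBasis_apply, comul_el, map_sum, Finsupp.finsetSum_apply,
    Finset.sum_congr rfl fun k _ => hrepr k, Finset.sum_ite_eq' Finset.univ]
  simp

theorem elBasis_repr_one_ne_zero_iff (p : F.pos) (x : F.neg) :
    (elBasis F).repr 1 (p, x) ≠ 0 ↔ x = 1 := by
  classical
  simp [one_eq, ← elBasis_apply, Finsupp.single_apply, eq_comm (a := x)]

end Bicross

theorem IsPositiveBasis.isBicross {H ι : Type*} [Ring H] [HopfAlgebra ℂ H] [Fintype ι]
    {b : Module.Basis ι ℂ H} (hb : IsPositiveBasis b) {idx : F.pos × F.neg ≃ ι}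
    (e : H ≃ₐc[ℂ] Bicross F) {s : F.pos × F.neg → ℂ} (hs : ∀ w, s w ≠ 0)
    (he : ∀ w, e (b (idx w)) = s w • Bicross.elBasis F w) : hb.support.IsBicross F idx where
  mul_iff p x q y k := by
    obtain ⟨w, rfl⟩ := idx.surjective k
    have hmul := mul_mulCoeff_of_apply_basis_eq_smul he (p, x) (q, y) w
    change mulCoeff b (idx (p, x)) (idx (q, y)) (idx w) ≠ 0 ↔ _
    rw [← mul_ne_zero_iff_left (hs w), hmul, mul_ne_zero_iff_left (mul_ne_zero (hs _) (hs _)),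
      Bicross.mulCoeff_elBasis_ne_zero_iff, idx.apply_eq_iff_eq]
  comul_iff p x q y k := by
    obtain ⟨w, rfl⟩ := idx.surjective k
    have hcomul := mul_comulCoeff_of_apply_basis_eq_smul he (p, x) (q, y) w
    change comulCoeff b (idx (p, x)) (idx (q, y)) (idx w) ≠ 0 ↔ _
    rw [← mul_ne_zero_iff_left (mul_ne_zero (hs (p, x)) (hs (q, y))), hcomul,
      mul_ne_zero_iff_left (hs w), Bicross.comulCoeff_elBasis_ne_zero_iff, idx.apply_eq_iff_eq]
  unit_iff p x := by
    have hone := repr_eq_of_apply_basis_eq_smul (l := (e : H →ₐ[ℂ] Bicross F).toLinearMap) he 1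
      (p, x)
    change b.repr 1 (idx (p, x)) ≠ 0 ↔ _
    rw [← mul_ne_zero_iff_left (hs _), ← hone, AlgHom.toLinearMap_apply, map_one,
      Bicross.elBasis_repr_one_ne_zero_iff]
  counit_iff p x := by
    have hcounit := CoalgHomClass.counit_comp_apply e (b (idx (p, x)))
    rw [he, map_smul, Bicross.elBasis_apply, Bicross.counit_el] at hcounit
    change Coalgebra.counit (R := ℂ) (b (idx (p, x))) ≠ 0 ↔ _
    rw [← hcounit, smul_eq_mul, mul_ne_zero_iff_left (hs _), ne_eq, ite_eq_right_iff]
    simp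

namespace Bicross

variable {G' : Type u} [Group G'] [Finite G'] {F' : UniqueFactorization G'}

theorem exists_isFactorIso_of_bialgEquiv {e : Bicross F ≃ₐc[ℂ] Bicross F'} {σ : G ≃ G'}
    {c : G → ℂ} (hc : ∀ g, c g ≠ 0) (he : ∀ g, e (basis F g) = c g • basis F' (σ g)) :
    ∃ f : G ≃* G', F.IsFactorIso F' f ∧ ∀ g, f g = σ g := by
  have := Fintype.ofFinite G
  have hb : IsPositiveBasis (basis F) := isPositiveBasis
  have hbicross : hb.support.IsBicross F (Subgroup.IsComplement.equiv F.isComplement).symm :=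
    hb.isBicross (BialgEquiv.refl ℂ _) (s := 1) (fun _ => one_ne_zero) fun w => by
      rw [Pi.one_apply, one_smul, elBasis, Module.Basis.reindex_apply]
      rfl
  have hbicross' : hb.support.IsBicross F'
      ((Subgroup.IsComplement.equiv F'.isComplement).symm.trans σ.symm) :=
    hb.isBicross e (s := fun w => c (σ.symm (w.1 * w.2 : G'))) (fun _ => hc _) fun w => by
      rw [he, Equiv.trans_apply, Equiv.apply_symm_apply, elBasis, Module.Basis.reindex_apply]
      rfl
  obtain ⟨f, hf, hidx⟩ := hbicross.exists_isFactorIso hbicross'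
  have hσ (p : F.pos) (x : F.neg) : σ (p * x) = hf.posEquiv p * hf.negEquiv x :=
    σ.eq_symm_apply.1 (hidx p x)
  refine ⟨f, hf, fun g => ?_⟩
  rw [← F.posPart_mul_negPart g, hσ, map_mul, hf.coe_posEquiv, hf.coe_negEquiv]

theorem tensorSquare_rMatrix_eq_tens {e : Bicross F ≃ₐc[ℂ] Bicross F'} {f : G ≃* G'}
    (hf : F.IsFactorIso F' f) {c : G → ℂ} (he : ∀ g, e (basis F g) = c g • basis F' (f g))
    (ξ η : F.pos →* F.neg) : tensorSquare e (F.rMatrix ξ η) = tens F'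
      (fun p q => c ((hf.posEquiv.symm p) * (F.negPow (η (hf.posEquiv.symm q))
        (hf.posEquiv.symm p) : G)⁻¹) * c (hf.posEquiv.symm q * ξ (hf.posEquiv.symm p)))
      (fun p q => hf.negEquiv (F.negPow (η (hf.posEquiv.symm q)) (hf.posEquiv.symm p))⁻¹)
      fun p _ => hf.negEquiv (ξ (hf.posEquiv.symm p)) := by
  simp only [UniqueFactorization.rMatrix, tens, map_sum, tensorSquare_tmul, he,
    TensorProduct.smul_tmul_smul, map_mul, map_inv]
  refine Fintype.sum_equiv hf.posEquiv.toEquiv _ _ fun p =>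
    Fintype.sum_equiv hf.posEquiv.toEquiv _ _ fun q => ?_
  simp [el, hf.coe_posEquiv, hf.coe_negEquiv]

theorem negEquiv_apply_eq_of_tensorSquare_rMatrix_eq {e : Bicross F ≃ₐc[ℂ] Bicross F'}
    {f : G ≃* G'} (hf : F.IsFactorIso F' f) {c : G → ℂ} (hc : ∀ g, c g ≠ 0)
    (he : ∀ g, e (basis F g) = c g • basis F' (f g)) {ξ η : F.pos →* F.neg}
    {ξ' η' : F'.pos →* F'.neg} (hR : tensorSquare e (F.rMatrix ξ η) = F'.rMatrix ξ' η')
    (p : F.pos) : hf.negEquiv (ξ p) = ξ' (hf.posEquiv p) := by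
  rw [tensorSquare_rMatrix_eq_tens hf he, rMatrix_eq_tens] at hR
  have hξ := (eq_of_tens_eq hR (p := hf.posEquiv p) (q := 1) (mul_ne_zero (hc _) (hc _))).2.2
  rwa [MulEquiv.symm_apply_apply] at hξ

end Bicross

end Uniqueness

/-! ### Classification -/

/-- The correspondence of the second kind of data with the first on objects: `H(G; G₊, G₋)` with
the basis `G` and the triangular structure `R_ξ`. -/
def AbelianFact.toPosTriHopf (X : AbelianFact.{u}) : PosTriHopf.{u} where
  H := Bicross X.1.F
  ι := X.1.G
  b := Bicross.basis X.1.F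
  R := X.1.F.rMatrix X.1.ξ X.1.ξ
  isPositiveBasis := Bicross.isPositiveBasis
  isTriangular :=
    Bicross.isTriangular_rMatrix (UniqueFactorization.isAbelianNormal_iff_isBraided.1 X.2)
  isPositiveTensor := Bicross.isPositiveTensor_rMatrix X.1.ξ X.1.ξ

theorem AbelianFact.toPosTriHopf_iso_iff (X Y : AbelianFact.{u}) :
    PosTriHopf.Iso X.toPosTriHopf Y.toPosTriHopf ↔ FactHom.Iso X.1 Y.1 := by
  constructor
  · rintro ⟨e, ⟨σ, c, he⟩, hR⟩
    have hc (g : X.1.G) : (c g : ℂ) ≠ 0 := by exact_mod_cast (he g).1.ne'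
    obtain ⟨f, hf, hσ⟩ := Bicross.exists_isFactorIso_of_bialgEquiv (G := X.1.G) (G' := Y.1.G)
      (e := e) hc fun g => (he g).2
    refine ⟨f, hf.1, hf.2, fun p q hpq => ?_⟩
    obtain rfl : hf.posEquiv p = q := Subtype.ext hpq
    have hξ := Bicross.negEquiv_apply_eq_of_tensorSquare_rMatrix_eq (e := e) hf hc
      (fun g => (he g).2.trans (by rw [hσ]; rfl)) hR p
    exact congrArg Subtype.val hξ
  · intro h
    obtain ⟨f, hf, hξ⟩ := h.exists_isFactorIso
    refine ⟨Bicross.bialgEquivOfIsFactorIso hf, ⟨f.toEquiv, fun _ => 1, fun g => ⟨one_pos, ?_⟩⟩,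
      Bicross.tensorSquare_bialgEquivOfIsFactorIso_rMatrix hf hξ⟩
    rw [Complex.ofReal_one, one_smul]
    exact Bicross.bialgEquivOfIsFactorIso_basis hf g

theorem PosTriHopf.exists_iso (Y : PosTriHopf.{u}) :
    ∃ X : AbelianFact.{u}, PosTriHopf.Iso X.toPosTriHopf Y := by
  obtain ⟨G, _, _, F, e, σ, c, he⟩ := Y.isPositiveBasis.exists_bialgEquiv
  have hpos : IsPositiveTensor (Bicross.basis F) (tensorSquare e Y.R) :=
    Y.isPositiveTensor.map fun i => by
      rw [(he i).2]
      exact (IsNonneg.self _).smul (by exact_mod_cast (he i).1.le)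
  obtain ⟨ξ, hξ, hR⟩ := Bicross.exists_isBraided_of_isTriangular (Y.isTriangular.map e) hpos
  exact ⟨⟨{ G := G, F := F, ξ := ξ }, UniqueFactorization.isAbelianNormal_iff_isBraided.2 hξ⟩,
    PosTriHopf.setoid.symm ⟨e, ⟨σ, c, he⟩, hR.symm⟩⟩

/-- The bijection of the isomorphism classes of the second kind of data with those of the first,
given by `AbelianFact.toPosTriHopf`. -/
def abelianHopfEquiv : Quotient AbelianFact.setoid.{u} ≃ Quotient PosTriHopf.setoid.{u} :=
  Equiv.ofBijective
    (Quotient.map AbelianFact.toPosTriHopf fun X Y h => (X.toPosTriHopf_iso_iff Y).2 h) <| by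
      constructor
      · rintro ⟨X⟩ ⟨Y⟩ h
        exact Quotient.sound ((X.toPosTriHopf_iso_iff Y).1 (Quotient.exact h))
      · rintro ⟨Y⟩
        obtain ⟨X, hX⟩ := Y.exists_iso
        exact ⟨⟦X⟧, Quotient.sound hX⟩

end

/-- The four kinds of data correspond bijectively up to isomorphism, through the explicit
constructions; moreover, on a fixed unique factorization, `ξ ↦ R` is a bijection onto the positive
triangular structures, the second and third conditions on `ξ` agree, and the structure given by a
pair `(ξ, η)` is triangular exactly when `ξ = η`. -/
theorem theorem4 :
    (∃ (e₂₁ : Quotient AbelianFact.setoid.{u} ≃ Quotient PosTriHopf.setoid.{u})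
        (e₂₃ : Quotient AbelianFact.setoid.{u} ≃ Quotient BraidedFact.setoid.{u})
        (e₂₄ : Quotient AbelianFact.setoid.{u} ≃ Quotient CycleData.setoid.{u}),
      (∀ X : AbelianFact.{u},
        ∃ (hb : IsPositiveBasis (Bicross.basis X.1.F))
          (hR : IsTriangular (X.1.F.rMatrix X.1.ξ X.1.ξ))
          (hp : IsPositiveTensor (Bicross.basis X.1.F) (X.1.F.rMatrix X.1.ξ X.1.ξ)),
          e₂₁ ⟦X⟧ = ⟦{ H := Bicross X.1.F, ι := X.1.G, b := Bicross.basis X.1.F,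
                       R := X.1.F.rMatrix X.1.ξ X.1.ξ, isPositiveBasis := hb,
                       isTriangular := hR, isPositiveTensor := hp }⟧) ∧
      (∀ X : AbelianFact.{u}, ∃ h : X.1.F.IsBraided X.1.ξ, e₂₃ ⟦X⟧ = ⟦⟨X.1, h⟩⟧) ∧
      (∀ X : AbelianFact.{u}, e₂₄ ⟦X⟧ = ⟦X.toCycleData⟧) ∧
      (∀ Y : CycleData.{u}, ∃ h : Y.toFactHom.F.IsAbelianNormal Y.toFactHom.ξ,
        e₂₄.symm ⟦Y⟧ = ⟦⟨Y.toFactHom, h⟩⟧)) ∧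
    (∀ (G : Type u) [Group G] [Finite G] (F : UniqueFactorization G),
      Set.BijOn (fun ξ => F.rMatrix ξ ξ) {ξ | F.IsAbelianNormal ξ}
        {R | IsTriangular R ∧ IsPositiveTensor (Bicross.basis F) R} ∧
      (∀ ξ : F.pos →* F.neg, F.IsAbelianNormal ξ ↔ F.IsBraided ξ) ∧
      (∀ ξ η : F.pos →* F.neg, F.IsQuasiTriangularPair ξ η →
        (IsTriangular (F.rMatrix ξ η) ↔ ξ = η))) := by
  refine ⟨⟨abelianHopfEquiv, abelianBraidedEquiv, abelianCycleEquiv,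
    fun X => ⟨Bicross.isPositiveBasis,
      Bicross.isTriangular_rMatrix (UniqueFactorization.isAbelianNormal_iff_isBraided.1 X.2),
      Bicross.isPositiveTensor_rMatrix _ _, rfl⟩,
    fun X => ⟨UniqueFactorization.isAbelianNormal_iff_isBraided.1 X.2, rfl⟩, fun X => rfl,
    fun Y => ⟨Y.isAbelianNormal_ξ, rfl⟩⟩, ?_⟩
  intro G _ _ F
  exact ⟨Bicross.bijOn_rMatrix F, fun ξ => UniqueFactorization.isAbelianNormal_iff_isBraided,
    fun ξ η h => Bicross.isTriangular_rMatrix_iff h⟩
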